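/- Conventions. The Fourier transform on $L^2(\mathbb R^2)$ is the unitary extension of $\hat f(\xi)=\int f(x)e^{-2\pi i\langle x,\xi\rangle}\,dx$. For $a>0$, $s\in\mathbb R$ and $c=(c_1,c_2)\in(0,\infty)^2$ put $$A_a=\begin{pmatrix}a&0\\0&\sqrt a\end{pmatrix},\qquad S_s=\begin{pmatrix}1&s\\0&1\end{pmatrix},\qquad M_c=\begin{pmatrix}c_1&0\\0&c_2\end{pmatrix}.$$ Let $\mathcal C=\{\xi\in\mathbb R^2:|\xi_1|\ge1,\ |\xi_2/\xi_1|\le1\}$ and $L^2(\mathcal C)=\{f\in L^2(\mathbb R^2):\operatorname{supp}\hat f\subseteq\mathcal C\}$. For $\psi\in L^2(\mathbb R^2)$ the regular shearlet system with sampling matrix $M_c$ is the family $$\psi_{j,k,m}(x)=2^{3j/4}\,\psi(S_{-k}A_{2^j}x-M_cm),\qquad j\ge0,\ k\in\mathbb Z,\ |k|\le\lceil2^{j/2}\rceil,\ m\in\mathbb Z^2 .$$ It is a frame for $L^2(\mathcal C)$ if there are $0<A\le B<\infty$ with $A\|f\|^2\le\sum_{j,k,m}|\langle f,\psi_{j,k,m}\rangle|^2\le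 B\|f\|^2$ for all $f\in L^2(\mathcal C)$; the frame bounds are the largest such $A$ and the smallest such $B$. Further put $$\Phi(\xi,\omega)=\sum_{j\ge0}\ \sum_{|k|\le\lceil2^{j/2}\rceil}|\hat\psi(S_k^TA_{2^{-j}}\xi)|\,|\hat\psi(S_k^TA_{2^{-j}}\xi+\omega)|,\qquad \Gamma(\omega)=\operatorname*{ess\,sup}_{\xi\in\mathcal C}\Phi(\xi,\omega),$$ $$L_{\inf}=\operatorname*{ess\,inf}_{\xi\in\mathcal C}\Phi(\xi,0),\quad L_{\sup}=\operatorname*{ess\,sup}_{\xi\in\mathcal C}\Phi(\xi,0),\quad R(c)=\sum_{m\in\mathbb Z^2\setminus\{0\}}\bigl[\Gamma(M_c^{-1}m)\,\Gamma(-M_c^{-1}m)\bigr]^{1/2}.$$ Theorem. Let $K,L$ be integers with $L\ge10$ and $\tfrac{3L}2\le K\le3L-2$. Let $m_0$ be a $1$-periodic trigonometric polynomial with real coefficients, $m_0(0)=1$ and $$|m_0(\xi)|^2=(\cos\pi\xi)^{2K}\sum_{n=0}^{L-1}\binom{K-1+n}{n}(\sin\pi\xi)^{2n}\qquad(\xi\in\mathbb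 R),$$ and let $m_1:\mathbb R\to\mathbb C$ be measurable with $|m_1(\xi)|^2=|m_0(\xi+\tfrac12)|^2$ for all $\xi\in\mathbb R$. Then the product $\hat\phi(\xi)=\prod_{j=0}^\infty m_0(2^{-j}\xi)$ converges for every $\xi\in\mathbb R$, and there is a function $\psi\in L^2(\mathbb R^2)$ with $$\hat\psi(\xi)=m_1(4\xi_1)\,\hat\phi(\xi_1)\,\hat\phi(2\xi_2)\qquad\text{for a.e. }\xi=(\xi_1,\xi_2)\in\mathbb R^2;$$ if $m_1$ is a $1$-periodic trigonometric polynomial, then $\psi$ is compactly supported. Moreover $L_{\sup}<\infty$, and there is $\hat c_1>0$ such that for all $c=(c_1,c_2)$ with $0<c_2\le c_1\le\hat c_1$ the following hold. 1. The regular shearlet system generated by $\psi$ with sampling matrix $M_c$ is a frame for $L^2(\mathcal C)$. 2. For every integer $J_0\ge0$ with $2^{-J_0}\bigl(1-|m_0(\tfrac16)|^2\bigr)\le\tfrac12$, the number $$\tilde L_{\inf}=\bigl|m_0(\tfrac16)\bigr|^2\Bigl(\prod_{j=0}^{J_0-1}\bigl|m_0(\tfrac{2^{-j}}6)\bigr|^2\cdot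 e^{-2^{-J_0+2}(1-|m_0(\frac16)|^2)}\Bigr)^2$$ satisfies $R(c)<\tilde L_{\inf}\le L_{\inf}$. 3. For all real numbers $\tilde L_{\inf}$ and $\tilde L_{\sup}$ with $R(c)<\tilde L_{\inf}\le L_{\inf}$ and $L_{\sup}\le\tilde L_{\sup}$, the frame bounds $A$ and $B$ satisfy $$\frac1{|\det M_c|}\bigl[\tilde L_{\inf}-R(c)\bigr]\le A\le B\le\frac1{|\det M_c|}\bigl[\tilde L_{\sup}+R(c)\bigr].$$ -/

import Mathlib

open MeasureTheory
open scoped ENNReal FourierTransform ComplexConjugate Matrix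

namespace Shearlet

noncomputable section

/-- The Euclidean plane. -/
abbrev Plane : Type := EuclideanSpace ℝ (Fin 2)

/-- The Hilbert space `L²(ℝ²)` of complex-valued functions. On it `𝓕` is Mathlib's unitary Fourier
transform, which extends `f ↦ ∫ f(x) exp(-2πi⟨x,ξ⟩) dx`. -/
abbrev L2 : Type := Lp ℂ 2 (volume : Measure Plane)

/-! ### Parabolic scaling, shearing and sampling matrices -/

/-- The parabolic scaling matrix `A_a = diag(a, √a)`. -/
def scaleMat (a : ℝ) : Matrix (Fin 2) (Fin 2) ℝ := !![a, 0; 0, √a]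

/-- The shear matrix `S_s`. -/
def shearMat (s : ℝ) : Matrix (Fin 2) (Fin 2) ℝ := !![1, s; 0, 1]

/-- The sampling matrix `M_c = diag(c₁, c₂)`. -/
def sampMat (c₁ c₂ : ℝ) : Matrix (Fin 2) (Fin 2) ℝ := !![c₁, 0; 0, c₂]

/-- A matrix acting on the plane by `x ↦ A x`. -/
abbrev act (A : Matrix (Fin 2) (Fin 2) ℝ) (x : Plane) : Plane := Matrix.toEuclideanLin A x

/-- An integer vector as a point of the plane. -/
def latticePt (m : Fin 2 → ℤ) : Plane := WithLp.toLp 2 fun i => (m i : ℝ)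

/-- The admissible shears at scale `j`: integers `k` with `|k| ≤ ⌈2^{j/2}⌉`. -/
def shears (j : ℕ) : Finset ℤ :=
  Finset.Icc (-⌈(2 : ℝ) ^ ((j : ℝ) / 2)⌉) ⌈(2 : ℝ) ^ ((j : ℝ) / 2)⌉

/-! ### Regular shearlet systems -/

/-- The function `ψ_{j,k,m}(x) = 2^{3j/4} ψ(S_{-k} A_{2^j} x - M_c m)`. This is
`a^{-3/4} ψ(A_a⁻¹ S_s⁻¹ (x - t))` at the regular sampling point
`(a, s, t) = (2^{-j}, k 2^{-j/2}, S_{k 2^{-j/2}} A_{2^{-j}} M_c m)`. -/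
def shearletFun (c₁ c₂ : ℝ) (ψ : Plane → ℂ) (j : ℕ) (k : ℤ) (m : Fin 2 → ℤ) (x : Plane) : ℂ :=
  (((2 : ℝ) ^ (3 * (j : ℝ) / 4) : ℝ) : ℂ) *
    ψ (act (shearMat (-(k : ℝ)) * scaleMat ((2 : ℝ) ^ j)) x - act (sampMat c₁ c₂) (latticePt m))

/-- An affine change of variables preserves square integrability. -/
theorem memLp_comp_affine {ψ : Plane → ℂ} (hψ : MemLp ψ 2 volume)
    {A : Matrix (Fin 2) (Fin 2) ℝ} (hA : A.det ≠ 0) (b : Plane) :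
    MemLp (fun x => ψ (act A x - b)) 2 volume := by
  have hdet : LinearMap.det (Matrix.toEuclideanLin A) ≠ 0 := by
    rwa [LinearMap.det_toLpLin]
  have h1 : MemLp (fun y => ψ (y - b)) 2 (volume : Measure Plane) :=
    hψ.comp_measurePreserving (measurePreserving_sub_right volume b)
  have hmeas : Measurable (Matrix.toEuclideanLin A : Plane → Plane) :=
    (LinearMap.continuous_of_finiteDimensional _).measurable
  refine MemLp.comp_of_map (g := fun y => ψ (y - b)) (f := Matrix.toEuclideanLin A) ?_
    hmeas.aemeasurable
  rw [Measure.map_linearMap_addHaar_eq_smul_addHaar volume hdet]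
  exact h1.smul_measure ENNReal.ofReal_ne_top

theorem memLp_shearletFun (c₁ c₂ : ℝ) (ψ : L2) (j : ℕ) (k : ℤ) (m : Fin 2 → ℤ) :
    MemLp (shearletFun c₁ c₂ ψ j k m) 2 volume := by
  refine (memLp_comp_affine (Lp.memLp ψ) ?_ _).const_mul _
  simp [shearMat, scaleMat, Matrix.det_fin_two]

/-- The indices `(j, k, m)` with `j ≥ 0`, `|k| ≤ ⌈2^{j/2}⌉` and `m ∈ ℤ²`. -/
abbrev Index : Type := (Σ j : ℕ, {k : ℤ // k ∈ shears j}) × (Fin 2 → ℤ)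

/-- The regular shearlet system generated by `ψ` with sampling matrix `M_c`. -/
def system (c₁ c₂ : ℝ) (ψ : L2) (i : Index) : L2 :=
  (memLp_shearletFun c₁ c₂ ψ i.1.1 i.1.2 i.2).toLp

/-! ### The horizontal cone and its `L²` space -/

/-- The horizontal (truncated, two-sided) frequency cone. -/
def cone : Set Plane :=
  {ξ | 1 ≤ ξ 0 ∧ |ξ 1 / ξ 0| ≤ 1} ∪ {ξ | ξ 0 ≤ -1 ∧ |ξ 1 / ξ 0| ≤ 1}

/-- `L²(𝒞)`: the square-integrable functions whose Fourier transform is supported in the cone. -/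
def coneL2 : Submodule ℂ L2 where
  carrier := {f | ∀ᵐ ξ ∂(volume : Measure Plane), ξ ∉ cone → (𝓕 f : L2) ξ = 0}
  zero_mem' := by
    have h0 : (𝓕 (0 : L2) : L2) = 0 := (Lp.fourierTransformₗᵢ Plane ℂ).map_zero
    change ∀ᵐ ξ ∂(volume : Measure Plane), ξ ∉ cone → (𝓕 (0 : L2) : L2) ξ = 0
    rw [h0]
    filter_upwards [Lp.coeFn_zero ℂ 2 (volume : Measure Plane)] with ξ h _
    exact h
  add_mem' := by
    intro f g hf hg
    have h0 : (𝓕 (f + g) : L2) = 𝓕 f + 𝓕 g := (Lp.fourierTransformₗᵢ Plane ℂ).map_add f g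
    change ∀ᵐ ξ ∂(volume : Measure Plane), ξ ∉ cone → (𝓕 (f + g) : L2) ξ = 0
    rw [h0]
    filter_upwards [hf, hg, Lp.coeFn_add (𝓕 f : L2) (𝓕 g)] with ξ h1 h2 h3 hξ
    rw [h3, Pi.add_apply, h1 hξ, h2 hξ, add_zero]
  smul_mem' := by
    intro a f hf
    have h0 : (𝓕 (a • f) : L2) = a • 𝓕 f := (Lp.fourierTransformₗᵢ Plane ℂ).map_smul a f
    change ∀ᵐ ξ ∂(volume : Measure Plane), ξ ∉ cone → (𝓕 (a • f) : L2) ξ = 0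
    rw [h0]
    filter_upwards [hf, Lp.coeFn_smul a (𝓕 f : L2)] with ξ h1 h2 hξ
    rw [h2, Pi.smul_apply, h1 hξ, smul_zero]

/-! ### Frames

The elements of the system need not lie in the subspace `V`; the frame inequalities are required for
all `f ∈ V`. -/

section Frames

variable {H : Type*} [NormedAddCommGroup H] [InnerProductSpace ℂ H] {ι : Type*}

/-- `A > 0` and `A ‖f‖² ≤ ∑ᵢ |⟨f, eᵢ⟩|²` for all `f ∈ V`. -/
def IsLowerFrameBound (V : Submodule ℂ H) (e : ι → H) (A : ℝ) : Prop :=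
  0 < A ∧ ∀ f ∈ V, ENNReal.ofReal (A * ‖f‖ ^ 2) ≤ ∑' i, ‖inner ℂ (e i) f‖ₑ ^ 2

/-- `B > 0` and `∑ᵢ |⟨f, eᵢ⟩|² ≤ B ‖f‖²` for all `f ∈ V`. -/
def IsUpperFrameBound (V : Submodule ℂ H) (e : ι → H) (B : ℝ) : Prop :=
  0 < B ∧ ∀ f ∈ V, ∑' i, ‖inner ℂ (e i) f‖ₑ ^ 2 ≤ ENNReal.ofReal (B * ‖f‖ ^ 2)

/-- The family `e` is a frame for `V`. -/
def IsFrameFor (V : Submodule ℂ H) (e : ι → H) : Prop :=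
  (∃ A, IsLowerFrameBound V e A) ∧ ∃ B, IsUpperFrameBound V e B

/-- `A` and `B` are the (optimal) frame bounds of `e` for `V`. -/
def AreFrameBounds (V : Submodule ℂ H) (e : ι → H) (A B : ℝ) : Prop :=
  IsGreatest {a | IsLowerFrameBound V e a} A ∧ IsLeast {b | IsUpperFrameBound V e b} B

end Frames

/-! ### Filters, scaling function and shearlet -/

/-- `1`-periodic trigonometric polynomials with real coefficients. -/
def IsRealTrigPoly (m : ℝ → ℂ) : Prop :=
  ∃ h : ℤ →₀ ℝ, ∀ ξ : ℝ,
    m ξ = h.sum fun n a => (a : ℂ) * Complex.exp (2 * Real.pi * Complex.I * n * ξ)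

/-- `1`-periodic trigonometric polynomials with complex coefficients. -/
def IsTrigPoly (m : ℝ → ℂ) : Prop :=
  ∃ h : ℤ →₀ ℂ, ∀ ξ : ℝ,
    m ξ = h.sum fun n a => a * Complex.exp (2 * Real.pi * Complex.I * n * ξ)

/-- `m₀` is a maximally flat low-pass filter with parameters `K` and `L`. -/
structure IsMaxFlatFilter (K L : ℕ) (m₀ : ℝ → ℂ) : Prop where
  trigPoly : IsRealTrigPoly m₀
  map_zero : m₀ 0 = 1
  normSq : ∀ ξ : ℝ, ‖m₀ ξ‖ ^ 2 = Real.cos (Real.pi * ξ) ^ (2 * K) *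
    ∑ n ∈ Finset.range L, ((K - 1 + n).choose n : ℝ) * Real.sin (Real.pi * ξ) ^ (2 * n)

/-- The Fourier transform of the scaling function, `∏_{j ≥ 0} m₀(2^{-j} ξ)`. -/
def scalingHat (m₀ : ℝ → ℂ) (ξ : ℝ) : ℂ := ∏' j : ℕ, m₀ (ξ / 2 ^ j)

/-- The Fourier transform of the separable shearlet, `m₁(4ξ₁) φ̂(ξ₁) φ̂(2ξ₂)`. -/
def shearletHat (m₀ m₁ : ℝ → ℂ) (ξ : Plane) : ℂ :=
  m₁ (4 * ξ 0) * scalingHat m₀ (ξ 0) * scalingHat m₀ (2 * ξ 1)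

/-! ### The quantities in the frame bound estimates

Here `g` stands for the Fourier transform of the generator; all values lie in `[0, ∞]`. -/

/-- `Φ(ξ, ω) = ∑_{j ≥ 0} ∑_{|k| ≤ ⌈2^{j/2}⌉} |g(S_kᵀ A_{2^{-j}} ξ)| |g(S_kᵀ A_{2^{-j}} ξ + ω)|`. -/
def Phi (g : Plane → ℂ) (ξ ω : Plane) : ℝ≥0∞ :=
  ∑' j : ℕ, ∑ k ∈ shears j,
    ‖g (act ((shearMat (k : ℝ))ᵀ * scaleMat ((2 : ℝ) ^ j)⁻¹) ξ)‖ₑ *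
      ‖g (act ((shearMat (k : ℝ))ᵀ * scaleMat ((2 : ℝ) ^ j)⁻¹) ξ + ω)‖ₑ

/-- `Γ(ω)`, the essential supremum of `Φ(·, ω)` over the cone. -/
def Gam (g : Plane → ℂ) (ω : Plane) : ℝ≥0∞ :=
  essSup (fun ξ => Phi g ξ ω) (volume.restrict cone)

/-- `L_inf`, the essential infimum of `Φ(·, 0)` over the cone. -/
def Linf (g : Plane → ℂ) : ℝ≥0∞ := essInf (fun ξ => Phi g ξ 0) (volume.restrict cone)

/-- `L_sup`, the essential supremum of `Φ(·, 0)` over the cone. -/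
def Lsup (g : Plane → ℂ) : ℝ≥0∞ := essSup (fun ξ => Phi g ξ 0) (volume.restrict cone)

/-- `R(c) = ∑_{m ∈ ℤ² ∖ {0}} (Γ(M_c⁻¹ m) Γ(-M_c⁻¹ m))^{1/2}`. -/
def R (g : Plane → ℂ) (c₁ c₂ : ℝ) : ℝ≥0∞ :=
  ∑' m : {m : Fin 2 → ℤ // m ≠ 0},
    (Gam g (act (sampMat c₁ c₂)⁻¹ (latticePt m)) *
      Gam g (-act (sampMat c₁ c₂)⁻¹ (latticePt m))) ^ (1 / 2 : ℝ)

/-- The explicit lower estimate for `L_inf`, namely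
`|m₀(1/6)|² (∏_{j < J} |m₀(2^{-j}/6)|² · exp(-2^{-J+2} (1 - |m₀(1/6)|²)))²`. -/
def explicitLinf (m₀ : ℝ → ℂ) (J : ℕ) : ℝ :=
  ‖m₀ (1 / 6)‖ ^ 2 *
    ((∏ j ∈ Finset.range J, ‖m₀ (((2 : ℝ) ^ j)⁻¹ / 6)‖ ^ 2) *
      Real.exp (-(4 / 2 ^ J * (1 - ‖m₀ (1 / 6)‖ ^ 2)))) ^ 2

end

end Shearlet

/-! On the Fourier side a coefficient of f is, up to a constant, a Fourier integral at a lattice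
point of f̂ times a dilated and sheared copy of conj ψ̂. For fixed scale and shear, periodize this
product and apply Parseval on the torus: up to a determinant, the sum over m is the integral of
|f̂|²|ψ̂|² plus overlaps of the product with its nonzero lattice translates. Summed over scales and
shears, the diagonal part is ∫|f̂|²Φ(·,0), which lies between L_inf‖f‖² and L_sup‖f‖² for f in the
cone space, and Cauchy–Schwarz bounds the overlaps by R(c)‖f‖² (`lattice_fourier_comparison`,
`tsum_cross_le`, `frame_sum_comparison`). It remains to see that L_sup is finite, that R(c) is small
for small c, and that the explicit numbers bound L_inf from below.

All of this comes from the polynomial P = `flatPoly K L`, for which |m₀(ξ)|² = P(sin²πξ). Its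
derivative is a negative constant times y^(L-1) (1-y)^(K-1), so P decreases from 1 on [0,1], and it
is concave on [0,1/4] by K ≤ 3L-2.

Upper bounds: P(y) ≤ (1-y)^K C(K+L-1, L-1), and the binomial coefficient is at most 4^K/256 when L ≥
10 and 2K ≥ 3L. With sin 2x = 2 sin x cos x the infinite product then decays like |ξ|^(-4)
(`norm_scalingHat_le`). Together with the zero of m₁ at the origin this bounds Φ(·,ω) uniformly on
the cone, with enough decay in ω to sum over the lattice (`HasShearletDecay.Phi_le`,
`HasShearletDecay.R_le`).

Lower bounds: concavity makes 1-|m₀(2^(-j)/6)|² decay geometrically, so the tail of the product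
exceeds an explicit exponential. Every ξ in the cone is carried by some admissible scale and shear
to a point where all three factors of ψ̂ are bounded below (`explicitLinf_le_Phi`). The explicit
numbers are bounded below independently of J₀, so one threshold for c₁ serves them all.

Compact support: partial products are exponential sums with frequencies in a fixed ball, and their
limit is tested against Schwartz functions vanishing on that ball. -/

namespace Shearlet

/-! ### The maximally flat polynomial -/

/-- `(1 - y)^K ∑_{n < L} C(K - 1 + n, n) yⁿ`. -/
def flatPoly (K L : ℕ) (y : ℝ) : ℝ :=
  (1 - y) ^ K * ∑ n ∈ Finset.range L, ((K - 1 + n).choose n : ℝ) * y ^ n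

/-- The derivative telescopes: all contributions but the one of the last term cancel. Sign and
monotonicity of the derivative thus reduce to a single product y^l (1-y)^k. -/
theorem flatPoly_hasDerivAt (k l : ℕ) (y : ℝ) :
    HasDerivAt (flatPoly (k + 1) (l + 1))
      (-((l + 1) * ((k + l + 1).choose (l + 1) : ℝ) * (y ^ l * (1 - y) ^ k))) y := by
  induction l with
  | zero =>
    have h : flatPoly (k + 1) (0 + 1) = fun y => (1 - y) ^ (k + 1) := by
      funext z; simp [flatPoly]
    rw [h]
    have h1 := ((hasDerivAt_id y).const_sub 1).pow (k + 1)
    refine h1.congr_deriv ?_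
    simp
  | succ l ih =>
    have h : flatPoly (k + 1) (l + 1 + 1) = fun y => flatPoly (k + 1) (l + 1) y +
        (1 - y) ^ (k + 1) * (((k + (l + 1)).choose (l + 1) : ℝ) * y ^ (l + 1)) := by
      funext z
      simp only [flatPoly, Finset.sum_range_succ _ (l + 1), mul_add, Nat.add_sub_cancel]
    rw [h]
    have h1 := (((hasDerivAt_id y).const_sub 1).pow (k + 1)).mul
      (((hasDerivAt_id y).pow (l + 1)).const_mul ((k + (l + 1)).choose (l + 1) : ℝ))
    refine (ih.add h1).congr_deriv ?_
    have h2 : ((l + 1 + 1 : ℕ) : ℝ) * ((k + (l + 1) + 1).choose (l + 1 + 1) : ℝ)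
        = (k + (l + 1) + 1 : ℕ) * ((k + (l + 1)).choose (l + 1) : ℝ) := by
      rw [mul_comm]
      exact_mod_cast (Nat.add_one_mul_choose_eq (k + (l + 1)) (l + 1)).symm
    push_cast at h2 ⊢
    simp only [Pi.pow_apply, id]
    rw [h2, show k + l + 1 = k + (l + 1) by ring]
    ring

theorem flatPoly_zero {K L : ℕ} (hL : 0 < L) : flatPoly K L 0 = 1 := by
  obtain ⟨l, rfl⟩ := Nat.exists_eq_add_of_lt hL
  simp [flatPoly, Finset.sum_range_succ']

theorem flatPoly_antitoneOn {K L : ℕ} (hK : 0 < K) (hL : 0 < L) :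
    AntitoneOn (flatPoly K L) (Set.Icc 0 1) := by
  obtain ⟨k, rfl⟩ := Nat.exists_eq_succ_of_ne_zero hK.ne'
  obtain ⟨l, rfl⟩ := Nat.exists_eq_succ_of_ne_zero hL.ne'
  refine antitoneOn_of_deriv_nonpos (convex_Icc 0 1)
    (fun y _ => (flatPoly_hasDerivAt k l y).continuousAt.continuousWithinAt)
    (fun y _ => (flatPoly_hasDerivAt k l y).differentiableAt.differentiableWithinAt) ?_
  intro y hy
  rw [interior_Icc] at hy
  rw [(flatPoly_hasDerivAt k l y).deriv, neg_nonpos]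
  have := hy.1.le
  have h2 : 0 ≤ 1 - y := by linarith [hy.2]
  positivity

theorem flatPoly_le_one {K L : ℕ} (hK : 0 < K) (hL : 0 < L) {y : ℝ} (h0 : 0 ≤ y) (h1 : y ≤ 1) :
    flatPoly K L y ≤ 1 := by
  rw [← flatPoly_zero (K := K) hL]
  exact flatPoly_antitoneOn hK hL ⟨le_rfl, zero_le_one⟩ ⟨h0, h1⟩ h0

/-- The derivative is a negative multiple of y^(L-1) (1-y)^(K-1), which increases up to y =
(L-1)/(K+L-2). That point is at least 1/4 = sin²(π/6) precisely when K + 2 ≤ 3L. -/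
theorem flatPoly_concaveOn {K L : ℕ} (hK : 0 < K) (hL : 2 ≤ L) (hKL : K + 2 ≤ 3 * L) :
    ConcaveOn ℝ (Set.Icc 0 (1 / 4)) (flatPoly K L) := by
  obtain ⟨k, rfl⟩ := Nat.exists_eq_succ_of_ne_zero hK.ne'
  obtain ⟨l, rfl⟩ := Nat.exists_eq_add_of_le' (show 1 ≤ L by omega)
  refine AntitoneOn.concaveOn_of_deriv (convex_Icc _ _)
    (fun y _ => (flatPoly_hasDerivAt k l y).continuousAt.continuousWithinAt)
    (fun y _ => (flatPoly_hasDerivAt k l y).differentiableAt.differentiableWithinAt) ?_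
  rw [interior_Icc]
  have hd : deriv (flatPoly (k + 1) (l + 1)) = fun y =>
      -((l + 1) * ((k + l + 1).choose (l + 1) : ℝ) * (y ^ l * (1 - y) ^ k)) :=
    funext fun y => (flatPoly_hasDerivAt k l y).deriv
  have hmono : MonotoneOn (fun y : ℝ => y ^ l * (1 - y) ^ k) (Set.Ioo 0 (1 / 4)) := by
    have hder : ∀ y : ℝ, HasDerivAt (fun y : ℝ => y ^ l * (1 - y) ^ k)
        (l * y ^ (l - 1) * (1 - y) ^ k - y ^ l * (k * (1 - y) ^ (k - 1))) y := by
      intro y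
      refine ((hasDerivAt_pow l y).mul (((hasDerivAt_id y).const_sub 1).pow k)).congr_deriv ?_
      simp; ring
    refine monotoneOn_of_deriv_nonneg (convex_Ioo _ _)
      (fun y _ => (hder y).continuousAt.continuousWithinAt)
      (fun y _ => (hder y).differentiableAt.differentiableWithinAt) ?_
    intro y hy
    rw [interior_Ioo] at hy
    rw [(hder y).deriv]
    obtain ⟨a, rfl⟩ := Nat.exists_eq_add_of_le' (show 1 ≤ l by omega)
    rcases Nat.eq_zero_or_pos k with rfl | hk
    · simp
      have := hy.1.le
      positivity
    obtain ⟨b, rfl⟩ := Nat.exists_eq_add_of_le' (show 1 ≤ k by omega)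
    simp only [Nat.add_sub_cancel]
    have h1 : 0 < y := hy.1
    have h2 : 0 < 1 - y := by linarith [hy.2]
    have h3 : 0 ≤ y ^ a * (1 - y) ^ b := by positivity
    have h4 : (b : ℝ) ≤ 3 * a + 2 := by
      have : b ≤ 3 * a + 2 := by omega
      exact_mod_cast this
    have h5 : 0 ≤ ((a : ℝ) + 1) * (1 - y) - (b + 1) * y := by
      have : (b + 1) * y ≤ (3 * a + 3) * y := by nlinarith
      nlinarith [hy.2]
    push_cast
    calc (0 : ℝ) ≤ (((a : ℝ) + 1) * (1 - y) - (b + 1) * y) * (y ^ a * (1 - y) ^ b) :=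
          mul_nonneg h5 h3
      _ = _ := by ring
  intro x hx y hy hxy
  rw [hd]
  exact neg_le_neg (mul_le_mul_of_nonneg_left (hmono hx hy hxy) (by positivity))

/-! ### The binomial estimate behind the decay of the scaling function. -/

/-- The total mass of the truncated binomial series at `y = 1`. -/
theorem sum_choose_eq (k l : ℕ) :
    ∑ n ∈ Finset.range (l + 1), (k + n).choose n = (k + l + 1).choose l := by
  induction l with
  | zero => simp
  | succ l ih =>
    rw [Finset.sum_range_succ, ih, show k + (l + 1) + 1 = (k + l + 1) + 1 by ring,
      Nat.choose_succ_succ (k + l + 1) l, show k + (l + 1) = k + l + 1 by ring]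

/-- The quotient of the two coefficients is (k+l+2)/(k+2). -/
theorem choose_step_left {k l : ℕ} (h : l ≤ k + 2) :
    (k + 1 + l + 1).choose l ≤ 2 * (k + l + 1).choose l := by
  have h1 := Nat.choose_mul_succ_eq (k + l + 1) l
  have h2 : k + l + 1 + 1 - l = k + 2 := by omega
  rw [h2] at h1
  have h3 : (k + 1 + l + 1) = k + l + 1 + 1 := by ring
  rw [h3]
  nlinarith [Nat.zero_le ((k + l + 1).choose l)]

/-- The quotient of the two coefficients is (k+l+2)/(l+1) = 1 + (k+1)/(l+1). -/
theorem choose_step_right {k l : ℕ} (h : 3 * (k + 1) ≤ 5 * (l + 1)) :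
    3 * (k + (l + 1) + 1).choose (l + 1) ≤ 8 * (k + l + 1).choose l := by
  have h1 := Nat.add_one_mul_choose_eq (k + l + 1) l
  rw [show k + (l + 1) + 1 = k + l + 1 + 1 by ring]
  nlinarith [Nat.zero_le ((k + l + 1).choose l)]

/-- Induction along the extremal line 2K = 3L: passing from (k, l) to (k+3, l+2) costs at most
(8/3)²·2³ < 64 = 4³. Away from the line, raising k by one costs at most 2 < 4. -/
theorem choose_le_four_pow (l : ℕ) (hl : 9 ≤ l) :
    ∀ k, 3 * (l + 1) ≤ 2 * (k + 1) → 256 * (k + l + 1).choose l ≤ 4 ^ (k + 1) := by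
  have step : ∀ l, ∀ k₀, l ≤ k₀ + 2 → 256 * (k₀ + l + 1).choose l ≤ 4 ^ (k₀ + 1) →
      ∀ k, k₀ ≤ k → 256 * (k + l + 1).choose l ≤ 4 ^ (k + 1) := by
    intro l k₀ h0 hb k hk
    induction k, hk using Nat.le_induction with
    | base => exact hb
    | succ k hk ih =>
      have := choose_step_left (k := k) (l := l) (by omega)
      rw [pow_succ]
      omega
  -- Two chains, since the least K with 2K ≥ 3L depends on the parity of L. They start at (K, L) =
  -- (15, 10) and (17, 11).
  have base : ∀ n : ℕ, (256 * (3 * n + 14 + (2 * n + 9) + 1).choose (2 * n + 9)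
        ≤ 4 ^ (3 * n + 14 + 1)) ∧
      (256 * (3 * n + 16 + (2 * n + 10) + 1).choose (2 * n + 10) ≤ 4 ^ (3 * n + 16 + 1)) := by
    have key : ∀ k l : ℕ, 3 * (k + 1) ≤ 5 * (l + 1) → l ≤ k →
        256 * (k + l + 1).choose l ≤ 4 ^ (k + 1) →
        256 * (k + 3 + (l + 2) + 1).choose (l + 2) ≤ 4 ^ (k + 3 + 1) := by
      intro k l h1 h2 h3
      have a1 := choose_step_right h1
      have a2 := choose_step_right (k := k) (l := l + 1) (by omega)
      have a3 := choose_step_left (k := k) (l := l + 2) (by omega)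
      have a4 := choose_step_left (k := k + 1) (l := l + 2) (by omega)
      have a5 := choose_step_left (k := k + 2) (l := l + 2) (by omega)
      have e : (4 : ℕ) ^ (k + 3 + 1) = 64 * 4 ^ (k + 1) := by ring
      rw [e]
      rw [show l + 1 + 1 = l + 2 by ring] at a2
      rw [show k + 1 + 1 = k + 2 by ring] at a4
      rw [show k + 2 + 1 = k + 3 by ring] at a5
      omega
    intro n
    induction n with
    | zero => constructor <;> norm_num [Nat.choose_eq_descFactorial_div_factorial, Nat.descFactorial, Nat.factorial]
    | succ n ih =>
      constructor
      · exact key (3 * n + 14) (2 * n + 9) (by omega) (by omega) ih.1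
      · exact key (3 * n + 16) (2 * n + 10) (by omega) (by omega) ih.2
  intro k hk
  rcases Nat.even_or_odd' l with ⟨m, rfl | rfl⟩
  · obtain ⟨n, rfl⟩ := Nat.exists_eq_add_of_le' (show 5 ≤ m by omega)
    exact step _ _ (by omega) (base n).2 k (by omega)
  · obtain ⟨n, rfl⟩ := Nat.exists_eq_add_of_le' (show 4 ≤ m by omega)
    exact step _ _ (by omega) (base n).1 k (by omega)

/-- `256 ∑_{n < L} C(K - 1 + n, n) ≤ 4^K`. -/
theorem sum_choose_le {K L : ℕ} (hL : 10 ≤ L) (hK : 3 * L ≤ 2 * K) :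
    256 * ∑ n ∈ Finset.range L, ((K - 1 + n).choose n : ℝ) ≤ 4 ^ K := by
  obtain ⟨k, rfl⟩ := Nat.exists_eq_add_of_le' (show 1 ≤ K by omega)
  obtain ⟨l, rfl⟩ := Nat.exists_eq_add_of_le' (show 1 ≤ L by omega)
  simp only [Nat.add_sub_cancel]
  have h := choose_le_four_pow l (by omega) k hK
  rw [← sum_choose_eq] at h
  exact_mod_cast h

theorem flatPoly_le {K L : ℕ} {y : ℝ} (h0 : 0 ≤ y) (h1 : y ≤ 1) :
    flatPoly K L y ≤ (1 - y) ^ K * ∑ n ∈ Finset.range L, ((K - 1 + n).choose n : ℝ) := by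
  refine mul_le_mul_of_nonneg_left (Finset.sum_le_sum fun n _ => ?_) (pow_nonneg (by linarith) _)
  exact mul_le_of_le_one_right (by positivity) (pow_le_one₀ h0 h1)

/-- The graph lies above its chord from (0, 1), so the deficit at y/2 is at most half the deficit at
y; monotonicity covers smaller z. -/
theorem one_sub_flatPoly_half {K L : ℕ} (hK : 0 < K) (hL : 2 ≤ L) (hKL : K + 2 ≤ 3 * L)
    {y z : ℝ} (hy : y ≤ 1 / 4) (hz0 : 0 ≤ z) (hz : z ≤ y / 2) :
    1 - flatPoly K L z ≤ (1 - flatPoly K L y) / 2 := by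
  have h1 := (flatPoly_concaveOn hK hL hKL).2 (⟨le_rfl, by norm_num⟩ : (0 : ℝ) ∈ Set.Icc 0 (1 / 4))
    (⟨by linarith, hy⟩ : y ∈ Set.Icc (0 : ℝ) (1 / 4)) (show (0 : ℝ) ≤ 1 / 2 by norm_num)
    (show (0 : ℝ) ≤ 1 / 2 by norm_num) (by norm_num)
  rw [flatPoly_zero (by omega)] at h1
  simp only [smul_eq_mul] at h1
  have h2 := flatPoly_antitoneOn hK (show 0 < L by omega) ⟨hz0, by linarith⟩
    (⟨by linarith, by linarith⟩ : y / 2 ∈ Set.Icc (0 : ℝ) 1) hz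
  rw [show 1 / 2 * 0 + 1 / 2 * y = y / 2 by ring] at h1
  linarith

/-! ### The filter and the scaling function -/

variable {K L : ℕ} {m₀ : ℝ → ℂ}

theorem IsMaxFlatFilter.normSq_eq (h : IsMaxFlatFilter K L m₀) (ξ : ℝ) :
    ‖m₀ ξ‖ ^ 2 = flatPoly K L (Real.sin (Real.pi * ξ) ^ 2) := by
  rw [h.normSq, flatPoly, ← Real.cos_sq', ← pow_mul]
  simp only [pow_mul]

theorem sin_sq_mem (x : ℝ) : Real.sin x ^ 2 ∈ Set.Icc (0 : ℝ) 1 :=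
  ⟨sq_nonneg _, Real.sin_sq_le_one x⟩

theorem sin_abs_sq (x : ℝ) : Real.sin |x| ^ 2 = Real.sin x ^ 2 := by
  rcases abs_choice x with h | h <;> simp [h]

theorem IsMaxFlatFilter.norm_le_one (h : IsMaxFlatFilter K L m₀) (hK : 0 < K) (hL : 0 < L)
    (ξ : ℝ) : ‖m₀ ξ‖ ≤ 1 := by
  have h1 := flatPoly_le_one hK hL (sin_sq_mem (Real.pi * ξ)).1 (sin_sq_mem (Real.pi * ξ)).2
  rw [← h.normSq_eq] at h1
  nlinarith [norm_nonneg (m₀ ξ)]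

theorem IsRealTrigPoly.isTrigPoly {m : ℝ → ℂ} (h : IsRealTrigPoly m) : IsTrigPoly m := by
  obtain ⟨h, hh⟩ := h
  refine ⟨h.mapRange (fun a : ℝ => (a : ℂ)) (by simp), fun ξ => ?_⟩
  rw [hh, Finsupp.sum_mapRange_index (by simp)]

theorem IsTrigPoly.differentiable {m : ℝ → ℂ} (h : IsTrigPoly m) : Differentiable ℝ m := by
  obtain ⟨h, hh⟩ := h
  rw [show m = fun ξ : ℝ => _ from funext hh]
  simp only [Finsupp.sum]
  intro ξ
  refine DifferentiableAt.fun_sum fun n _ => ?_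
  have h1 : DifferentiableAt ℝ (fun ξ : ℝ => (ξ : ℂ)) ξ := Complex.ofRealCLM.differentiableAt
  have h2 : DifferentiableAt ℝ (fun ξ : ℝ => (2 * Real.pi * Complex.I * n * ξ : ℂ)) ξ :=
    h1.const_mul _
  exact h2.cexp.const_mul _

/-- Differentiability at 0 gives m(ξ/2^j) - 1 = O(ξ/2^j), a geometric series. -/
theorem IsTrigPoly.multipliable {m : ℝ → ℂ} (h : IsTrigPoly m) (h0 : m 0 = 1) (ξ : ℝ) :
    Multipliable fun j : ℕ => m (ξ / 2 ^ j) := by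
  have h1 : (fun x => m x - m 0) =O[nhds 0] fun x => x - 0 :=
    (h.differentiable 0).hasDerivAt.isBigO_sub
  have hs : Summable fun j : ℕ => ξ / 2 ^ j := by
    simpa [div_eq_mul_inv] using
      (summable_geometric_of_lt_one (r := (2 : ℝ)⁻¹) (by norm_num) (by norm_num)).mul_left ξ
  have h2 := h1.comp_tendsto hs.tendsto_atTop_zero
  have h3 : Summable fun j : ℕ => ‖m (ξ / 2 ^ j) - 1‖ := by
    refine summable_of_isBigO_nat hs (h2.norm_left.congr_left ?_ |>.congr_right ?_)
    · intro j; simp [h0]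
    · intro j; simp
  have h4 := multipliable_one_add_of_summable h3
  simpa using h4

theorem IsMaxFlatFilter.multipliable (h : IsMaxFlatFilter K L m₀) (ξ : ℝ) :
    Multipliable fun j : ℕ => m₀ (ξ / 2 ^ j) :=
  h.trigPoly.isTrigPoly.multipliable h.map_zero ξ

theorem IsMaxFlatFilter.tendsto_prod (h : IsMaxFlatFilter K L m₀) (ξ : ℝ) :
    Filter.Tendsto (fun n => ∏ j ∈ Finset.range n, m₀ (ξ / 2 ^ j)) Filter.atTop
      (nhds (scalingHat m₀ ξ)) :=
  (h.multipliable ξ).hasProd.tendsto_prod_nat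

theorem IsMaxFlatFilter.measurable_scalingHat (h : IsMaxFlatFilter K L m₀) :
    Measurable (scalingHat m₀) := by
  refine measurable_of_tendsto_metrizable (f := fun n ξ => ∏ j ∈ Finset.range n, m₀ (ξ / 2 ^ j))
    (fun n => ?_) (tendsto_pi_nhds.2 h.tendsto_prod)
  have := h.trigPoly.isTrigPoly.differentiable.continuous
  fun_prop

theorem IsMaxFlatFilter.norm_prod_le_one (h : IsMaxFlatFilter K L m₀) (hK : 0 < K) (hL : 0 < L)
    (ξ : ℝ) (n : ℕ) : ‖∏ j ∈ Finset.range n, m₀ (ξ / 2 ^ j)‖ ≤ 1 := by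
  rw [norm_prod]
  exact Finset.prod_le_one (fun _ _ => norm_nonneg _) fun _ _ => h.norm_le_one hK hL _

theorem IsMaxFlatFilter.norm_scalingHat_le_one (h : IsMaxFlatFilter K L m₀) (hK : 0 < K)
    (hL : 0 < L) (ξ : ℝ) : ‖scalingHat m₀ ξ‖ ≤ 1 :=
  le_of_tendsto' (h.tendsto_prod ξ).norm fun n => h.norm_prod_le_one hK hL ξ n

theorem IsMaxFlatFilter.scalingHat_eq (h : IsMaxFlatFilter K L m₀) (ξ : ℝ) (n : ℕ) :
    scalingHat m₀ ξ = (∏ j ∈ Finset.range n, m₀ (ξ / 2 ^ j)) * scalingHat m₀ (ξ / 2 ^ n) := by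
  have h1 : (fun j : ℕ => m₀ (ξ / 2 ^ (j + n))) = fun j => m₀ (ξ / 2 ^ n / 2 ^ j) := by
    funext j
    rw [div_div, ← pow_add, add_comm]
  have h2 : Multipliable fun j : ℕ => m₀ (ξ / 2 ^ (j + n)) := h1 ▸ h.multipliable _
  have h3 := Multipliable.prod_mul_tprod_nat_mul' (f := fun j => m₀ (ξ / 2 ^ j)) h2
  rw [scalingHat, scalingHat, ← h3, h1]

theorem IsMaxFlatFilter.norm_scalingHat_le_prod (h : IsMaxFlatFilter K L m₀) (hK : 0 < K)
    (hL : 0 < L) (ξ : ℝ) (n : ℕ) :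
    ‖scalingHat m₀ ξ‖ ^ 2 ≤ ∏ j ∈ Finset.range n, ‖m₀ (ξ / 2 ^ j)‖ ^ 2 := by
  rw [h.scalingHat_eq ξ n, norm_mul, norm_prod, mul_pow, ← Finset.prod_pow]
  refine mul_le_of_le_one_right (Finset.prod_nonneg fun _ _ => sq_nonneg _) ?_
  exact pow_le_one₀ (norm_nonneg _) (h.norm_scalingHat_le_one hK hL _)

theorem IsMaxFlatFilter.normSq_le_cos (h : IsMaxFlatFilter K L m₀) (hL : 10 ≤ L)
    (hK : 3 * L ≤ 2 * K) (ξ : ℝ) : ‖m₀ ξ‖ ^ 2 ≤ (Real.cos (Real.pi * ξ) ^ 2) ^ K * (4 ^ K / 256) := by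
  rw [h.normSq_eq]
  refine (flatPoly_le (sin_sq_mem _).1 (sin_sq_mem _).2).trans ?_
  rw [← Real.cos_sq']
  refine mul_le_mul_of_nonneg_left ?_ (by positivity)
  linarith [sum_choose_le hL hK]

/-- Since 4 sin²x cos²x = sin²2x, the factor 4^K in `normSq_le_cos` is absorbed by doubling the
angle in the sine, and each new factor of the product contributes exactly 1/256. -/
theorem IsMaxFlatFilter.sin_mul_prod_le (h : IsMaxFlatFilter K L m₀) (hL : 10 ≤ L)
    (hK : 3 * L ≤ 2 * K) (ξ : ℝ) (n : ℕ) :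
    (Real.sin (2 * Real.pi * ξ / 2 ^ n) ^ 2) ^ K * ∏ j ∈ Finset.range n, ‖m₀ (ξ / 2 ^ j)‖ ^ 2
      ≤ (1 / 256) ^ n := by
  induction n with
  | zero => simpa using pow_le_one₀ (n := K) (sq_nonneg _) (Real.sin_sq_le_one (2 * Real.pi * ξ))
  | succ n ih =>
    rw [Finset.prod_range_succ, pow_succ (1 / 256 : ℝ)]
    have h1 := h.normSq_le_cos hL hK (ξ / 2 ^ n)
    have h2 : Real.sin (2 * Real.pi * ξ / 2 ^ n) =
        2 * Real.sin (2 * Real.pi * ξ / 2 ^ (n + 1)) * Real.cos (Real.pi * (ξ / 2 ^ n)) := by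
      rw [show Real.pi * (ξ / 2 ^ n) = 2 * Real.pi * ξ / 2 ^ (n + 1) by rw [pow_succ]; field_simp,
        ← Real.sin_two_mul]
      congr 1
      rw [pow_succ]; field_simp
    set P := ∏ j ∈ Finset.range n, ‖m₀ (ξ / 2 ^ j)‖ ^ 2
    have hP : 0 ≤ P := Finset.prod_nonneg fun _ _ => sq_nonneg _
    set s := Real.sin (2 * Real.pi * ξ / 2 ^ (n + 1))
    set c := Real.cos (Real.pi * (ξ / 2 ^ n))
    calc (s ^ 2) ^ K * (P * ‖m₀ (ξ / 2 ^ n)‖ ^ 2)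
        ≤ (s ^ 2) ^ K * (P * ((c ^ 2) ^ K * (4 ^ K / 256))) := by gcongr
      _ = ((2 * s * c) ^ 2) ^ K * P * (1 / 256) := by
          rw [show (2 * s * c) ^ 2 = 4 * (s ^ 2 * c ^ 2) by ring, mul_pow, mul_pow]; ring
      _ ≤ (1 / 256) ^ n * (1 / 256) := by rw [← h2]; gcongr

theorem IsMaxFlatFilter.norm_scalingHat_le (h : IsMaxFlatFilter K L m₀) (hL : 10 ≤ L)
    (hK : 3 * L ≤ 2 * K) (ξ : ℝ) : ‖scalingHat m₀ ξ‖ ≤ 2 ^ K / (1 + |ξ|) ^ 4 := by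
  have hK0 : 0 < K := by omega
  have hL0 : 0 < L := by omega
  rw [le_div_iff₀ (by positivity)]
  rcases lt_or_ge |ξ| 1 with h1 | h1
  · calc ‖scalingHat m₀ ξ‖ * (1 + |ξ|) ^ 4 ≤ 1 * (1 + 1) ^ 4 := by
          gcongr
          exact h.norm_scalingHat_le_one hK0 hL0 ξ
      _ = 2 ^ 4 := by norm_num
      _ ≤ 2 ^ K := pow_le_pow_right₀ (by norm_num) (by omega)
  -- With 2^n ≤ 8|ξ| < 2^(n+1) the angle 2π|ξ|/2^n lies in [π/4, π/2], so the sine stays away from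
  -- 0. Moreover 2^n > 4|ξ| ≥ 1 + |ξ|, and 256 = 2^8 gives eight powers of decay for the square.
  obtain ⟨n, hn1, hn2⟩ := exists_nat_pow_near (x := 8 * |ξ|) (y := (2 : ℝ)) (by linarith)
    (by norm_num)
  have hpi := Real.pi_pos
  have hs : 1 / 4 ≤ Real.sin (2 * Real.pi * ξ / 2 ^ n) ^ 2 := by
    have hx : |2 * Real.pi * ξ / 2 ^ n| = Real.pi / 4 * (8 * |ξ| / 2 ^ n) := by
      rw [abs_div, abs_mul, abs_mul, abs_of_pos hpi, abs_of_pos (by positivity : (0 : ℝ) < 2 ^ n),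
        abs_two]
      ring
    have a1 : 1 ≤ 8 * |ξ| / 2 ^ n := by rwa [one_le_div (by positivity)]
    have a2 : 8 * |ξ| / 2 ^ n ≤ 2 := by
      rw [div_le_iff₀ (by positivity)]; rw [pow_succ] at hn2; linarith
    have h2 : 1 / 2 ≤ Real.sin |2 * Real.pi * ξ / 2 ^ n| := by
      refine le_trans ?_ (Real.mul_le_sin (abs_nonneg _) ?_)
      · rw [hx, ← mul_assoc, show 2 / Real.pi * (Real.pi / 4) = 1 / 2 by field_simp; norm_num]
        linarith
      · rw [hx]; nlinarith
    rw [← sin_abs_sq]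
    nlinarith
  have h2 := h.sin_mul_prod_le hL hK ξ n
  have h3 := h.norm_scalingHat_le_prod hK0 hL0 ξ n
  have h4 : (1 / 4 : ℝ) ^ K * ‖scalingHat m₀ ξ‖ ^ 2 ≤ (1 / 256) ^ n :=
    le_trans (by gcongr) h2
  have h5 : (1 + |ξ|) ^ 8 ≤ (256 : ℝ) ^ n := by
    rw [show (256 : ℝ) = 2 ^ 8 by norm_num, ← pow_mul, mul_comm, pow_mul]
    rw [pow_succ] at hn2
    gcongr
    linarith
  have h6 : (‖scalingHat m₀ ξ‖ * (1 + |ξ|) ^ 4) ^ 2 ≤ (2 ^ K) ^ 2 := by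
    rw [one_div, inv_pow, one_div, inv_pow, inv_mul_le_iff₀ (by positivity)] at h4
    calc (‖scalingHat m₀ ξ‖ * (1 + |ξ|) ^ 4) ^ 2 = ‖scalingHat m₀ ξ‖ ^ 2 * (1 + |ξ|) ^ 8 := by ring
      _ ≤ (4 ^ K * (256 ^ n)⁻¹) * 256 ^ n := by gcongr
      _ = (2 ^ K) ^ 2 := by
          rw [mul_assoc, inv_mul_cancel₀ (by positivity), mul_one, ← pow_mul, mul_comm K, pow_mul]
          norm_num
  exact (sq_le_sq₀ (by positivity) (by positivity)).1 h6

/-! ### Lower bounds near the origin -/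

theorem sin_sq_pi_half_le {x : ℝ} (hx : |x| ≤ 1 / 6) :
    Real.sin (Real.pi * x) ^ 2 ≤ 1 / 4 := by
  have hpi := Real.pi_pos
  have h1 : |Real.pi * x| ≤ Real.pi / 6 := by
    rw [abs_mul, abs_of_pos hpi]; nlinarith
  have h2 := Real.sin_le_sin_of_le_of_le_pi_div_two (x := |Real.pi * x|) (y := Real.pi / 6)
    (by linarith [abs_nonneg (Real.pi * x)]) (by linarith) h1
  have h3 := Real.sin_nonneg_of_nonneg_of_le_pi (abs_nonneg (Real.pi * x)) (by linarith)
  rw [Real.sin_pi_div_six] at h2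
  rw [← sin_abs_sq]
  nlinarith

theorem IsMaxFlatFilter.normSq_pos (h : IsMaxFlatFilter K L m₀) (hL : 0 < L) {x : ℝ}
    (hx : |x| ≤ 1 / 6) : 0 < ‖m₀ x‖ ^ 2 := by
  rw [h.normSq_eq, flatPoly]
  have h1 := sin_sq_pi_half_le hx
  refine mul_pos (pow_pos (by linarith) _) ?_
  obtain ⟨l, rfl⟩ := Nat.exists_eq_add_of_le' (show 1 ≤ L by omega)
  rw [Finset.sum_range_succ']
  have : 0 ≤ ∑ k ∈ Finset.range l, ((K - 1 + (k + 1)).choose (k + 1) : ℝ) *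
      (Real.sin (Real.pi * x) ^ 2) ^ (k + 1) := Finset.sum_nonneg fun _ _ => by positivity
  simp
  linarith

theorem IsMaxFlatFilter.normSq_anti (h : IsMaxFlatFilter K L m₀) (hK : 0 < K) (hL : 0 < L)
    {x y : ℝ} (hxy : |x| ≤ y) (hy : y ≤ 1 / 2) : ‖m₀ y‖ ^ 2 ≤ ‖m₀ x‖ ^ 2 := by
  rw [h.normSq_eq, h.normSq_eq]
  refine flatPoly_antitoneOn hK hL (sin_sq_mem _) (sin_sq_mem _) ?_
  have hpi := Real.pi_pos
  rw [← sin_abs_sq (Real.pi * x), abs_mul, abs_of_pos hpi]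
  have h0 := abs_nonneg x
  have h2 := Real.sin_le_sin_of_le_of_le_pi_div_two (x := Real.pi * |x|) (y := Real.pi * y)
    (by nlinarith) (by nlinarith) (by nlinarith)
  have h3 := Real.sin_nonneg_of_nonneg_of_le_pi (x := Real.pi * |x|) (by positivity) (by nlinarith)
  gcongr

/-- Halving the angle at least halves sin², because sin²2x = 4 sin²x cos²x and cos²x ≥ 1/2 here. By
`one_sub_flatPoly_half` each halving then halves the deficit. -/
theorem IsMaxFlatFilter.one_sub_normSq_le (h : IsMaxFlatFilter K L m₀) (hK : 0 < K) (hL : 2 ≤ L)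
    (hKL : K + 2 ≤ 3 * L) (j : ℕ) :
    1 - ‖m₀ (((2 : ℝ) ^ j)⁻¹ / 6)‖ ^ 2 ≤ (1 - ‖m₀ (1 / 6)‖ ^ 2) / 2 ^ j := by
  induction j with
  | zero => simp
  | succ j ih =>
    have hj : ((2 : ℝ) ^ j)⁻¹ ≤ 1 := inv_le_one_of_one_le₀ (one_le_pow₀ (by norm_num))
    have hj0 : (0 : ℝ) < ((2 : ℝ) ^ j)⁻¹ := by positivity
    have h1 : Real.sin (Real.pi * (((2 : ℝ) ^ j)⁻¹ / 6)) ^ 2 ≤ 1 / 4 :=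
      sin_sq_pi_half_le (by rw [abs_of_pos (by positivity)]; linarith)
    have h2 : Real.sin (Real.pi * (((2 : ℝ) ^ (j + 1))⁻¹ / 6)) ^ 2
        ≤ Real.sin (Real.pi * (((2 : ℝ) ^ j)⁻¹ / 6)) ^ 2 / 2 := by
      have h3 : Real.pi * (((2 : ℝ) ^ j)⁻¹ / 6) = 2 * (Real.pi * (((2 : ℝ) ^ (j + 1))⁻¹ / 6)) := by
        rw [pow_succ]; field_simp
      have h4 : Real.sin (Real.pi * (((2 : ℝ) ^ (j + 1))⁻¹ / 6)) ^ 2 ≤ 1 / 4 := by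
        refine sin_sq_pi_half_le ?_
        rw [abs_of_pos (by positivity), pow_succ, mul_inv]; linarith
      rw [h3, Real.sin_two_mul, mul_pow, mul_pow, Real.cos_sq']
      nlinarith [sq_nonneg (Real.sin (Real.pi * (((2 : ℝ) ^ (j + 1))⁻¹ / 6)))]
    have h5 := one_sub_flatPoly_half hK hL hKL h1 (sin_sq_mem _).1 h2
    rw [← h.normSq_eq, ← h.normSq_eq] at h5
    calc _ ≤ _ := h5
      _ ≤ (1 - ‖m₀ (1 / 6)‖ ^ 2) / 2 ^ j / 2 := by gcongr
      _ = _ := by rw [div_div, ← pow_succ 2 j]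

theorem exp_neg_two_mul_le {x : ℝ} (h0 : 0 ≤ x) (h1 : x ≤ 1 / 2) : Real.exp (-(2 * x)) ≤ 1 - x := by
  rw [Real.exp_neg, inv_le_iff_one_le_mul₀ (Real.exp_pos _)]
  nlinarith [Real.add_one_le_exp (2 * x)]

/-- The explicit lower bound for `|φ̂|²` on `[-1/6, 1/6]`. -/
theorem IsMaxFlatFilter.le_normSq_scalingHat (h : IsMaxFlatFilter K L m₀) (hK : 0 < K) (hL : 2 ≤ L)
    (hKL : K + 2 ≤ 3 * L) {J : ℕ} (hJ : (1 - ‖m₀ (1 / 6)‖ ^ 2) / 2 ^ J ≤ 1 / 2) {ξ : ℝ}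
    (hξ : |ξ| ≤ 1 / 6) :
    (∏ j ∈ Finset.range J, ‖m₀ (((2 : ℝ) ^ j)⁻¹ / 6)‖ ^ 2) *
      Real.exp (-(4 / 2 ^ J * (1 - ‖m₀ (1 / 6)‖ ^ 2))) ≤ ‖scalingHat m₀ ξ‖ ^ 2 := by
  have hL0 : 0 < L := by omega
  set q := 1 - ‖m₀ (1 / 6)‖ ^ 2 with hq
  have hq0 : 0 ≤ q := by
    have := h.norm_le_one hK hL0 (1 / 6)
    have := norm_nonneg (m₀ (1 / 6))
    nlinarith
  -- The factor of index J+i is at least 1 - q/2^(J+i) ≥ exp(-2q/2^(J+i)). These exponents sum to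
  -- -4q/2^J, and the second term of the exponent is the part not yet used.
  have key : ∀ i : ℕ, (∏ j ∈ Finset.range J, ‖m₀ (((2 : ℝ) ^ j)⁻¹ / 6)‖ ^ 2) *
      Real.exp (-(4 / 2 ^ J * q) + 4 / 2 ^ (J + i) * q) ≤
      ∏ j ∈ Finset.range (J + i), ‖m₀ (((2 : ℝ) ^ j)⁻¹ / 6)‖ ^ 2 := by
    intro i
    induction i with
    | zero => simp
    | succ i ih =>
      rw [← add_assoc, Finset.prod_range_succ]
      have e : -(4 / 2 ^ J * q) + 4 / 2 ^ (J + i + 1) * q =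
          (-(4 / 2 ^ J * q) + 4 / 2 ^ (J + i) * q) + -(2 * (q / 2 ^ (J + i))) := by
        rw [pow_succ]; field_simp; ring
      rw [e, Real.exp_add, ← mul_assoc]
      refine mul_le_mul ih ?_ (Real.exp_pos _).le (Finset.prod_nonneg fun _ _ => sq_nonneg _)
      refine (exp_neg_two_mul_le (by positivity) (le_trans ?_ hJ)).trans ?_
      · gcongr
        · norm_num
        · omega
      · linarith [h.one_sub_normSq_le hK hL hKL (J + i)]
  refine ge_of_tendsto ((h.tendsto_prod ξ).norm.pow 2) ?_
  filter_upwards [Filter.eventually_ge_atTop J] with n hn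
  obtain ⟨i, rfl⟩ := Nat.exists_eq_add_of_le hn
  calc _ ≤ ∏ j ∈ Finset.range (J + i), ‖m₀ (((2 : ℝ) ^ j)⁻¹ / 6)‖ ^ 2 := by
        refine le_trans (mul_le_mul_of_nonneg_left (Real.exp_le_exp.2 ?_)
          (Finset.prod_nonneg fun _ _ => sq_nonneg _)) (key i)
        have : 0 ≤ 4 / 2 ^ (J + i) * q := by positivity
        linarith
    _ ≤ _ := by
        rw [norm_prod, ← Finset.prod_pow]
        refine Finset.prod_le_prod (fun _ _ => sq_nonneg _) fun j _ => ?_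
        have hj : ((2 : ℝ) ^ j)⁻¹ ≤ 1 := inv_le_one_of_one_le₀ (one_le_pow₀ (by norm_num))
        have hj0 : (0 : ℝ) < ((2 : ℝ) ^ j)⁻¹ := by positivity
        refine h.normSq_anti hK hL0 ?_ (by linarith)
        rw [abs_div, abs_of_pos (by positivity : (0 : ℝ) < 2 ^ j), div_eq_mul_inv]
        nlinarith

/-- The explicit lower estimates are bounded below by a positive constant. -/
theorem IsMaxFlatFilter.exists_le_explicitLinf (h : IsMaxFlatFilter K L m₀) (hK : 0 < K)
    (hL : 2 ≤ L) (hKL : K + 2 ≤ 3 * L) :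
    ∃ c > 0, ∀ J : ℕ, (1 - ‖m₀ (1 / 6)‖ ^ 2) / 2 ^ J ≤ 1 / 2 → c ≤ explicitLinf m₀ J := by
  have hL0 : 0 < L := by omega
  have h6 : 0 < ‖m₀ (1 / 6)‖ ^ 2 := h.normSq_pos hL0 (by norm_num [abs_of_pos])
  have hS : 0 < ‖scalingHat m₀ (1 / 6)‖ ^ 2 := by
    refine lt_of_lt_of_le ?_ (h.le_normSq_scalingHat hK hL hKL (J := 1) ?_ (ξ := 1 / 6) ?_)
    · refine mul_pos (Finset.prod_pos fun j _ => ?_) (Real.exp_pos _)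
      have hj : ((2 : ℝ) ^ j)⁻¹ ≤ 1 := inv_le_one_of_one_le₀ (one_le_pow₀ (by norm_num))
      exact h.normSq_pos hL0 (by rw [abs_of_pos (by positivity)]; linarith)
    · linarith
    · norm_num [abs_of_pos]
  -- Independent of J: every partial product dominates the full one, and the condition on J says
  -- that the exponent is at least -2.
  refine ⟨‖m₀ (1 / 6)‖ ^ 2 * (‖scalingHat m₀ (1 / 6)‖ ^ 2 * Real.exp (-2)) ^ 2, by positivity, ?_⟩
  intro J hJ
  rw [explicitLinf]
  have h1 := h.norm_scalingHat_le_prod hK hL0 (1 / 6) J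
  have h2 : ∀ j : ℕ, (1 / 6 : ℝ) / 2 ^ j = ((2 : ℝ) ^ j)⁻¹ / 6 := fun j => by field_simp
  simp only [h2] at h1
  have h3 : -2 ≤ -(4 / 2 ^ J * (1 - ‖m₀ (1 / 6)‖ ^ 2)) := by
    have : 4 / 2 ^ J * (1 - ‖m₀ (1 / 6)‖ ^ 2) = 4 * ((1 - ‖m₀ (1 / 6)‖ ^ 2) / 2 ^ J) := by ring
    linarith
  gcongr

/-! ### The high-pass filter -/

variable {m₁ : ℝ → ℂ}

theorem IsMaxFlatFilter.highpass_normSq_eq (h : IsMaxFlatFilter K L m₀)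
    (h₁ : ∀ ξ : ℝ, ‖m₁ ξ‖ ^ 2 = ‖m₀ (ξ + 1 / 2)‖ ^ 2) (ξ : ℝ) :
    ‖m₁ ξ‖ ^ 2 = flatPoly K L (Real.cos (Real.pi * ξ) ^ 2) := by
  rw [h₁, h.normSq_eq, mul_add, show Real.pi * (1 / 2) = Real.pi / 2 by ring,
    Real.sin_add_pi_div_two]

theorem IsMaxFlatFilter.highpass_le_one (h : IsMaxFlatFilter K L m₀) (hK : 0 < K) (hL : 0 < L)
    (h₁ : ∀ ξ : ℝ, ‖m₁ ξ‖ ^ 2 = ‖m₀ (ξ + 1 / 2)‖ ^ 2) (ξ : ℝ) : ‖m₁ ξ‖ ≤ 1 := by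
  have h2 := h.norm_le_one hK hL (ξ + 1 / 2)
  exact ((sq_le_sq₀ (norm_nonneg _) (norm_nonneg _)).1 (h₁ ξ).le).trans h2

/-- The factor (1-y)^K of P at y = cos² gives m₁(4t) a zero of high order at t = 0. Order two is
kept: the sum over shears later costs a factor 1/|t|, and one power must survive for the sum over
scales. -/
theorem IsMaxFlatFilter.highpass_le (h : IsMaxFlatFilter K L m₀) (hL : 10 ≤ L)
    (hK : 3 * L ≤ 2 * K) (h₁ : ∀ ξ : ℝ, ‖m₁ ξ‖ ^ 2 = ‖m₀ (ξ + 1 / 2)‖ ^ 2) :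
    ∃ B : ℝ, 0 ≤ B ∧ ∀ t : ℝ, ‖m₁ (4 * t)‖ ≤ B * (t ^ 2 / (1 + |t|) ^ 2) := by
  have hpi := Real.pi_pos
  refine ⟨4 * (1 + 2 ^ K * (4 * Real.pi) ^ 2), by positivity, fun t => ?_⟩
  have h1 : ‖m₁ (4 * t)‖ ≤ 1 := h.highpass_le_one (by omega) (by omega) h₁ _
  have h2 : ‖m₁ (4 * t)‖ ≤ 2 ^ K * (4 * Real.pi) ^ 2 * t ^ 2 := by
    refine (sq_le_sq₀ (norm_nonneg _) (by positivity)).1 ?_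
    rw [h.highpass_normSq_eq h₁]
    refine (flatPoly_le (sq_nonneg _) (Real.cos_sq_le_one _)).trans ?_
    rw [← Real.sin_sq]
    have h3 : Real.sin (Real.pi * (4 * t)) ^ 2 ≤ (4 * Real.pi * t) ^ 2 := by
      rw [show Real.pi * (4 * t) = 4 * Real.pi * t by ring]
      exact sq_le_sq.2 Real.abs_sin_le_abs
    have h4 : (Real.sin (Real.pi * (4 * t)) ^ 2) ^ K ≤ ((4 * Real.pi * t) ^ 2) ^ 2 :=
      (pow_le_pow_of_le_one (sq_nonneg _) (Real.sin_sq_le_one _) (show 2 ≤ K by omega)).trans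
        (pow_le_pow_left₀ (sq_nonneg _) h3 2)
    have h5 := sum_choose_le hL hK
    have h6 : (0 : ℝ) ≤ ∑ n ∈ Finset.range L, ((K - 1 + n).choose n : ℝ) :=
      Finset.sum_nonneg fun _ _ => by positivity
    calc _ ≤ ((4 * Real.pi * t) ^ 2) ^ 2 * 4 ^ K := by gcongr; linarith
      _ = _ := by
        rw [show (4 : ℝ) ^ K = (2 ^ K) ^ 2 by rw [← pow_mul, mul_comm, pow_mul]; norm_num]
        ring
  rw [← mul_div_assoc, le_div_iff₀ (by positivity)]
  set C := 2 ^ K * (4 * Real.pi) ^ 2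
  have hC : 0 ≤ C := by positivity
  have ht := abs_nonneg t
  rw [← sq_abs t] at h2 ⊢
  rcases le_total |t| 1 with h3 | h3
  · calc _ ≤ C * |t| ^ 2 * (1 + 1) ^ 2 := by gcongr
      _ ≤ _ := by nlinarith [sq_nonneg |t|]
  · calc _ ≤ 1 * (|t| + |t|) ^ 2 := by gcongr
      _ ≤ _ := by nlinarith [mul_nonneg hC (sq_nonneg |t|)]

/-- For these t, |4t| lies in [1/3, 2/3], hence cos²(4πt) ≤ 1/4 = sin²(π/6), and P decreases. -/
theorem IsMaxFlatFilter.le_highpass (h : IsMaxFlatFilter K L m₀) (hK : 0 < K) (hL : 0 < L)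
    (h₁ : ∀ ξ : ℝ, ‖m₁ ξ‖ ^ 2 = ‖m₀ (ξ + 1 / 2)‖ ^ 2) {t : ℝ} (ht : 1 / 12 ≤ |t|)
    (ht' : |t| ≤ 1 / 6) : ‖m₀ (1 / 6)‖ ^ 2 ≤ ‖m₁ (4 * t)‖ ^ 2 := by
  rw [h.highpass_normSq_eq h₁, h.normSq_eq]
  refine flatPoly_antitoneOn hK hL ⟨sq_nonneg _, Real.cos_sq_le_one _⟩ (sin_sq_mem _) ?_
  have hpi := Real.pi_pos
  rw [show Real.pi * (1 / 6) = Real.pi / 6 by ring, Real.sin_pi_div_six, ← Real.cos_abs, abs_mul,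
    abs_mul, abs_of_pos hpi, abs_of_pos (by norm_num : (0 : ℝ) < 4)]
  have a1 : Real.cos (Real.pi * (4 * |t|)) ≤ Real.cos (Real.pi / 3) :=
    Real.cos_le_cos_of_nonneg_of_le_pi (by positivity) (by nlinarith) (by nlinarith)
  have a2 : Real.cos (Real.pi - Real.pi / 3) ≤ Real.cos (Real.pi * (4 * |t|)) :=
    Real.cos_le_cos_of_nonneg_of_le_pi (by positivity) (by linarith) (by nlinarith)
  rw [Real.cos_pi_sub] at a2
  rw [Real.cos_pi_div_three] at a1 a2
  nlinarith

/-! ### Summation over scales and shears -/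

/-- The weight `1 / (1 + |x|)`. -/
noncomputable def wt (x : ℝ) : ℝ := (1 + |x|)⁻¹

theorem wt_pos (x : ℝ) : 0 < wt x := by unfold wt; positivity

theorem wt_le_one (x : ℝ) : wt x ≤ 1 :=
  inv_le_one_of_one_le₀ (by linarith [abs_nonneg x])

theorem wt_neg (x : ℝ) : wt (-x) = wt x := by simp [wt]

theorem abs_mul_wt_le_one (x : ℝ) : |x| * wt x ≤ 1 := by
  rw [wt, ← div_eq_mul_inv, div_le_one (by positivity)]
  linarith

theorem wt_mul_wt_add_le (x w : ℝ) : wt x * wt (x + w) ≤ wt w := by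
  rw [wt, wt, wt, ← mul_inv]
  refine inv_anti₀ (by positivity) ?_
  have h : |w| ≤ |x + w| + |x| := by
    simpa using abs_sub (x + w) x
  nlinarith [abs_nonneg x, abs_nonneg (x + w)]

theorem wt_anti {x y : ℝ} (h : |x| ≤ |y|) : wt y ≤ wt x :=
  inv_anti₀ (by positivity) (by linarith)

/-- A discrete form of the fact that x/(1+|x|) has derivative `wt x ^ 2`; a step of length at most
one loses only a factor 2. -/
theorem wt_sq_le_sub {x τ : ℝ} (h0 : 0 < τ) (h1 : τ ≤ 1) :
    wt x ^ 2 ≤ 2 / τ * ((x + τ) * wt (x + τ) - x * wt x) := by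
  have key : ∀ a b : ℝ, 0 < a → 0 < b → a ^ 2 * (2 / τ * ((x + τ) * b⁻¹ - x * a⁻¹)) * b * τ =
      2 * a * ((x + τ) * a - x * b) := by
    intro a b ha hb
    field_simp
  have fin : ∀ a b : ℝ, 0 < a → 0 < b → b * τ ≤ 2 * a * ((x + τ) * a - x * b) →
      a⁻¹ ^ 2 ≤ 2 / τ * ((x + τ) * b⁻¹ - x * a⁻¹) := by
    intro a b ha hb h
    rw [← key a b ha hb, mul_assoc _ b τ] at h
    have h2 : 1 ≤ a ^ 2 * (2 / τ * ((x + τ) * b⁻¹ - x * a⁻¹)) :=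
      le_of_mul_le_mul_right (by rw [one_mul]; exact h) (mul_pos hb h0)
    rw [inv_pow, inv_le_iff_one_le_mul₀ (by positivity)]
    linarith
  unfold wt
  refine fin _ _ (by positivity) (by positivity) ?_
  rcases le_total 0 x with hx | hx
  · rw [abs_of_nonneg hx, abs_of_nonneg (by linarith)]
    nlinarith [mul_nonneg hx h0.le]
  · rw [abs_of_nonpos hx]
    rcases le_total 0 (x + τ) with hy | hy
    · rw [abs_of_nonneg hy]
      nlinarith [mul_nonneg hy (neg_nonneg.2 hx)]
    · rw [abs_of_nonpos hy]
      nlinarith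

theorem mul_wt_mono : Monotone fun x : ℝ => x * wt x := by
  intro x y h
  simp only [wt, ← div_eq_mul_inv]
  rw [div_le_div_iff₀ (by positivity) (by positivity)]
  rcases le_total 0 x with hx | hx
  · rw [abs_of_nonneg hx, abs_of_nonneg (hx.trans h)]; nlinarith
  · rw [abs_of_nonpos hx]
    rcases le_total 0 y with hy | hy
    · rw [abs_of_nonneg hy]; nlinarith
    · rw [abs_of_nonpos hy]; nlinarith

theorem sum_Icc_sub (f : ℤ → ℝ) (a b : ℤ) (h : a ≤ b + 1) :
    ∑ k ∈ Finset.Icc a b, (f (k + 1) - f k) = f (b + 1) - f a := by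
  have e : Finset.Icc a b = (Finset.range (b + 1 - a).toNat).map
    (Nat.castEmbedding.trans (addLeftEmbedding a)) := rfl
  rw [e, Finset.sum_map]
  have := Finset.sum_range_sub (fun n : ℕ => f (a + n)) (b + 1 - a).toNat
  simp only [Function.Embedding.trans_apply, Nat.castEmbedding_apply, addLeftEmbedding_apply]
  push_cast [← add_assoc] at this
  rw [this, Int.toNat_of_nonneg (by omega)]
  simp

/-- Telescoping against the increasing function x/(1+|x|), whose total variation is 2. The step is
truncated to min(t, 1) for `wt_sq_le_sub`; monotonicity covers the rest of it. -/
theorem sum_wt_sq_le {t : ℝ} (ht : 0 < t) (u : ℝ) (a b : ℤ) (h : a ≤ b + 1) :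
    ∑ k ∈ Finset.Icc a b, wt (k * t + u) ^ 2 ≤ 4 * (1 + t⁻¹) := by
  set τ := min t 1 with hτ
  have h0 : 0 < τ := lt_min ht one_pos
  have h1 : τ ≤ 1 := min_le_right _ _
  have hb : ∀ x : ℝ, |x * wt x| ≤ 1 := fun x => by
    rw [abs_mul, abs_of_pos (wt_pos x)]; exact abs_mul_wt_le_one x
  calc ∑ k ∈ Finset.Icc a b, wt (k * t + u) ^ 2
      ≤ ∑ k ∈ Finset.Icc a b, 2 / τ * ((((k + 1 : ℤ) : ℝ) * t + u) * wt (((k + 1 : ℤ) : ℝ) * t + u)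
          - (k * t + u) * wt (k * t + u)) := by
        refine Finset.sum_le_sum fun k _ => (wt_sq_le_sub h0 h1).trans ?_
        have := mul_wt_mono (show (k : ℝ) * t + u + τ ≤ ((k + 1 : ℤ) : ℝ) * t + u by
          push_cast; linarith [min_le_left t 1])
        simp only at this
        gcongr
    _ = 2 / τ * ((((b + 1 : ℤ) : ℝ) * t + u) * wt (((b + 1 : ℤ) : ℝ) * t + u)
          - (a * t + u) * wt (a * t + u)) := by
        rw [← Finset.mul_sum, sum_Icc_sub (fun k => ((k : ℝ) * t + u) * wt (k * t + u)) a b h]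
    _ ≤ 2 / τ * 2 := by
        have h2 := (abs_le.1 (hb (((b + 1 : ℤ) : ℝ) * t + u))).2
        have h3 := (abs_le.1 (hb (a * t + u))).1
        gcongr
        linarith
    _ = 4 * τ⁻¹ := by rw [div_eq_mul_inv]; ring
    _ ≤ 4 * (1 + t⁻¹) := by
        gcongr
        rcases min_choice t 1 with h | h
        · rw [hτ, h]; linarith
        · rw [hτ, h, inv_one]
          have : 0 < t⁻¹ := by positivity
          linarith

theorem sum_wt_sq_le_abs {t : ℝ} (ht : t ≠ 0) (u : ℝ) (a b : ℤ) (h : a ≤ b + 1) :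
    ∑ k ∈ Finset.Icc a b, wt (k * t + u) ^ 2 ≤ 4 * (1 + |t|⁻¹) := by
  rcases lt_or_gt_of_ne ht with h0 | h0
  · rw [abs_of_neg h0]
    refine le_trans (le_of_eq ?_) (sum_wt_sq_le (neg_pos.2 h0) (-u) a b h)
    refine Finset.sum_congr rfl fun k _ => ?_
    rw [← wt_neg]
    congr 2
    ring
  · rw [abs_of_pos h0]
    exact sum_wt_sq_le h0 u a b h

/-- Each term is at most 2(wt(a/2) - wt(a)) with a = T/2^j, so the sum telescopes. Uniformity in T
is what makes Φ bounded on the cone. -/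
theorem sum_scales_le {T : ℝ} (hT : 0 ≤ T) (n : ℕ) :
    ∑ j ∈ Finset.range n, T / 2 ^ j * wt (T / 2 ^ j) ^ 2 ≤ 2 := by
  have h : ∀ n : ℕ, ∑ j ∈ Finset.range n, T / 2 ^ j * wt (T / 2 ^ j) ^ 2
      ≤ 2 * (wt (T / 2 ^ n) - wt T) := by
    intro n
    induction n with
    | zero => simp
    | succ n ih =>
      rw [Finset.sum_range_succ]
      have h1 : T / 2 ^ (n + 1) = T / 2 ^ n / 2 := by rw [div_div, ← pow_succ]
      have h2 : 0 ≤ T / 2 ^ n := by positivity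
      rw [h1]
      set a := T / 2 ^ n
      have h3 : a * wt a ^ 2 ≤ 2 * (wt (a / 2) - wt a) := by
        unfold wt
        rw [abs_of_nonneg h2, abs_of_nonneg (by positivity), inv_sub_inv (by positivity)
          (by positivity), inv_pow, ← div_eq_mul_inv, ← mul_div_assoc,
          div_le_div_iff₀ (by positivity) (by positivity)]
        nlinarith [mul_nonneg h2 h2, mul_nonneg (mul_nonneg h2 h2) h2]
      linarith
  linarith [h n, wt_le_one (T / 2 ^ n), wt_pos T]

/-! ### Coordinates -/

theorem act_apply (A : Matrix (Fin 2) (Fin 2) ℝ) (x : Plane) (i : Fin 2) :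
    act A x i = A i 0 * x 0 + A i 1 * x 1 := by
  fin_cases i <;> simp [act, Matrix.toLpLin_apply]

theorem act_shear_scale_zero (k : ℤ) (a : ℝ) (ξ : Plane) :
    act ((shearMat (k : ℝ))ᵀ * scaleMat a) ξ 0 = a * ξ 0 := by
  simp [act_apply, shearMat, scaleMat, Matrix.mul_apply, Fin.sum_univ_two]

theorem act_shear_scale_one (k : ℤ) (a : ℝ) (ξ : Plane) :
    act ((shearMat (k : ℝ))ᵀ * scaleMat a) ξ 1 = k * (a * ξ 0) + √a * ξ 1 := by
  simp [act_apply, shearMat, scaleMat, Matrix.mul_apply, Fin.sum_univ_two, mul_assoc]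

theorem sampMat_inv {c₁ c₂ : ℝ} (h₁ : c₁ ≠ 0) (h₂ : c₂ ≠ 0) :
    (sampMat c₁ c₂)⁻¹ = sampMat c₁⁻¹ c₂⁻¹ := by
  refine Matrix.inv_eq_right_inv ?_
  ext i j
  fin_cases i <;> fin_cases j <;> simp [sampMat, Matrix.mul_apply, Fin.sum_univ_two, h₁, h₂]

theorem measurableSet_cone : MeasurableSet cone := by
  have h0 : Measurable fun ξ : Plane => ξ 0 := by fun_prop
  have h1 : Measurable fun ξ : Plane => |ξ 1 / ξ 0| := by fun_prop
  exact ((measurableSet_le measurable_const h0).inter (measurableSet_le h1 measurable_const)).union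
    ((measurableSet_le h0 measurable_const).inter (measurableSet_le h1 measurable_const))

theorem one_le_abs_of_mem_cone {ξ : Plane} (h : ξ ∈ cone) : 1 ≤ |ξ 0| ∧ |ξ 1 / ξ 0| ≤ 1 := by
  rcases h with ⟨h, h'⟩ | ⟨h, h'⟩
  · exact ⟨h.trans (le_abs_self _), h'⟩
  · exact ⟨by rw [abs_of_neg (by linarith)]; linarith, h'⟩

/-! ### Upper estimates for `Φ`, `Γ` and `R` -/

/-- The decay condition on the Fourier transform of a shearlet generator. -/
def HasShearletDecay (g : Plane → ℂ) (C : ℝ) : Prop :=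
  0 ≤ C ∧ ∀ η : Plane, ‖g η‖ ≤ C * (η 0 ^ 2 * wt (η 0) ^ 6 * wt (η 1) ^ 4)

/-- Two powers of decay per coordinate are traded for decay in ω by `wt_mul_wt_add_le`. What remains
of the factor at η suffices for the sums over shears and scales. -/
theorem HasShearletDecay.mul_le {g : Plane → ℂ} {C : ℝ} (h : HasShearletDecay g C) (η ω : Plane) :
    ‖g η‖ * ‖g (η + ω)‖ ≤
      C ^ 2 * (wt (ω 0) ^ 2 * wt (ω 1) ^ 2) * (η 0 ^ 2 * wt (η 0) ^ 4 * wt (η 1) ^ 2) := by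
  have h1 := h.2 η
  have h2 := h.2 (η + ω)
  have hC := h.1
  simp only [PiLp.add_apply] at h2
  have p1 := wt_pos (η 0)
  have p2 := wt_pos (η 1)
  have p3 := wt_pos (η 0 + ω 0)
  have p4 := wt_pos (η 1 + ω 1)
  have q1 := wt_mul_wt_add_le (η 0) (ω 0)
  have q2 := wt_mul_wt_add_le (η 1) (ω 1)
  have r1 := wt_le_one (η 0 + ω 0)
  have r2 := wt_le_one (η 1 + ω 1)
  have r3 := wt_le_one (η 1)
  have s1 : (η 0 + ω 0) ^ 2 * wt (η 0 + ω 0) ^ 2 ≤ 1 := by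
    rw [← sq_abs, ← mul_pow]
    exact pow_le_one₀ (by positivity) (abs_mul_wt_le_one _)
  set a := wt (η 0)
  set b := wt (η 1)
  set a' := wt (η 0 + ω 0)
  set b' := wt (η 1 + ω 1)
  calc ‖g η‖ * ‖g (η + ω)‖ ≤ (C * (η 0 ^ 2 * a ^ 6 * b ^ 4)) *
        (C * ((η 0 + ω 0) ^ 2 * a' ^ 6 * b' ^ 4)) := by gcongr
    _ = C ^ 2 * (η 0 ^ 2 * a ^ 4) * ((η 0 + ω 0) ^ 2 * a' ^ 2) * a' ^ 2 * (a * a') ^ 2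
          * (b * b') ^ 2 * b ^ 2 * b' ^ 2 := by ring
    _ ≤ C ^ 2 * (η 0 ^ 2 * a ^ 4) * 1 * 1 ^ 2 * wt (ω 0) ^ 2 * wt (ω 1) ^ 2 * b ^ 2 * 1 ^ 2 := by
        gcongr
    _ = _ := by ring

/-- At scale j the second coordinates form a progression of step t = 2^(-j) ξ₁, so the shears cost
4(1 + 1/|t|). This turns t² wt(t)⁴ into 4|t| wt(t)³, whose sum over scales is at most 8. -/
theorem HasShearletDecay.Phi_le {g : Plane → ℂ} {C : ℝ} (h : HasShearletDecay g C) {ξ : Plane}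
    (hξ : ξ 0 ≠ 0) (ω : Plane) :
    Phi g ξ ω ≤ ENNReal.ofReal (C ^ 2 * (wt (ω 0) ^ 2 * wt (ω 1) ^ 2) * 8) := by
  have hC := h.1
  set W := C ^ 2 * (wt (ω 0) ^ 2 * wt (ω 1) ^ 2) with hW
  have hW0 : 0 ≤ W := by positivity
  have key : ∀ j : ℕ, ∑ k ∈ shears j,
      ‖g (act ((shearMat (k : ℝ))ᵀ * scaleMat ((2 : ℝ) ^ j)⁻¹) ξ)‖ₑ *
      ‖g (act ((shearMat (k : ℝ))ᵀ * scaleMat ((2 : ℝ) ^ j)⁻¹) ξ + ω)‖ₑ ≤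
      ENNReal.ofReal (W * (4 * (|ξ 0| / 2 ^ j * wt (|ξ 0| / 2 ^ j) ^ 2))) := by
    intro j
    set t := ((2 : ℝ) ^ j)⁻¹ * ξ 0 with ht
    have ht0 : t ≠ 0 := mul_ne_zero (by positivity) hξ
    have hta : |ξ 0| / 2 ^ j = |t| := by
      rw [ht, abs_mul, abs_inv, abs_pow, abs_two, div_eq_inv_mul]
    have hwt : wt |t| = wt t := by simp [wt]
    rw [hta, hwt]
    simp only [← ofReal_norm]
    simp only [← ENNReal.ofReal_mul (norm_nonneg _)]
    rw [← ENNReal.ofReal_sum_of_nonneg fun _ _ => by positivity]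
    refine ENNReal.ofReal_le_ofReal ?_
    calc _ ≤ ∑ k ∈ shears j, W * (t ^ 2 * wt t ^ 4 * wt (k * t + √((2 : ℝ) ^ j)⁻¹ * ξ 1) ^ 2) := by
          refine Finset.sum_le_sum fun k _ => (h.mul_le _ ω).trans (le_of_eq ?_)
          rw [act_shear_scale_zero, act_shear_scale_one]
      _ = W * (t ^ 2 * wt t ^ 4) * ∑ k ∈ shears j, wt (k * t + √((2 : ℝ) ^ j)⁻¹ * ξ 1) ^ 2 := by
          rw [Finset.mul_sum]
          exact Finset.sum_congr rfl fun _ _ => by ring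
      _ ≤ W * (t ^ 2 * wt t ^ 4) * (4 * (1 + |t|⁻¹)) := by
          gcongr
          refine sum_wt_sq_le_abs ht0 _ _ _ ?_
          have : 0 ≤ ⌈(2 : ℝ) ^ ((j : ℝ) / 2)⌉ := Int.ceil_nonneg (by positivity)
          omega
      _ = W * (4 * (|t| * wt t ^ 2 * wt t)) := by
          have : 0 < |t| := abs_pos.2 ht0
          rw [← sq_abs t]
          unfold wt
          field_simp
          ring
      _ ≤ _ := by
          have h1 := wt_le_one t
          have h2 := wt_pos t
          exact mul_le_mul_of_nonneg_left (mul_le_mul_of_nonneg_left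
            (mul_le_of_le_one_right (by positivity) h1) (by norm_num)) hW0
  refine (ENNReal.tsum_le_tsum key).trans (ENNReal.tsum_le_of_sum_range_le fun n => ?_)
  rw [← ENNReal.ofReal_sum_of_nonneg fun j _ => by
    have := wt_pos (|ξ 0| / 2 ^ j); positivity]
  refine ENNReal.ofReal_le_ofReal ?_
  rw [← Finset.mul_sum, ← Finset.mul_sum]
  have := sum_scales_le (abs_nonneg (ξ 0)) n
  nlinarith

theorem HasShearletDecay.Gam_le {g : Plane → ℂ} {C : ℝ} (h : HasShearletDecay g C) (ω : Plane) :
    Gam g ω ≤ ENNReal.ofReal (C ^ 2 * (wt (ω 0) ^ 2 * wt (ω 1) ^ 2) * 8) := by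
  refine essSup_le_of_ae_le _ ?_
  filter_upwards [ae_restrict_mem measurableSet_cone] with ξ hξ
  refine h.Phi_le ?_ ω
  have := (one_le_abs_of_mem_cone hξ).1
  exact abs_pos.1 (by linarith)

theorem HasShearletDecay.Lsup_lt_top {g : Plane → ℂ} {C : ℝ} (h : HasShearletDecay g C) :
    Lsup g < ⊤ :=
  (h.Gam_le 0).trans_lt ENNReal.ofReal_lt_top

theorem summable_wt_sq : Summable fun k : ℤ => wt k ^ 2 := by
  have h : Summable fun n : ℕ => wt ((n : ℤ) : ℝ) ^ 2 := by
    have h1 := (summable_nat_add_iff 1).2 (Real.summable_one_div_nat_pow.2 (show 1 < 2 by norm_num))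
    refine h1.congr fun n => ?_
    simp [wt, add_comm]
  refine Summable.of_nat_of_neg h ?_
  simpa [wt_neg] using h

theorem summable_wt_sq_mul : Summable fun m : Fin 2 → ℤ => wt (m 0) ^ 2 * wt (m 1) ^ 2 := by
  have h := summable_wt_sq.mul_of_nonneg summable_wt_sq (fun _ => sq_nonneg _) fun _ => sq_nonneg _
  exact (finTwoArrowEquiv ℤ).summable_iff.2 h

/-- Some coordinate n of m is nonzero, and for it wt(n/c) ≤ 2c wt(n) ≤ 2c₁ wt(n), where c₂ ≤ c₁
enters. The other coordinate only uses c ≤ 1. Squaring produces the small factor c₁². -/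
theorem HasShearletDecay.R_le {g : Plane → ℂ} {C : ℝ} (h : HasShearletDecay g C) {c₁ c₂ : ℝ}
    (h₂ : 0 < c₂) (h₂₁ : c₂ ≤ c₁) (h₁ : c₁ ≤ 1) :
    R g c₁ c₂ ≤ ENNReal.ofReal
      (32 * C ^ 2 * c₁ ^ 2 * ∑' m : Fin 2 → ℤ, wt (m 0) ^ 2 * wt (m 1) ^ 2) := by
  have hc : 0 < c₁ := h₂.trans_le h₂₁
  have hwt : ∀ (n : ℤ) (c : ℝ), 0 < c → c ≤ 1 → wt (c⁻¹ * n) ≤ wt n := by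
    intro n c hc hc1
    refine wt_anti ?_
    rw [abs_mul, abs_of_pos (inv_pos.2 hc)]
    exact le_mul_of_one_le_left (abs_nonneg _) ((one_le_inv₀ hc).2 hc1)
  have hwt' : ∀ (n : ℤ) (c : ℝ), n ≠ 0 → 0 < c → c ≤ c₁ → wt (c⁻¹ * n) ≤ 2 * c₁ * wt n := by
    intro n c hn hc hc1
    have h1 : (1 : ℝ) ≤ |(n : ℝ)| := by exact_mod_cast Int.one_le_abs hn
    unfold wt
    rw [abs_mul, abs_of_pos (inv_pos.2 hc), ← div_eq_mul_inv, inv_eq_one_div,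
      div_le_div_iff₀ (by positivity) (by positivity), one_mul]
    have h2 : 1 ≤ c₁ * c⁻¹ := by rw [← div_eq_mul_inv, one_le_div hc]; exact hc1
    nlinarith
  have key : ∀ m : {m : Fin 2 → ℤ // m ≠ 0},
      (Gam g (act (sampMat c₁ c₂)⁻¹ (latticePt m)) *
      Gam g (-act (sampMat c₁ c₂)⁻¹ (latticePt m))) ^ (1 / 2 : ℝ) ≤
      ENNReal.ofReal (32 * C ^ 2 * c₁ ^ 2 * (wt (m.1 0) ^ 2 * wt (m.1 1) ^ 2)) := by
    rintro ⟨m, hm⟩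
    set ω := act (sampMat c₁ c₂)⁻¹ (latticePt m) with hω
    have hω0 : ω 0 = c₁⁻¹ * m 0 := by
      rw [hω, sampMat_inv hc.ne' h₂.ne', act_apply]; simp [sampMat, latticePt]
    have hω1 : ω 1 = c₂⁻¹ * m 1 := by
      rw [hω, sampMat_inv hc.ne' h₂.ne', act_apply]; simp [sampMat, latticePt]
    have hG : ∀ ω' : Plane, wt (ω' 0) = wt (ω 0) → wt (ω' 1) = wt (ω 1) →
        Gam g ω' ≤ ENNReal.ofReal (32 * C ^ 2 * c₁ ^ 2 * (wt (m 0) ^ 2 * wt (m 1) ^ 2)) := by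
      intro ω' h0 h1
      refine (h.Gam_le ω').trans (ENNReal.ofReal_le_ofReal ?_)
      rw [h0, h1, hω0, hω1]
      have p0 := wt_pos (c₁⁻¹ * m 0)
      have p1 := wt_pos (c₂⁻¹ * m 1)
      have q0 := wt_pos (m 0)
      have q1 := wt_pos (m 1)
      have : wt (c₁⁻¹ * m 0) * wt (c₂⁻¹ * m 1) ≤ 2 * c₁ * (wt (m 0) * wt (m 1)) := by
        by_cases hm0 : m 0 = 0
        · have hm1 : m 1 ≠ 0 := by
            intro hm1
            apply hm
            funext i
            fin_cases i
            · exact hm0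
            · exact hm1
          have a1 := hwt (m 0) c₁ hc h₁
          have a2 := hwt' (m 1) c₂ hm1 h₂ h₂₁
          calc _ ≤ wt (m 0) * (2 * c₁ * wt (m 1)) := by gcongr
            _ = _ := by ring
        · have a1 := hwt' (m 0) c₁ hm0 hc le_rfl
          have a2 := hwt (m 1) c₂ h₂ (h₂₁.trans h₁)
          calc _ ≤ (2 * c₁ * wt (m 0)) * wt (m 1) := by gcongr
            _ = _ := by ring
      calc C ^ 2 * (wt (c₁⁻¹ * m 0) ^ 2 * wt (c₂⁻¹ * m 1) ^ 2) * 8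
          = C ^ 2 * (wt (c₁⁻¹ * m 0) * wt (c₂⁻¹ * m 1)) ^ 2 * 8 := by ring
        _ ≤ C ^ 2 * (2 * c₁ * (wt (m 0) * wt (m 1))) ^ 2 * 8 := by gcongr
        _ = _ := by ring
    calc _ ≤ (ENNReal.ofReal (32 * C ^ 2 * c₁ ^ 2 * (wt (m 0) ^ 2 * wt (m 1) ^ 2)) ^ 2)
          ^ (1 / 2 : ℝ) := by
          rw [sq]
          refine ENNReal.rpow_le_rpow (mul_le_mul' (hG ω rfl rfl) (hG (-ω) ?_ ?_)) (by norm_num)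
          · simp [wt_neg]
          · simp [wt_neg]
      _ = _ := by
          rw [← ENNReal.rpow_natCast, ← ENNReal.rpow_mul]
          norm_num
  calc R g c₁ c₂ ≤ _ := ENNReal.tsum_le_tsum key
    _ ≤ ∑' m : Fin 2 → ℤ, ENNReal.ofReal (32 * C ^ 2 * c₁ ^ 2 * (wt (m 0) ^ 2 * wt (m 1) ^ 2)) :=
        ENNReal.tsum_comp_le_tsum_of_injective Subtype.val_injective _
    _ = _ := by
        rw [← ENNReal.ofReal_tsum_of_nonneg (fun m => by positivity)
          (summable_wt_sq_mul.mul_left _), tsum_mul_left]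

theorem HasShearletDecay.exists_R_lt {g : Plane → ℂ} {C : ℝ} (h : HasShearletDecay g C) {c₀ : ℝ}
    (hc₀ : 0 < c₀) :
    ∃ c > 0, ∀ c₁ c₂ : ℝ, 0 < c₂ → c₂ ≤ c₁ → c₁ ≤ c → R g c₁ c₂ < ENNReal.ofReal c₀ := by
  set D := 32 * C ^ 2 * ∑' m : Fin 2 → ℤ, wt (m 0) ^ 2 * wt (m 1) ^ 2 with hD
  have hD0 : 0 ≤ D := mul_nonneg (by positivity) (tsum_nonneg fun _ => by positivity)
  refine ⟨min 1 (c₀ / (2 * (D + 1))), lt_min one_pos (by positivity), ?_⟩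
  intro c₁ c₂ h₂ h₂₁ h₁
  have hc : 0 < c₁ := h₂.trans_le h₂₁
  have h3 := h₁.trans (min_le_left _ _)
  have h4 := h₁.trans (min_le_right _ _)
  rw [le_div_iff₀ (by positivity)] at h4
  refine (h.R_le h₂ h₂₁ h3).trans_lt ((ENNReal.ofReal_lt_ofReal_iff hc₀).2 ?_)
  calc _ = D * c₁ ^ 2 := by rw [hD]; ring
    _ ≤ D * c₁ := by gcongr; nlinarith
    _ < c₀ := by nlinarith

/-- The square of a generator with shearlet decay is integrable. -/
theorem HasShearletDecay.memLp {g : Plane → ℂ} {C : ℝ} (h : HasShearletDecay g C)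
    (hg : Measurable g) : MemLp g 2 volume := by
  have h1 : Integrable (fun ξ : Plane => C ^ 2 * (1 + ‖ξ‖) ^ (-(8 : ℝ))) :=
    (integrable_one_add_norm (by simp; norm_num)).const_mul _
  refine (memLp_two_iff_integrable_sq_norm hg.aestronglyMeasurable).2
    (h1.mono' (hg.norm.pow_const 2).aestronglyMeasurable (ae_of_all _ fun η => ?_))
  have hC := h.1
  have p1 := wt_pos (η 0)
  have p2 := wt_pos (η 1)
  have s1 : η 0 ^ 2 * wt (η 0) ^ 2 ≤ 1 := by
    rw [← sq_abs, ← mul_pow]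
    exact pow_le_one₀ (by positivity) (abs_mul_wt_le_one _)
  have h2 : wt (η 0) * wt (η 1) ≤ (1 + ‖η‖)⁻¹ := by
    unfold wt
    rw [← mul_inv]
    refine inv_anti₀ (by positivity) ?_
    have h3 : ‖η‖ ≤ |η 0| + |η 1| := by
      rw [EuclideanSpace.norm_eq, Fin.sum_univ_two, Real.sqrt_le_left (by positivity)]
      simp only [Real.norm_eq_abs]
      nlinarith [abs_nonneg (η 0), abs_nonneg (η 1)]
    nlinarith [mul_nonneg (abs_nonneg (η 0)) (abs_nonneg (η 1))]
  rw [Real.norm_of_nonneg (sq_nonneg _), Real.rpow_neg (by positivity),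
    show (8 : ℝ) = ((8 : ℕ) : ℝ) by norm_num, Real.rpow_natCast, ← inv_pow]
  calc ‖g η‖ ^ 2 ≤ (C * (η 0 ^ 2 * wt (η 0) ^ 6 * wt (η 1) ^ 4)) ^ 2 := by
        have := h.2 η; gcongr
    _ = C ^ 2 * ((η 0 ^ 2 * wt (η 0) ^ 2) ^ 2 * (wt (η 0) * wt (η 1)) ^ 8) := by ring
    _ ≤ C ^ 2 * (1 ^ 2 * (1 + ‖η‖)⁻¹ ^ 8) := by gcongr
    _ = _ := by ring

/-! ### The shearlet generator -/

variable {K L : ℕ} {m₀ m₁ : ℝ → ℂ}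

theorem IsMaxFlatFilter.measurable_shearletHat (h : IsMaxFlatFilter K L m₀) (hm : Measurable m₁) :
    Measurable (shearletHat m₀ m₁) := by
  have := h.measurable_scalingHat
  unfold shearletHat
  fun_prop

theorem IsMaxFlatFilter.exists_hasShearletDecay (h : IsMaxFlatFilter K L m₀) (hL : 10 ≤ L)
    (hK : 3 * L ≤ 2 * K) (h₁ : ∀ ξ : ℝ, ‖m₁ ξ‖ ^ 2 = ‖m₀ (ξ + 1 / 2)‖ ^ 2) :
    ∃ C, HasShearletDecay (shearletHat m₀ m₁) C := by
  obtain ⟨B, hB, hm⟩ := h.highpass_le hL hK h₁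
  refine ⟨B * 2 ^ K * 2 ^ K, by positivity, fun η => ?_⟩
  have a1 := hm (η 0)
  have a2 := h.norm_scalingHat_le hL hK (η 0)
  have a3 : ‖scalingHat m₀ (2 * η 1)‖ ≤ 2 ^ K * wt (η 1) ^ 4 := by
    refine (h.norm_scalingHat_le hL hK (2 * η 1)).trans ?_
    rw [wt, inv_pow, ← div_eq_mul_inv, abs_mul, abs_two]
    gcongr
    linarith [abs_nonneg (η 1)]
  rw [shearletHat, norm_mul, norm_mul]
  calc _ ≤ B * (η 0 ^ 2 / (1 + |η 0|) ^ 2) * (2 ^ K / (1 + |η 0|) ^ 4) *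
        (2 ^ K * wt (η 1) ^ 4) := by gcongr
    _ = _ := by
      unfold wt
      field_simp

/-- For every `ξ` in the cone, a single term of `Φ(ξ, 0)` dominates the explicit estimate. -/
theorem IsMaxFlatFilter.explicitLinf_le_Phi (h : IsMaxFlatFilter K L m₀) (hK : 0 < K) (hL : 2 ≤ L)
    (hKL : K + 2 ≤ 3 * L) (h₁ : ∀ ξ : ℝ, ‖m₁ ξ‖ ^ 2 = ‖m₀ (ξ + 1 / 2)‖ ^ 2) {J : ℕ}
    (hJ : (1 - ‖m₀ (1 / 6)‖ ^ 2) / 2 ^ J ≤ 1 / 2) {ξ : Plane} (hξ : ξ ∈ cone) :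
    ENNReal.ofReal (explicitLinf m₀ J) ≤ Phi (shearletHat m₀ m₁) ξ 0 := by
  obtain ⟨hξ0, hξ1⟩ := one_le_abs_of_mem_cone hξ
  -- The scale j = n + 1 brings the first coordinate into 1/12 ≤ |t| ≤ 1/6, the range of
  -- `le_highpass`.
  obtain ⟨n, hn1, hn2⟩ := exists_nat_pow_near (x := 6 * |ξ 0|) (y := (2 : ℝ)) (by linarith)
    (by norm_num)
  set j := n + 1 with hj
  set t := ((2 : ℝ) ^ j)⁻¹ * ξ 0 with ht
  have hta : |t| = |ξ 0| / 2 ^ j := by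
    rw [ht, abs_mul, abs_inv, abs_pow, abs_two, div_eq_inv_mul]
  have ht1 : 1 / 12 ≤ |t| := by
    rw [hta, le_div_iff₀ (by positivity), hj, pow_succ]; linarith
  have ht2 : |t| ≤ 1 / 6 := by
    rw [hta, div_le_iff₀ (by positivity)]; linarith
  have ht0 : t ≠ 0 := abs_pos.1 (by linarith)
  have hξ00 : ξ 0 ≠ 0 := abs_pos.1 (by linarith)
  set x := √((2 : ℝ) ^ j)⁻¹ * ξ 1 / t with hx
  set X := (2 : ℝ) ^ ((j : ℝ) / 2) with hX
  have hX2 : X = √((2 : ℝ) ^ j) := by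
    rw [hX, Real.sqrt_eq_rpow, ← Real.rpow_natCast, ← Real.rpow_mul (by norm_num)]
    congr 1; ring
  have hxX : |x| ≤ X := by
    have e : x = √((2 : ℝ) ^ j) * (ξ 1 / ξ 0) := by
      have hs : √((2 : ℝ) ^ j) * √((2 : ℝ) ^ j) = 2 ^ j := Real.mul_self_sqrt (by positivity)
      have hs0 : 0 < √((2 : ℝ) ^ j) := Real.sqrt_pos.2 (by positivity)
      rw [hx, ht, Real.sqrt_inv]
      generalize √((2 : ℝ) ^ j) = s at hs hs0
      rw [← hs]
      field_simp
    rw [e, abs_mul, hX2, abs_of_nonneg (Real.sqrt_nonneg _)]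
    exact mul_le_of_le_one_right (Real.sqrt_nonneg _) hξ1
  -- The nearest shear leaves |k + x| ≤ 1/2, so |2η₁| ≤ 2·(1/6)·(1/2) = 1/6. The cone condition
  -- gives |x| ≤ 2^(j/2), and the ceiling in `shears` keeps the rounded value admissible.
  set k := round (-x) with hk
  have hkx : |(k : ℝ) + x| ≤ 1 / 2 := by
    have := abs_sub_round (-x)
    rw [abs_sub_comm] at this
    simpa using this
  have hkm : k ∈ shears j := by
    have b1 := abs_le.1 hkx
    have b2 := abs_le.1 hxX
    have b3 := Int.le_ceil X
    rw [shears, Finset.mem_Icc, ← hX]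
    constructor
    · have : (-⌈X⌉ : ℝ) - 1 < k := by linarith
      have : -⌈X⌉ - 1 < k := by exact_mod_cast this
      omega
    · have : (k : ℝ) < ⌈X⌉ + 1 := by linarith
      have : k < ⌈X⌉ + 1 := by exact_mod_cast this
      omega
  set η := act ((shearMat (k : ℝ))ᵀ * scaleMat ((2 : ℝ) ^ j)⁻¹) ξ with hη
  have hη0 : η 0 = t := act_shear_scale_zero _ _ _
  have hη1 : η 1 = t * (k + x) := by
    rw [hη, act_shear_scale_one, hx, ← ht, mul_add, mul_div_cancel₀ _ ht0, mul_comm t]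
  have hη2 : |2 * η 1| ≤ 1 / 6 := by
    rw [hη1, abs_mul, abs_mul, abs_two]
    nlinarith [abs_nonneg t, abs_nonneg ((k : ℝ) + x)]
  have hmain : explicitLinf m₀ J ≤ ‖shearletHat m₀ m₁ η‖ * ‖shearletHat m₀ m₁ η‖ := by
    have c1 := h.le_highpass hK (by omega) h₁ ht1 ht2
    have c2 := h.le_normSq_scalingHat hK hL hKL hJ ht2
    have c3 := h.le_normSq_scalingHat hK hL hKL hJ hη2
    rw [explicitLinf, shearletHat, norm_mul, norm_mul, hη0]
    set q := (∏ j ∈ Finset.range J, ‖m₀ (((2 : ℝ) ^ j)⁻¹ / 6)‖ ^ 2) *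
      Real.exp (-(4 / 2 ^ J * (1 - ‖m₀ (1 / 6)‖ ^ 2))) with hq
    have hq0 : 0 ≤ q := mul_nonneg (Finset.prod_nonneg fun _ _ => sq_nonneg _) (Real.exp_pos _).le
    calc _ = ‖m₀ (1 / 6)‖ ^ 2 * q * q := by ring
      _ ≤ ‖m₁ (4 * t)‖ ^ 2 * ‖scalingHat m₀ t‖ ^ 2 * ‖scalingHat m₀ (2 * η 1)‖ ^ 2 := by gcongr
      _ = _ := by ring
  calc ENNReal.ofReal (explicitLinf m₀ J)
      ≤ ‖shearletHat m₀ m₁ η‖ₑ * ‖shearletHat m₀ m₁ (η + 0)‖ₑ := by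
        rw [add_zero, ← ofReal_norm, ← ENNReal.ofReal_mul (norm_nonneg _)]
        exact ENNReal.ofReal_le_ofReal hmain
    _ ≤ ∑ k ∈ shears j, ‖shearletHat m₀ m₁ (act ((shearMat (k : ℝ))ᵀ * scaleMat ((2 : ℝ) ^ j)⁻¹) ξ)‖ₑ *
        ‖shearletHat m₀ m₁ (act ((shearMat (k : ℝ))ᵀ * scaleMat ((2 : ℝ) ^ j)⁻¹) ξ + 0)‖ₑ :=
        Finset.single_le_sum (f := fun k : ℤ =>
          ‖shearletHat m₀ m₁ (act ((shearMat (k : ℝ))ᵀ * scaleMat ((2 : ℝ) ^ j)⁻¹) ξ)‖ₑ *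
          ‖shearletHat m₀ m₁ (act ((shearMat (k : ℝ))ᵀ * scaleMat ((2 : ℝ) ^ j)⁻¹) ξ + 0)‖ₑ)
          (fun _ _ => bot_le) hkm
    _ ≤ _ := ENNReal.le_tsum j

theorem IsMaxFlatFilter.explicitLinf_le_Linf (h : IsMaxFlatFilter K L m₀) (hK : 0 < K) (hL : 2 ≤ L)
    (hKL : K + 2 ≤ 3 * L) (h₁ : ∀ ξ : ℝ, ‖m₁ ξ‖ ^ 2 = ‖m₀ (ξ + 1 / 2)‖ ^ 2) {J : ℕ}
    (hJ : (1 - ‖m₀ (1 / 6)‖ ^ 2) / 2 ^ J ≤ 1 / 2) :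
    ENNReal.ofReal (explicitLinf m₀ J) ≤ Linf (shearletHat m₀ m₁) := by
  refine le_essInf_of_ae_le _ ?_
  filter_upwards [ae_restrict_mem measurableSet_cone] with ξ hξ
  exact h.explicitLinf_le_Phi hK hL hKL h₁ hJ hξ

/-! ### Periodization and Parseval's identity -/

section Periodization

open scoped Function

/-- The unit cell `(0, 1]^ι`. -/
def cell (ι : Type*) : Set (ι → ℝ) := {x | ∀ i, x i ∈ Set.Ioc (0 : ℝ) (0 + 1)}

/-- An integer vector as a real vector. -/
def intVec {ι : Type*} (n : ι → ℤ) : ι → ℝ := fun i => (n i : ℝ)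

/-- The square of a sum differs from the sum of the squares by at most the off-diagonal terms. -/
theorem enorm_tsum_sq_comparison {ι : Type*} {a : (ι → ℤ) → ℂ} (ha : ∑' n, ‖a n‖ₑ ≠ ⊤) :
    ‖∑' n, a n‖ₑ ^ 2 ≤ ∑' n, (‖a n‖ₑ ^ 2 + ∑' l : {l : ι → ℤ // l ≠ 0}, ‖a n‖ₑ * ‖a (n + l)‖ₑ) ∧
    ∑' n, ‖a n‖ₑ ^ 2 ≤ ‖∑' n, a n‖ₑ ^ 2 +
      ∑' n, ∑' l : {l : ι → ℤ // l ≠ 0}, ‖a n‖ₑ * ‖a (n + l)‖ₑ := by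
  have hs : Summable fun n => ‖a n‖ := by
    have := ENNReal.summable_toReal ha
    simpa using this
  have hsa : Summable a := hs.of_norm
  set S := ∑' n, a n with hS
  have hrest : ∀ n, ‖S - a n‖ₑ ≤ ∑' l : {l : ι → ℤ // l ≠ 0}, ‖a (n + l)‖ₑ := by
    intro n
    have h1 : Summable fun l : ι → ℤ => a (n + l) := (Equiv.addLeft n).summable_iff.2 hsa
    have h2 : S = ∑' l, a (n + l) := ((Equiv.addLeft n).tsum_eq a).symm
    have h3 := h1.tsum_subtype_add_tsum_subtype_compl {0}
    rw [tsum_singleton (0 : ι → ℤ) fun l => a (n + l), add_zero, ← h2] at h3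
    rw [← h3, add_sub_cancel_left]
    exact enorm_tsum_le_tsum_enorm
  have hA : ∀ n, ‖a n‖ ≤ ∑' n, ‖a n‖ := fun n => hs.le_tsum n fun _ _ => norm_nonneg _
  have hq : Summable fun n => ‖a n‖ ^ 2 := by
    refine Summable.of_nonneg_of_le (fun _ => sq_nonneg _) (fun n => ?_)
      (hs.mul_left (∑' n, ‖a n‖))
    rw [sq]
    exact mul_le_mul_of_nonneg_right (hA n) (norm_nonneg _)
  have hconj : Summable fun n => conj (a n) * S :=
    (Complex.conjCLE.summable.2 hsa).mul_right S
  have hqc : Summable fun n => ((‖a n‖ ^ 2 : ℝ) : ℂ) := Complex.ofRealCLM.summable hq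
  have hid : ∀ n, conj (a n) * S - ((‖a n‖ ^ 2 : ℝ) : ℂ) = conj (a n) * (S - a n) := by
    intro n
    have : ((‖a n‖ ^ 2 : ℝ) : ℂ) = conj (a n) * a n := by
      rw [Complex.conj_mul']; norm_cast
    rw [this]; ring
  have hcS : ∑' n, conj (a n) * S = conj S * S := by
    rw [tsum_mul_right]
    congr 1
    exact (Complex.conjCLE.map_tsum).symm
  have hdiff : conj S * S - ((∑' n, ‖a n‖ ^ 2 : ℝ) : ℂ) = ∑' n, conj (a n) * (S - a n) := by
    rw [← hcS, Complex.ofReal_tsum, ← hconj.tsum_sub hqc]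
    exact tsum_congr hid
  have hr : ‖∑' n, conj (a n) * (S - a n)‖ₑ ≤
      ∑' n, ∑' l : {l : ι → ℤ // l ≠ 0}, ‖a n‖ₑ * ‖a (n + l)‖ₑ := by
    refine enorm_tsum_le_tsum_enorm.trans (ENNReal.tsum_le_tsum fun n => ?_)
    rw [enorm_mul, RCLike.enorm_conj, ENNReal.tsum_mul_left]
    gcongr
    exact hrest n
  have hS2 : ‖conj S * S‖ₑ = ‖S‖ₑ ^ 2 := by rw [enorm_mul, RCLike.enorm_conj, sq]
  have hQ2 : ‖((∑' n, ‖a n‖ ^ 2 : ℝ) : ℂ)‖ₑ = ∑' n, ‖a n‖ₑ ^ 2 := by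
    rw [← ofReal_norm, Complex.norm_real, Real.norm_of_nonneg (tsum_nonneg fun _ => sq_nonneg _),
      ENNReal.ofReal_tsum_of_nonneg (fun _ => sq_nonneg _) hq]
    refine tsum_congr fun n => ?_
    rw [ENNReal.ofReal_pow (norm_nonneg _), ofReal_norm]
  rw [ENNReal.tsum_add]
  constructor
  · calc ‖S‖ₑ ^ 2 = ‖((∑' n, ‖a n‖ ^ 2 : ℝ) : ℂ) + ∑' n, conj (a n) * (S - a n)‖ₑ := by
          rw [← hS2, ← hdiff, add_sub_cancel]
      _ ≤ _ := (enorm_add_le _ _).trans (by rw [hQ2]; gcongr)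
  · calc ∑' n, ‖a n‖ₑ ^ 2 = ‖conj S * S - ∑' n, conj (a n) * (S - a n)‖ₑ := by
          rw [← hQ2, ← hdiff, sub_sub_cancel]
      _ ≤ _ := (enorm_sub_le).trans (by rw [hS2]; gcongr)

variable {ι : Type*} [Fintype ι]

theorem measurableSet_cell : MeasurableSet (cell ι) := by
  have : cell ι = Set.pi Set.univ fun _ => Set.Ioc (0 : ℝ) (0 + 1) := by
    ext x; simp [cell]
  rw [this]
  exact MeasurableSet.univ_pi fun _ => measurableSet_Ioc

/-- Lebesgue measure is the sum of the integer translates of its restriction to the unit cell. -/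
theorem sum_map_add_intVec :
    Measure.sum (fun n : ι → ℤ => (volume.restrict (cell ι)).map fun x => x + intVec n) =
      (volume : Measure (ι → ℝ)) := by
  have h1 : ∀ n : ι → ℤ, (volume.restrict (cell ι)).map (fun x => x + intVec n) =
      volume.restrict ((fun x : ι → ℝ => x - intVec n) ⁻¹' cell ι) := by
    intro n
    have h := (measurePreserving_add_right (volume : Measure (ι → ℝ)) (intVec n)).restrict_preimage
      (s := (fun x : ι → ℝ => x - intVec n) ⁻¹' cell ι)
      (measurableSet_cell.preimage (measurable_id.sub_const _))
    have h2 : (fun x => x + intVec n) ⁻¹' ((fun x : ι → ℝ => x - intVec n) ⁻¹' cell ι) = cell ι := by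
      ext x; simp
    rw [h2] at h
    exact h.map_eq
  -- The cell is open on the left and closed on the right, so the translate containing x is found
  -- with the ceiling and has index ⌈x⌉ - 1.
  have hmem : ∀ (n : ι → ℤ) (x : ι → ℝ), x ∈ (fun x : ι → ℝ => x - intVec n) ⁻¹' cell ι ↔
      ∀ i, ⌈x i⌉ = n i + 1 := by
    intro n x
    simp only [Set.mem_preimage, cell, Set.mem_ofPred_eq, Set.mem_Ioc, Int.ceil_eq_iff, intVec,
      Pi.sub_apply]
    refine forall_congr' fun i => ?_
    push_cast
    constructor <;> rintro ⟨h, h'⟩ <;> constructor <;> linarith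
  simp only [h1]
  rw [← Measure.restrict_iUnion]
  · rw [Set.iUnion_eq_univ_iff.2, Measure.restrict_univ]
    intro x
    exact ⟨fun i => ⌈x i⌉ - 1, (hmem _ _).2 fun i => by ring⟩
  · intro n n' hn
    refine Set.disjoint_left.2 fun x hx hx' => hn (funext fun i => ?_)
    have := (hmem n x).1 hx i
    have := (hmem n' x).1 hx' i
    omega
  · exact fun n => measurableSet_cell.preimage (measurable_id.sub_const _)

theorem lintegral_eq_lintegral_cell {f : (ι → ℝ) → ℝ≥0∞} (hf : Measurable f) :
    ∫⁻ x, f x = ∫⁻ x in cell ι, ∑' n : ι → ℤ, f (x + intVec n) := by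
  rw [lintegral_tsum]
  · conv_lhs => rw [← sum_map_add_intVec, lintegral_sum_measure]
    exact tsum_congr fun n => lintegral_map hf (measurable_id.add_const (intVec n))
  · exact fun n => (hf.comp (measurable_id.add_const _)).aemeasurable

theorem integral_eq_integral_cell {f : (ι → ℝ) → ℂ} (hf : Measurable f) (hi : Integrable f) :
    ∫ x, f x = ∫ x in cell ι, ∑' n : ι → ℤ, f (x + intVec n) := by
  have hi' := hi
  rw [← sum_map_add_intVec] at hi
  have h := (hasSum_integral_measure hi).tsum_eq
  rw [sum_map_add_intVec] at h
  rw [← h, integral_tsum]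
  · exact tsum_congr fun n => integral_map (measurable_id.add_const _).aemeasurable
      hf.aestronglyMeasurable
  · exact fun n => (hf.comp (measurable_id.add_const _)).aestronglyMeasurable
  · have hm : ∀ n : ι → ℤ, Measurable fun x => ‖f (x + intVec n)‖ₑ :=
      fun n => (hf.comp (measurable_id.add_const _)).enorm
    rw [← lintegral_tsum fun n => (hm n).aemeasurable,
      ← lintegral_eq_lintegral_cell (f := fun x => ‖f x‖ₑ) hf.enorm]
    exact hi'.2.ne

-- The probability Haar measure, for which the exponentials are orthonormal.
noncomputable local instance instCircleMeasureSpace : MeasureSpace UnitAddCircle :=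
  ⟨AddCircle.haarAddCircle⟩

/-- Parseval's identity for a square-integrable function on the torus. -/
theorem tsum_enorm_mFourierCoeff_sq {F : UnitAddTorus ι → ℂ} (hF : MemLp F 2 volume) :
    ∑' m, ‖UnitAddTorus.mFourierCoeff F m‖ₑ ^ 2 = ∫⁻ t, ‖F t‖ₑ ^ 2 := by
  have h := UnitAddTorus.hasSum_sq_mFourierCoeff hF.toLp
  have h1 : ∀ m, UnitAddTorus.mFourierCoeff (hF.toLp : UnitAddTorus ι → ℂ) m =
      UnitAddTorus.mFourierCoeff F m := by
    intro m
    refine integral_congr_ae ?_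
    filter_upwards [hF.coeFn_toLp] with t ht
    rw [ht]
  have h2 : ∫ t, ‖(hF.toLp : UnitAddTorus ι → ℂ) t‖ ^ 2 = ∫ t, ‖F t‖ ^ 2 := by
    refine integral_congr_ae ?_
    filter_upwards [hF.coeFn_toLp] with t ht
    rw [ht]
  simp only [h1, h2] at h
  have h3 := (memLp_two_iff_integrable_sq_norm hF.1).1 hF
  calc ∑' m, ‖UnitAddTorus.mFourierCoeff F m‖ₑ ^ 2
      = ∑' m, ENNReal.ofReal (‖UnitAddTorus.mFourierCoeff F m‖ ^ 2) := by
        refine tsum_congr fun m => ?_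
        rw [ENNReal.ofReal_pow (norm_nonneg _), ofReal_norm]
    _ = ENNReal.ofReal (∫ t, ‖F t‖ ^ 2) := by
        rw [← h.tsum_eq, ENNReal.ofReal_tsum_of_nonneg (fun _ => sq_nonneg _) h.summable]
    _ = ∫⁻ t, ‖F t‖ₑ ^ 2 := by
        rw [ofReal_integral_eq_lintegral_ofReal h3 (ae_of_all _ fun _ => sq_nonneg _)]
        refine lintegral_congr fun t => ?_
        rw [ENNReal.ofReal_pow (norm_nonneg _), ofReal_norm]

/-- The exponential `exp(2πi⟨m, x⟩)`. -/
noncomputable def expo (m : ι → ℤ) (x : ι → ℝ) : ℂ :=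
  Complex.exp (2 * Real.pi * Complex.I * (∑ i, (m i : ℝ) * x i : ℝ))

theorem expo_eq_mFourier (m : ι → ℤ) (x : ι → ℝ) :
    expo m x = UnitAddTorus.mFourier m fun i => (x i : UnitAddCircle) := by
  rw [expo, UnitAddTorus.mFourier]
  simp only [ContinuousMap.coe_mk, fourier_coe_apply]
  rw [← Complex.exp_sum]
  congr 1
  push_cast
  rw [Finset.mul_sum]
  refine Finset.sum_congr rfl fun i _ => ?_
  simp; ring

theorem expo_add_intVec (m n : ι → ℤ) (x : ι → ℝ) : expo m (x + intVec n) = expo m x := by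
  rw [expo_eq_mFourier, expo_eq_mFourier]
  congr 1
  funext i
  simp [intVec]

theorem norm_expo (m : ι → ℤ) (x : ι → ℝ) : ‖expo m x‖ = 1 := by
  rw [expo, show 2 * Real.pi * Complex.I * ((∑ i, (m i : ℝ) * x i : ℝ) : ℂ) =
    ((2 * Real.pi * ∑ i, (m i : ℝ) * x i : ℝ) : ℂ) * Complex.I by push_cast; ring]
  exact Complex.norm_exp_ofReal_mul_I _

theorem continuous_expo (m : ι → ℤ) : Continuous (expo m) := by
  unfold expo
  fun_prop

/-- The squared Fourier integrals of `v` at the integer points compare with `∫ |v|²` up to the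
overlaps of `v` with its integer translates. -/
theorem tsum_fourier_comparison {v : (ι → ℝ) → ℂ} (hv : Measurable v) (hi : Integrable v)
    (hfin : ∫⁻ x, ‖v x‖ₑ ^ 2 + ∑' l : {l : ι → ℤ // l ≠ 0}, ‖v x‖ₑ * ‖v (x + intVec l)‖ₑ ≠ ⊤) :
    ∑' m : ι → ℤ, ‖∫ x, v x * expo m x‖ₑ ^ 2 ≤
      ∫⁻ x, ‖v x‖ₑ ^ 2 + ∑' l : {l : ι → ℤ // l ≠ 0}, ‖v x‖ₑ * ‖v (x + intVec l)‖ₑ ∧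
    ∫⁻ x, ‖v x‖ₑ ^ 2 ≤ (∑' m : ι → ℤ, ‖∫ x, v x * expo m x‖ₑ ^ 2) +
      ∫⁻ x, ∑' l : {l : ι → ℤ // l ≠ 0}, ‖v x‖ₑ * ‖v (x + intVec l)‖ₑ := by
  have hadd : ∀ n : ι → ℤ, Measurable fun x : ι → ℝ => x + intVec n :=
    fun n => measurable_id.add_const _
  have intVec_add : ∀ n l : ι → ℤ, intVec (n + l) = intVec n + intVec l := by
    intro n l; funext i; simp [intVec]
  set P : (ι → ℝ) → ℂ := fun x => ∑' n : ι → ℤ, v (x + intVec n) with hP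
  have hPm : Measurable P := Measurable.tsum fun n => hv.comp (hadd n)
  have hvm : Measurable fun x => ‖v x‖ₑ := hv.enorm
  have hoffm : Measurable fun x => ∑' l : {l : ι → ℤ // l ≠ 0}, ‖v x‖ₑ * ‖v (x + intVec l)‖ₑ :=
    Measurable.tsum fun l => hvm.mul (hvm.comp (hadd l))
  have hsummable : ∀ᵐ x ∂volume.restrict (cell ι), ∑' n : ι → ℤ, ‖v (x + intVec n)‖ₑ ≠ ⊤ := by
    have h1 := lintegral_eq_lintegral_cell hvm
    have h2 : ∫⁻ x in cell ι, ∑' n : ι → ℤ, ‖v (x + intVec n)‖ₑ ≠ ⊤ := by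
      rw [← h1]; exact hi.2.ne
    filter_upwards [ae_lt_top (Measurable.tsum fun n => hvm.comp (hadd n)) h2] with x hx
    exact hx.ne
  have hcmp := hsummable.mono fun x hx =>
    enorm_tsum_sq_comparison (a := fun n => v (x + intVec n)) hx
  have hup : ∫⁻ x in cell ι, ‖P x‖ₑ ^ 2 ≤
      ∫⁻ x, ‖v x‖ₑ ^ 2 + ∑' l : {l : ι → ℤ // l ≠ 0}, ‖v x‖ₑ * ‖v (x + intVec l)‖ₑ := by
    rw [lintegral_eq_lintegral_cell (f := fun x => ‖v x‖ₑ ^ 2 +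
      ∑' l : {l : ι → ℤ // l ≠ 0}, ‖v x‖ₑ * ‖v (x + intVec l.1)‖ₑ) ((hvm.pow_const 2).add hoffm)]
    refine lintegral_mono_ae (hcmp.mono fun x hx => hx.1.trans (le_of_eq ?_))
    simp only [intVec_add, add_assoc]
  have hlow : ∫⁻ x, ‖v x‖ₑ ^ 2 ≤ (∫⁻ x in cell ι, ‖P x‖ₑ ^ 2) +
      ∫⁻ x, ∑' l : {l : ι → ℤ // l ≠ 0}, ‖v x‖ₑ * ‖v (x + intVec l)‖ₑ := by
    rw [lintegral_eq_lintegral_cell (hvm.pow_const 2), lintegral_eq_lintegral_cell hoffm,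
      ← lintegral_add_left (hPm.enorm.pow_const 2)]
    refine lintegral_mono_ae (hcmp.mono fun x hx => hx.2.trans (le_of_eq ?_))
    simp only [hP, intVec_add, add_assoc]
  -- A measurable section of the quotient map with values in the cell; through it the periodization
  -- becomes a function on the torus.
  set s : UnitAddTorus ι → ι → ℝ := fun t =>
    (UnitAddTorus.measurableEquivPiIoc (0 : ι → ℝ) t).1 with hs
  have hsm : Measurable s :=
    measurable_subtype_coe.comp (UnitAddTorus.measurableEquivPiIoc (0 : ι → ℝ)).measurable
  have hsc : ∀ x ∈ cell ι, s (fun i => (x i : UnitAddCircle)) = x := by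
    intro x hx
    have := (UnitAddTorus.measurableEquivPiIoc (0 : ι → ℝ)).apply_symm_apply ⟨x, hx⟩
    exact congrArg Subtype.val this
  have hL2 : ∫⁻ t, ‖P (s t)‖ₑ ^ 2 = ∫⁻ x in cell ι, ‖P x‖ₑ ^ 2 := by
    rw [UnitAddTorus.lintegral_preimage (fun t => ‖P (s t)‖ₑ ^ 2) 0]
    refine setLIntegral_congr_fun measurableSet_cell fun x hx => ?_
    simp only [hsc x hx]
  have hmem : MemLp (fun t => P (s t)) 2 volume := by
    refine ⟨(hPm.comp hsm).aestronglyMeasurable, ?_⟩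
    rw [eLpNorm_lt_top_iff_lintegral_rpow_enorm_lt_top (by norm_num) (by norm_num)]
    simp only [ENNReal.toReal_ofNat, ENNReal.rpow_ofNat]
    rw [hL2]
    exact hup.trans_lt hfin.lt_top
  -- Fourier coefficients carry the conjugate exponential, hence -m; the reindexing m ↦ -m in
  -- Parseval's identity undoes the sign.
  have hcoeff : ∀ m : ι → ℤ, UnitAddTorus.mFourierCoeff (fun t => P (s t)) (-m) =
      ∫ x, v x * expo m x := by
    intro m
    have hint : Integrable fun x => v x * expo m x :=
      hi.mul_bdd (c := 1) (continuous_expo m).aestronglyMeasurable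
        (ae_of_all _ fun x => (norm_expo m x).le)
    rw [UnitAddTorus.mFourierCoeff_eq_integral _ _ 0, neg_neg,
      integral_eq_integral_cell (f := fun x => v x * expo m x)
        (hv.mul (continuous_expo m).measurable) hint]
    refine setIntegral_congr_fun measurableSet_cell fun x hx => ?_
    simp only [hsc x hx, expo_add_intVec, tsum_mul_right, ← expo_eq_mFourier, smul_eq_mul, hP]
    rw [mul_comm]
  have hpars := tsum_enorm_mFourierCoeff_sq hmem
  rw [← (Equiv.neg (ι → ℤ)).tsum_eq] at hpars
  simp only [Equiv.neg_apply, hcoeff, hL2] at hpars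
  rw [hpars]
  exact ⟨hup, hlow⟩

end Periodization

/-! ### Linear changes of variables in the plane -/

theorem act_mul (A B : Matrix (Fin 2) (Fin 2) ℝ) (x : Plane) : act (A * B) x = act A (act B x) := by
  ext i
  simp only [act_apply, Matrix.mul_apply, Fin.sum_univ_two]
  ring

theorem act_one (x : Plane) : act 1 x = x := by
  ext i
  revert i
  rw [Fin.forall_fin_two]
  constructor <;> simp [act_apply]

theorem act_nonsing_inv {A : Matrix (Fin 2) (Fin 2) ℝ} (hA : A.det ≠ 0) (x : Plane) :
    act A (act A⁻¹ x) = x := by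
  rw [← act_mul, Matrix.mul_nonsing_inv _ (isUnit_iff_ne_zero.2 hA), act_one]

theorem act_nonsing_inv' {A : Matrix (Fin 2) (Fin 2) ℝ} (hA : A.det ≠ 0) (x : Plane) :
    act A⁻¹ (act A x) = x := by
  rw [← act_mul, Matrix.nonsing_inv_mul _ (isUnit_iff_ne_zero.2 hA), act_one]

theorem inner_act (A : Matrix (Fin 2) (Fin 2) ℝ) (x y : Plane) :
    inner ℝ (act A x) y = inner ℝ x (act Aᵀ y) := by
  simp only [PiLp.inner_apply, Fin.sum_univ_two, act_apply, Matrix.transpose_apply,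
    RCLike.inner_apply, conj_trivial]
  ring

theorem continuous_act (A : Matrix (Fin 2) (Fin 2) ℝ) : Continuous (act A) :=
  LinearMap.continuous_of_finiteDimensional _

theorem measurable_act (A : Matrix (Fin 2) (Fin 2) ℝ) : Measurable (act A) :=
  (continuous_act A).measurable

theorem map_act {A : Matrix (Fin 2) (Fin 2) ℝ} (hA : A.det ≠ 0) :
    (volume : Measure Plane).map (act A) = ENNReal.ofReal |A.det⁻¹| • volume := by
  have hdet : LinearMap.det (Matrix.toEuclideanLin A) ≠ 0 := by
    rwa [LinearMap.det_toLpLin]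
  rw [Measure.map_linearMap_addHaar_eq_smul_addHaar volume hdet, LinearMap.det_toLpLin]

theorem map_act_sub {A : Matrix (Fin 2) (Fin 2) ℝ} (hA : A.det ≠ 0) (b : Plane) :
    (volume : Measure Plane).map (fun x => act A x - b) = ENNReal.ofReal |A.det⁻¹| • volume := by
  have h : (fun x => act A x - b) = (fun y => y - b) ∘ act A := rfl
  rw [h, ← Measure.map_map (show Measurable fun y : Plane => y - b from measurable_id.sub_const b)
    (measurable_act A), map_act hA,
    Measure.map_smul, (measurePreserving_sub_right volume b).map_eq]

/-- The parametrization of the plane by `x ↦ D⁻¹ x`. -/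
theorem map_act_toLp {D : Matrix (Fin 2) (Fin 2) ℝ} (hD : D.det ≠ 0) :
    (volume : Measure (Fin 2 → ℝ)).map (fun x => act D⁻¹ (WithLp.toLp 2 x)) =
      ENNReal.ofReal |D.det| • volume := by
  have h : (fun x : Fin 2 → ℝ => act D⁻¹ (WithLp.toLp 2 x)) = act D⁻¹ ∘ WithLp.toLp 2 := rfl
  have hdet : D⁻¹.det = D.det⁻¹ := by
    rw [Matrix.det_nonsing_inv, Ring.inverse_eq_inv']
  rw [h, ← Measure.map_map (measurable_act _) (PiLp.volume_preserving_toLp (Fin 2)).measurable,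
    (PiLp.volume_preserving_toLp (Fin 2)).map_eq, map_act (by rw [hdet]; exact inv_ne_zero hD),
    hdet, inv_inv]

/-- The substitution x = Dξ reduces to integer translates. Squared Fourier integrals acquire |det
D|² and the other integrals |det D|, so one factor remains after cancelling. -/
theorem lattice_fourier_comparison {D : Matrix (Fin 2) (Fin 2) ℝ} (hD : D.det ≠ 0)
    {u : Plane → ℂ} (hu : Measurable u) (hi : Integrable u)
    (hfin : ∫⁻ ξ, ‖u ξ‖ₑ ^ 2 + ∑' l : {l : Fin 2 → ℤ // l ≠ 0},
      ‖u ξ‖ₑ * ‖u (ξ + act D⁻¹ (latticePt l))‖ₑ ≠ ⊤) :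
    ENNReal.ofReal |D.det| * ∑' m : Fin 2 → ℤ, ‖∫ ξ, u ξ * expo m (act D ξ)‖ₑ ^ 2 ≤
      ∫⁻ ξ, ‖u ξ‖ₑ ^ 2 + ∑' l : {l : Fin 2 → ℤ // l ≠ 0},
        ‖u ξ‖ₑ * ‖u (ξ + act D⁻¹ (latticePt l))‖ₑ ∧
    ∫⁻ ξ, ‖u ξ‖ₑ ^ 2 ≤
      ENNReal.ofReal |D.det| * (∑' m : Fin 2 → ℤ, ‖∫ ξ, u ξ * expo m (act D ξ)‖ₑ ^ 2) +
      ∫⁻ ξ, ∑' l : {l : Fin 2 → ℤ // l ≠ 0}, ‖u ξ‖ₑ * ‖u (ξ + act D⁻¹ (latticePt l))‖ₑ := by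
  set T : (Fin 2 → ℝ) → Plane := fun x => act D⁻¹ (WithLp.toLp 2 x) with hT
  set κ := ENNReal.ofReal |D.det| with hκ
  have hκ0 : κ ≠ 0 := by simpa [hκ] using hD
  have hκt : κ ≠ ⊤ := ENNReal.ofReal_ne_top
  have hTm : Measurable T :=
    (measurable_act _).comp (PiLp.volume_preserving_toLp (Fin 2)).measurable
  have hmap : (volume : Measure (Fin 2 → ℝ)).map T = κ • volume := map_act_toLp hD
  have hlin : ∀ {f : Plane → ℝ≥0∞}, Measurable f → ∫⁻ x, f (T x) = κ * ∫⁻ ξ, f ξ := by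
    intro f hf
    rw [← lintegral_map hf hTm, hmap, lintegral_smul_measure, smul_eq_mul]
  have hint : ∀ m : Fin 2 → ℤ, ∫ x, u (T x) * expo m x =
      ((|D.det| : ℝ) : ℂ) * ∫ ξ, u ξ * expo m (act D ξ) := by
    intro m
    have hm : Measurable fun ξ : Plane => u ξ * expo m (act D ξ) :=
      hu.mul ((continuous_expo m).measurable.comp
        ((PiLp.continuous_ofLp 2 _).measurable.comp (measurable_act D)))
    have h1 := integral_map hTm.aemeasurable (μ := volume) hm.aestronglyMeasurable
    rw [hmap, integral_smul_measure, hκ, ENNReal.toReal_ofReal (abs_nonneg _)] at h1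
    rw [← Complex.real_smul, h1]
    refine integral_congr_ae (ae_of_all _ fun x => ?_)
    simp only [hT, act_nonsing_inv hD]
  have hadd : ∀ (x : Fin 2 → ℝ) (l : Fin 2 → ℤ), T (x + intVec l) = T x + act D⁻¹ (latticePt l) := by
    intro x l
    simp only [hT, act, WithLp.toLp_add, map_add]
    rfl
  have hum := hu.enorm
  have hoff : Measurable fun ξ => ∑' l : {l : Fin 2 → ℤ // l ≠ 0},
      ‖u ξ‖ₑ * ‖u (ξ + act D⁻¹ (latticePt l))‖ₑ :=
    Measurable.tsum fun l => hum.mul (hum.comp (measurable_id.add_const _))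
  have hvi : Integrable fun x => u (T x) := by
    refine Integrable.comp_measurable (f := T) ?_ hTm
    rw [hmap]
    exact hi.smul_measure hκt
  have main := tsum_fourier_comparison (v := fun x => u (T x)) (hu.comp hTm) hvi
  simp only [hadd, hint, enorm_mul, mul_pow, ENNReal.tsum_mul_left (a := ‖((|D.det| : ℝ) : ℂ)‖ₑ ^ 2)]
    at main
  have hn : ‖((|D.det| : ℝ) : ℂ)‖ₑ = κ := by
    rw [← ofReal_norm, Complex.norm_real, Real.norm_of_nonneg (abs_nonneg _)]
  rw [hn, hlin (f := fun ξ => ‖u ξ‖ₑ ^ 2 + ∑' l : {l : Fin 2 → ℤ // l ≠ 0},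
    ‖u ξ‖ₑ * ‖u (ξ + act D⁻¹ (latticePt l.1))‖ₑ) ((hum.pow_const 2).add hoff),
    hlin (f := fun ξ => ‖u ξ‖ₑ ^ 2) (hum.pow_const 2), hlin hoff] at main
  obtain ⟨h1, h2⟩ := main (ENNReal.mul_ne_top hκt hfin)
  rw [sq, mul_assoc] at h1 h2
  rw [← mul_add] at h2
  exact ⟨(ENNReal.mul_le_mul_iff_right hκ0 hκt).1 h1, (ENNReal.mul_le_mul_iff_right hκ0 hκt).1 h2⟩

/-! ### The Fourier transform and affine changes of variables -/

section WeightedComposition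

variable {T : Plane → Plane} {e : Plane → ℂ} {κ : ℝ≥0∞} {M : NNReal}

theorem memLp_weightedComp (hT : Measurable T) (hmap : (volume : Measure Plane).map T = κ • volume)
    (hκ : κ ≠ ⊤) (he : Measurable e) (hM : ∀ x, ‖e x‖ ≤ M) {f : Plane → ℂ} (hf : MemLp f 2 volume) :
    MemLp (fun x => e x * f (T x)) 2 volume := by
  have h1 : MemLp (fun x => f (T x)) 2 volume := by
    refine MemLp.comp_of_map (g := f) (f := T) ?_ hT.aemeasurable
    rw [hmap]
    exact hf.smul_measure hκ
  refine h1.of_le_mul (c := M) (he.aestronglyMeasurable.mul h1.1) (ae_of_all _ fun x => ?_)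
  rw [norm_mul]
  exact mul_le_mul_of_nonneg_right (hM x) (norm_nonneg _)

/-- Both sides of the transformation rule in `fourier_affine` involve such operators; continuity
extends the rule from Schwartz functions to all of L² by density. -/
theorem continuous_weightedComp (hT : Measurable T)
    (hmap : (volume : Measure Plane).map T = κ • volume) (hκ : κ ≠ ⊤) (he : Measurable e)
    (hM : ∀ x, ‖e x‖ ≤ M) :
    Continuous fun f : L2 => (memLp_weightedComp hT hmap hκ he hM (Lp.memLp f)).toLp := by
  have hc : M • κ ^ (1 / 2 : ℝ) ≠ ⊤ :=
    ENNReal.mul_ne_top ENNReal.coe_ne_top (ENNReal.rpow_ne_top_of_nonneg (by norm_num) hκ)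
  refine LipschitzWith.continuous (K := (M • κ ^ (1 / 2 : ℝ)).toNNReal) fun f g => ?_
  rw [ENNReal.coe_toNNReal hc, Lp.edist_toLp_toLp, Lp.edist_def, smul_mul_assoc]
  have hfg : AEStronglyMeasurable ((f : Plane → ℂ) - (g : Plane → ℂ)) (κ • volume) :=
    ((Lp.aestronglyMeasurable f).sub (Lp.aestronglyMeasurable g)).smul_measure κ
  have h1 : eLpNorm (fun x => ((f : Plane → ℂ) - (g : Plane → ℂ)) (T x)) 2 volume =
      κ ^ (1 / 2 : ℝ) * eLpNorm ((f : Plane → ℂ) - (g : Plane → ℂ)) 2 volume := by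
    have := eLpNorm_map_measure (p := 2) (μ := volume) (f := T) (by rw [hmap]; exact hfg)
      hT.aemeasurable
    rw [hmap, eLpNorm_smul_measure_of_ne_top (by norm_num)] at this
    simpa [Function.comp_def] using this.symm
  rw [← h1]
  refine eLpNorm_le_nnreal_smul_eLpNorm_of_ae_le_mul (ae_of_all _ fun x => ?_) 2
  rw [Pi.sub_apply, ← mul_sub, nnnorm_mul]
  exact mul_le_mul_of_nonneg_right (hM x) zero_le

end WeightedComposition

open Real in
/-- The Fourier transform of `x ↦ f(Bx - b)` for a Schwartz function `f`. -/
theorem fourier_schwartz_affine {B : Matrix (Fin 2) (Fin 2) ℝ} (hB : B.det ≠ 0) (b : Plane)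
    (f : SchwartzMap Plane ℂ) (ξ : Plane) :
    𝓕 (fun x : Plane => f (act B x - b)) ξ =
      (|B.det⁻¹| * 𝐞 (-inner ℝ b (act (B⁻¹)ᵀ ξ)) : ℂ) * 𝓕 (f : Plane → ℂ) (act (B⁻¹)ᵀ ξ) := by
  set G : Plane → ℂ := fun y => 𝐞 (-inner ℝ (act B⁻¹ (y + b)) ξ) • f y with hG
  have hGm : Measurable G := by
    have h1 : Continuous fun y : Plane => (-inner ℝ (act B⁻¹ (y + b)) ξ : ℝ) :=
      (((continuous_act _).comp (continuous_id.add_const b)).inner continuous_const).neg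
    exact ((Real.continuous_fourierChar.comp h1).smul f.continuous).measurable
  rw [Real.fourier_eq, Real.fourier_eq]
  have h1 : ∀ x : Plane, 𝐞 (-inner ℝ x ξ) • f (act B x - b) = G (act B x - b) := by
    intro x
    simp only [hG, sub_add_cancel, act_nonsing_inv' hB]
  simp only [h1]
  have h2 := integral_map (μ := volume)
    (((measurable_act B).sub_const b).aemeasurable) hGm.aestronglyMeasurable
  rw [map_act_sub hB, integral_smul_measure, ENNReal.toReal_ofReal (abs_nonneg _)] at h2
  rw [← h2, mul_assoc, Complex.real_smul]
  congr 1
  rw [← integral_const_mul]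
  refine integral_congr_ae (ae_of_all _ fun y => ?_)
  simp only [hG, inner_act, inner_add_left, neg_add, AddChar.map_add_eq_mul, Circle.smul_def,
    Circle.coe_mul, smul_eq_mul]
  ring

open Real in
/-- The Fourier transform on `L²` of `x ↦ f(Bx - b)`. -/
theorem fourier_affine {B : Matrix (Fin 2) (Fin 2) ℝ} (hB : B.det ≠ 0) (b : Plane) (f : L2) :
    (𝓕 ((memLp_comp_affine (Lp.memLp f) hB b).toLp : L2) : L2) =ᵐ[volume] fun ξ =>
      (|B.det⁻¹| * 𝐞 (-inner ℝ b (act (B⁻¹)ᵀ ξ)) : ℂ) * (𝓕 f : L2) (act (B⁻¹)ᵀ ξ) := by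
  set e : Plane → ℂ := fun ξ => (|B.det⁻¹| * 𝐞 (-inner ℝ b (act (B⁻¹)ᵀ ξ)) : ℂ) with he
  have hem : Measurable e := by
    have h1 : Continuous fun ξ : Plane => (-inner ℝ b (act (B⁻¹)ᵀ ξ) : ℝ) :=
      (continuous_const.inner (continuous_act _)).neg
    exact (continuous_const.mul (continuous_subtype_val.comp
      (Real.continuous_fourierChar.comp h1))).measurable
  have heM : ∀ ξ, ‖e ξ‖ ≤ (⟨|B.det⁻¹|, abs_nonneg _⟩ : NNReal) := by
    intro ξ
    rw [he, norm_mul, Circle.norm_coe, mul_one, Complex.norm_real, Real.norm_of_nonneg (abs_nonneg _)]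
  have hdet' : ((B⁻¹)ᵀ).det ≠ 0 := by
    rw [Matrix.det_transpose, Matrix.det_nonsing_inv, Ring.inverse_eq_inv']
    exact inv_ne_zero hB
  have hone : ∀ x : Plane, ‖(fun _ : Plane => (1 : ℂ)) x‖ ≤ (1 : NNReal) := by simp
  have hU : ∀ f : L2, ((memLp_comp_affine (Lp.memLp f) hB b).toLp : L2) =
      (memLp_weightedComp ((measurable_act B).sub_const b) (map_act_sub hB b) ENNReal.ofReal_ne_top
        measurable_const hone (Lp.memLp f)).toLp := by
    intro f
    refine (MemLp.toLp_eq_toLp_iff _ _).2 (ae_of_all _ fun x => ?_)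
    simp
  suffices h : ∀ f : L2, (𝓕 ((memLp_comp_affine (Lp.memLp f) hB b).toLp : L2) : L2) =
      (memLp_weightedComp (measurable_act _) (map_act hdet') ENNReal.ofReal_ne_top hem heM
        (Lp.memLp (𝓕 f : L2))).toLp by
    rw [h f]
    exact MemLp.coeFn_toLp _
  intro f
  refine DenseRange.induction_on (p := fun f : L2 =>
    (𝓕 ((memLp_comp_affine (Lp.memLp f) hB b).toLp : L2) : L2) =
      (memLp_weightedComp (measurable_act _) (map_act hdet') ENNReal.ofReal_ne_top hem heM
        (Lp.memLp (𝓕 f : L2))).toLp)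
    (SchwartzMap.denseRange_toLpCLM (E := Plane) (F := ℂ) (p := 2) ENNReal.ofNat_ne_top) f ?_ ?_
  · simp only [hU]
    refine isClosed_eq ?_ ?_
    · exact (Lp.fourierTransformₗᵢ Plane ℂ).continuous.comp (continuous_weightedComp
        ((measurable_act B).sub_const b) (map_act_sub hB b) ENNReal.ofReal_ne_top
        measurable_const hone)
    · exact (continuous_weightedComp (measurable_act _) (map_act hdet') ENNReal.ofReal_ne_top hem
        heM).comp (Lp.fourierTransformₗᵢ Plane ℂ).continuous
  · intro f
    simp only [SchwartzMap.toLpCLM_apply]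
    let Bl : Plane ≃L[ℝ] Plane := (LinearEquiv.ofIsUnitDet (f := Matrix.toEuclideanLin B)
      (v := (EuclideanSpace.basisFun (Fin 2) ℝ).toBasis)
      (v' := (EuclideanSpace.basisFun (Fin 2) ℝ).toBasis) (by
        rw [LinearMap.det_toMatrix, LinearMap.det_toLpLin]
        exact isUnit_iff_ne_zero.2 hB)).toContinuousLinearEquiv
    have hBl : ∀ x, Bl x = act B x := fun x => rfl
    set h : SchwartzMap Plane ℂ := SchwartzMap.compCLMOfContinuousLinearEquiv ℂ Bl
      (SchwartzMap.compSubConstCLM ℂ b f) with hh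
    have hhx : (h : Plane → ℂ) = fun x => f (act B x - b) := by
      funext x
      simp [hh, hBl]
    have hUh : ((memLp_comp_affine (Lp.memLp (f.toLp 2)) hB b).toLp : L2) = h.toLp 2 := by
      refine Lp.ext ((MemLp.coeFn_toLp _).trans ?_)
      have hq : Measure.QuasiMeasurePreserving (fun x : Plane => act B x - b) volume volume :=
        ⟨(measurable_act B).sub_const b, by
          rw [map_act_sub hB]; exact Measure.smul_absolutelyContinuous⟩
      have h1 := hq.ae_eq_comp (SchwartzMap.coeFn_toLp f 2 (volume : Measure Plane))
      filter_upwards [h1, SchwartzMap.coeFn_toLp h 2 (volume : Measure Plane)] with x hx hx'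
      rw [hx', hhx]
      exact hx
    rw [hUh, SchwartzMap.toLp_fourier_eq]
    refine Lp.ext ?_
    refine (SchwartzMap.coeFn_toLp _ 2 (volume : Measure Plane)).trans ?_
    refine Filter.EventuallyEq.trans ?_ (MemLp.coeFn_toLp _).symm
    have hq : Measure.QuasiMeasurePreserving (act (B⁻¹)ᵀ) volume volume :=
      ⟨measurable_act _, by rw [map_act hdet']; exact Measure.smul_absolutelyContinuous⟩
    rw [SchwartzMap.toLp_fourier_eq]
    have h1 := hq.ae_eq_comp (SchwartzMap.coeFn_toLp (𝓕 f) 2 (volume : Measure Plane))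
    filter_upwards [h1] with ξ hξ
    simp only [Function.comp_apply] at hξ
    rw [hξ, SchwartzMap.fourier_coe, SchwartzMap.fourier_coe, hhx]
    exact fourier_schwartz_affine hB b f ξ

/-! ### Frame coefficients on the Fourier side -/

/-- The pairs `(j, k)` of a scale and an admissible shear. -/
abbrev ScaleShear : Type := Σ j : ℕ, {k : ℤ // k ∈ shears j}

/-- The matrix `S_kᵀ A_{2^{-j}}`. -/
noncomputable def freqMat (q : ScaleShear) : Matrix (Fin 2) (Fin 2) ℝ :=
  (shearMat (q.2.1 : ℝ))ᵀ * scaleMat ((2 : ℝ) ^ q.1)⁻¹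

theorem Phi_eq_tsum (g : Plane → ℂ) (ξ ω : Plane) :
    Phi g ξ ω = ∑' q : ScaleShear, ‖g (act (freqMat q) ξ)‖ₑ * ‖g (act (freqMat q) ξ + ω)‖ₑ := by
  rw [ENNReal.tsum_sigma', Phi]
  refine tsum_congr fun j => ?_
  rw [tsum_fintype]
  exact (Finset.sum_coe_sort (shears j) fun k : ℤ =>
    ‖g (act ((shearMat (k : ℝ))ᵀ * scaleMat ((2 : ℝ) ^ j)⁻¹) ξ)‖ₑ *
      ‖g (act ((shearMat (k : ℝ))ᵀ * scaleMat ((2 : ℝ) ^ j)⁻¹) ξ + ω)‖ₑ).symm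

theorem det_freqMat (q : ScaleShear) :
    (freqMat q).det = ((2 : ℝ) ^ q.1)⁻¹ * √((2 : ℝ) ^ q.1)⁻¹ := by
  simp [freqMat, shearMat, scaleMat, Matrix.det_fin_two]

theorem det_freqMat_pos (q : ScaleShear) : 0 < (freqMat q).det := by
  rw [det_freqMat]; positivity

theorem det_timeMat (j : ℕ) (k : ℤ) :
    (shearMat (-(k : ℝ)) * scaleMat ((2 : ℝ) ^ j)).det = (2 : ℝ) ^ j * √((2 : ℝ) ^ j) := by
  simp [shearMat, scaleMat, Matrix.det_fin_two]

/-- A substitution by B in space acts by the inverse transpose of B in frequency, which is how the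
matrices in Φ arise. -/
theorem timeMat_inv_transpose (q : ScaleShear) :
    ((shearMat (-(q.2.1 : ℝ)) * scaleMat ((2 : ℝ) ^ q.1))⁻¹)ᵀ = freqMat q := by
  have h : (shearMat (-(q.2.1 : ℝ)) * scaleMat ((2 : ℝ) ^ q.1)) * (freqMat q)ᵀ = 1 := by
    have h1 : √((2 : ℝ) ^ q.1) * (√((2 : ℝ) ^ q.1))⁻¹ = 1 :=
      mul_inv_cancel₀ (Real.sqrt_pos.2 (by positivity)).ne'
    ext i l
    fin_cases i <;> fin_cases l <;>
      simp [freqMat, shearMat, scaleMat, Matrix.mul_apply, Fin.sum_univ_two, h1, mul_assoc]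
  rw [Matrix.inv_eq_right_inv h, Matrix.transpose_transpose]

theorem quasiMeasurePreserving_act {A : Matrix (Fin 2) (Fin 2) ℝ} (hA : A.det ≠ 0) :
    Measure.QuasiMeasurePreserving (act A) (volume : Measure Plane) volume :=
  ⟨measurable_act _, by rw [map_act hA]; exact Measure.smul_absolutelyContinuous⟩

/-- The dilation factor is L²-normalized: its square is the determinant of the matrix acting in
space. -/
theorem two_rpow_sq (j : ℕ) :
    ((2 : ℝ) ^ (3 * (j : ℝ) / 4)) ^ 2 = (2 : ℝ) ^ j * √((2 : ℝ) ^ j) := by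
  rw [Real.sqrt_eq_rpow, ← Real.rpow_natCast, ← Real.rpow_natCast, ← Real.rpow_mul (by norm_num),
    ← Real.rpow_mul (by norm_num), ← Real.rpow_add (by norm_num)]
  congr 1
  push_cast; ring

theorem conj_fourierChar (x : ℝ) :
    conj ((Real.fourierChar (-x) : Circle) : ℂ) = Complex.exp (2 * Real.pi * Complex.I * x) := by
  rw [← Circle.coe_inv_eq_conj, AddChar.map_neg_eq_inv, inv_inv, Real.fourierChar_apply]
  congr 1
  push_cast; ring

theorem exp_inner_latticePt (c₁ c₂ : ℝ) (C : Matrix (Fin 2) (Fin 2) ℝ) (m : Fin 2 → ℤ) (ξ : Plane) :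
    Complex.exp (2 * Real.pi * Complex.I *
      (inner ℝ (act (sampMat c₁ c₂) (latticePt m)) (act C ξ) : ℝ)) =
      expo m (act (sampMat c₁ c₂ * C) ξ) := by
  rw [expo]
  congr 3
  simp only [act_mul, PiLp.inner_apply, Fin.sum_univ_two, act_apply, sampMat, latticePt,
    RCLike.inner_apply, conj_trivial]
  simp
  ring

theorem system_eq_smul (c₁ c₂ : ℝ) (ψ : L2) (q : ScaleShear) (m : Fin 2 → ℤ)
    (hB : (shearMat (-(q.2.1 : ℝ)) * scaleMat ((2 : ℝ) ^ q.1)).det ≠ 0) :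
    system c₁ c₂ ψ (q, m) = (((2 : ℝ) ^ (3 * (q.1 : ℝ) / 4) : ℝ) : ℂ) •
      ((memLp_comp_affine (Lp.memLp ψ) hB (act (sampMat c₁ c₂) (latticePt m))).toLp : L2) := by
  refine Lp.ext ((MemLp.coeFn_toLp _).trans ?_)
  refine Filter.EventuallyEq.trans ?_ (Lp.coeFn_smul _ _).symm
  filter_upwards [MemLp.coeFn_toLp (memLp_comp_affine (Lp.memLp ψ) hB
    (act (sampMat c₁ c₂) (latticePt m)))] with x hx
  rw [Pi.smul_apply, hx]
  rfl

/-- By Plancherel the translation by M_c m becomes an exponential, so for fixed scale and shear the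
coefficients are Fourier integrals of one function. -/
theorem inner_system {c₁ c₂ : ℝ} {ψ : L2} {g : Plane → ℂ} (hψ : (𝓕 ψ : L2) =ᵐ[volume] g)
    (q : ScaleShear) (m : Fin 2 → ℤ) (f : L2) :
    inner ℂ (system c₁ c₂ ψ (q, m)) f =
      (((2 : ℝ) ^ (3 * (q.1 : ℝ) / 4) * (freqMat q).det : ℝ) : ℂ) *
      ∫ ξ, conj (g (act (freqMat q) ξ)) * (𝓕 f : L2) ξ *
        expo m (act (sampMat c₁ c₂ * freqMat q) ξ) := by
  have hB : (shearMat (-(q.2.1 : ℝ)) * scaleMat ((2 : ℝ) ^ q.1)).det ≠ 0 := by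
    rw [det_timeMat]; positivity
  have hBdet : |(shearMat (-(q.2.1 : ℝ)) * scaleMat ((2 : ℝ) ^ q.1)).det⁻¹| = (freqMat q).det := by
    rw [det_timeMat, det_freqMat, abs_of_pos (by positivity), mul_inv, Real.sqrt_inv]
  have h1 := fourier_affine hB (act (sampMat c₁ c₂) (latticePt m)) ψ
  rw [timeMat_inv_transpose, hBdet] at h1
  have h2 := (quasiMeasurePreserving_act (det_freqMat_pos q).ne').ae_eq_comp hψ
  rw [system_eq_smul c₁ c₂ ψ q m hB, inner_smul_left, Complex.conj_ofReal, Complex.ofReal_mul,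
    mul_assoc, ← integral_const_mul]
  congr 1
  rw [← Lp.inner_fourier_eq, L2.inner_def]
  refine integral_congr_ae ?_
  filter_upwards [h1, h2] with ξ h1 h2
  simp only [Function.comp_apply] at h2
  rw [RCLike.inner_apply, h1, h2, map_mul, map_mul, Complex.conj_ofReal, conj_fourierChar,
    exp_inner_latticePt]
  ring

/-- The squared prefactor collapses to det of `freqMat q`; times |det M_c| this is exactly the
weight in `lattice_fourier_comparison`. -/
theorem enorm_inner_system_sq {c₁ c₂ : ℝ} {ψ : L2} {g : Plane → ℂ}
    (hψ : (𝓕 ψ : L2) =ᵐ[volume] g) (q : ScaleShear) (m : Fin 2 → ℤ) (f : L2) :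
    ENNReal.ofReal |(sampMat c₁ c₂).det| * ‖inner ℂ (system c₁ c₂ ψ (q, m)) f‖ₑ ^ 2 =
      ENNReal.ofReal |(sampMat c₁ c₂ * freqMat q).det| *
      ‖∫ ξ, conj (g (act (freqMat q) ξ)) * (𝓕 f : L2) ξ *
        expo m (act (sampMat c₁ c₂ * freqMat q) ξ)‖ₑ ^ 2 := by
  have hd := det_freqMat_pos q
  have h1 : ((2 : ℝ) ^ (3 * (q.1 : ℝ) / 4) * (freqMat q).det) ^ 2 = (freqMat q).det := by
    rw [mul_pow, two_rpow_sq, det_freqMat, Real.sqrt_inv]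
    have h2 : 0 < √((2 : ℝ) ^ q.1) := Real.sqrt_pos.2 (by positivity)
    field_simp
  rw [inner_system hψ, enorm_mul, mul_pow, ← mul_assoc]
  congr 1
  rw [← ofReal_norm, Complex.norm_real, ← ENNReal.ofReal_pow (norm_nonneg _), Real.norm_eq_abs,
    sq_abs, h1, Matrix.det_mul, abs_mul, abs_of_pos hd, ENNReal.ofReal_mul (abs_nonneg _)]

/-! ### Cauchy–Schwarz estimates -/

theorem lintegral_mul_le_sqrt {α : Type*} [MeasurableSpace α] {μ : Measure α} {f g : α → ℝ≥0∞}
    (hf : AEMeasurable f μ) (hg : AEMeasurable g μ) :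
    ∫⁻ a, f a * g a ∂μ ≤ (∫⁻ a, f a ^ 2 ∂μ) ^ (1 / 2 : ℝ) * (∫⁻ a, g a ^ 2 ∂μ) ^ (1 / 2 : ℝ) := by
  simpa using ENNReal.lintegral_mul_le_Lp_mul_Lq μ Real.HolderConjugate.two_two hf hg

theorem tsum_mul_le_sqrt {ι : Type*} (f g : ι → ℝ≥0∞) :
    ∑' a, f a * g a ≤ (∑' a, f a ^ 2) ^ (1 / 2 : ℝ) * (∑' a, g a ^ 2) ^ (1 / 2 : ℝ) := by
  let _ : MeasurableSpace ι := ⊤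
  have h := lintegral_mul_le_sqrt (μ := Measure.count) (f := f) (g := g)
    (measurable_from_top.aemeasurable) (measurable_from_top.aemeasurable)
  simpa only [lintegral_count] using h

theorem sqrt_sq_eq (a : ℝ≥0∞) : (a ^ (1 / 2 : ℝ)) ^ 2 = a := by
  rw [← ENNReal.rpow_natCast, ← ENNReal.rpow_mul]
  norm_num

/-- The cross terms at the frequency offset `ω`, summed over all scales and shears. -/
theorem tsum_cross_le {g F : Plane → ℂ} (hg : Measurable g) (hF : Measurable F) (ω : Plane) :
    ∑' q : ScaleShear, ∫⁻ ξ, ‖conj (g (act (freqMat q) ξ)) * F ξ‖ₑ *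
      ‖conj (g (act (freqMat q) (ξ + act (freqMat q)⁻¹ ω))) * F (ξ + act (freqMat q)⁻¹ ω)‖ₑ ≤
    (∫⁻ ξ, ‖F ξ‖ₑ ^ 2 * Phi g ξ ω) ^ (1 / 2 : ℝ) *
      (∫⁻ ξ, ‖F ξ‖ₑ ^ 2 * Phi g ξ (-ω)) ^ (1 / 2 : ℝ) := by
  have hgm : ∀ (q : ScaleShear) (ω : Plane),
      Measurable fun ξ => ‖g (act (freqMat q) ξ)‖ₑ * ‖g (act (freqMat q) ξ + ω)‖ₑ :=
    fun q ω => (hg.comp (measurable_act _)).enorm.mul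
      (hg.comp ((measurable_act _).add_const _)).enorm
  have hFm : Measurable fun ξ => ‖F ξ‖ₑ := hF.enorm
  have htot : ∀ ω : Plane, ∑' q : ScaleShear, ∫⁻ ξ, ‖F ξ‖ₑ ^ 2 *
      (‖g (act (freqMat q) ξ)‖ₑ * ‖g (act (freqMat q) ξ + ω)‖ₑ) =
      ∫⁻ ξ, ‖F ξ‖ₑ ^ 2 * Phi g ξ ω := by
    intro ω
    have hm : ∀ q : ScaleShear, Measurable fun ξ => ‖F ξ‖ₑ ^ 2 *
        (‖g (act (freqMat q) ξ)‖ₑ * ‖g (act (freqMat q) ξ + ω)‖ₑ) :=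
      fun q => (hFm.pow_const 2).mul (hgm q ω)
    rw [← lintegral_tsum fun q => (hm q).aemeasurable]
    refine lintegral_congr fun ξ => ?_
    rw [ENNReal.tsum_mul_left, Phi_eq_tsum]
  have hterm : ∀ q : ScaleShear, ∫⁻ ξ, ‖conj (g (act (freqMat q) ξ)) * F ξ‖ₑ *
      ‖conj (g (act (freqMat q) (ξ + act (freqMat q)⁻¹ ω))) * F (ξ + act (freqMat q)⁻¹ ω)‖ₑ ≤
      (∫⁻ ξ, ‖F ξ‖ₑ ^ 2 * (‖g (act (freqMat q) ξ)‖ₑ * ‖g (act (freqMat q) ξ + ω)‖ₑ))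
        ^ (1 / 2 : ℝ) *
      (∫⁻ ξ, ‖F ξ‖ₑ ^ 2 * (‖g (act (freqMat q) ξ)‖ₑ * ‖g (act (freqMat q) ξ + -ω)‖ₑ))
        ^ (1 / 2 : ℝ) := by
    intro q
    set σ := act (freqMat q)⁻¹ ω with hσ
    have hact : ∀ ξ : Plane, act (freqMat q) (ξ + σ) = act (freqMat q) ξ + ω := by
      intro ξ
      rw [act, map_add]
      congr 1
      exact act_nonsing_inv (det_freqMat_pos q).ne' ω
    -- Cauchy–Schwarz is applied with one √w beside F(ξ) and the other beside F(ξ+σ). Translating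
    -- the second integral by σ turns the offset ω into -ω, whence the product Γ(ω)Γ(-ω) in R(c).
    set w : Plane → ℝ≥0∞ := fun ξ => ‖g (act (freqMat q) ξ)‖ₑ * ‖g (act (freqMat q) ξ + ω)‖ₑ
      with hw
    have hwm : Measurable fun ξ => w ξ ^ (1 / 2 : ℝ) := (hgm q ω).pow_const _
    have h1 : ∀ ξ : Plane, ‖conj (g (act (freqMat q) ξ)) * F ξ‖ₑ *
        ‖conj (g (act (freqMat q) (ξ + σ))) * F (ξ + σ)‖ₑ =
        (‖F ξ‖ₑ * w ξ ^ (1 / 2 : ℝ)) * (‖F (ξ + σ)‖ₑ * w ξ ^ (1 / 2 : ℝ)) := by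
      intro ξ
      rw [enorm_mul, enorm_mul, RCLike.enorm_conj, RCLike.enorm_conj, hact,
        mul_mul_mul_comm (‖F ξ‖ₑ), ← sq, sqrt_sq_eq, hw]
      ring
    have h2 : ∫⁻ ξ, (‖F (ξ + σ)‖ₑ * w ξ ^ (1 / 2 : ℝ)) ^ 2 =
        ∫⁻ ξ, ‖F ξ‖ₑ ^ 2 * (‖g (act (freqMat q) ξ)‖ₑ * ‖g (act (freqMat q) ξ + -ω)‖ₑ) := by
      rw [← lintegral_add_right_eq_self (fun ξ => ‖F ξ‖ₑ ^ 2 *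
        (‖g (act (freqMat q) ξ)‖ₑ * ‖g (act (freqMat q) ξ + -ω)‖ₑ)) σ]
      refine lintegral_congr fun ξ => ?_
      rw [mul_pow, sqrt_sq_eq, hact, hw, add_neg_cancel_right, mul_comm (‖g _‖ₑ)]
    calc _ = ∫⁻ ξ, (‖F ξ‖ₑ * w ξ ^ (1 / 2 : ℝ)) * (‖F (ξ + σ)‖ₑ * w ξ ^ (1 / 2 : ℝ)) :=
          lintegral_congr h1
      _ ≤ _ := lintegral_mul_le_sqrt (hFm.mul hwm).aemeasurable
          ((hFm.comp (measurable_id.add_const _)).mul hwm).aemeasurable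
      _ = _ := by rw [h2]; simp only [mul_pow, sqrt_sq_eq, hw]
  calc _ ≤ _ := ENNReal.tsum_le_tsum hterm
    _ ≤ _ := tsum_mul_le_sqrt _ _
    _ = _ := by simp only [sqrt_sq_eq, htot]

/-! ### The frame inequalities -/

theorem lintegral_enorm_sq_fourier (f : L2) :
    ∫⁻ ξ, ‖(𝓕 f : L2) ξ‖ₑ ^ 2 = ENNReal.ofReal (‖f‖ ^ 2) := by
  rw [← Lp.norm_fourier_eq f, ENNReal.ofReal_pow (norm_nonneg _), ofReal_norm, Lp.enorm_def,
    eLpNorm_eq_lintegral_rpow_enorm_toReal (by norm_num) (by norm_num)]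
  simp only [ENNReal.toReal_ofNat, ENNReal.rpow_ofNat]
  exact (sqrt_sq_eq _).symm

theorem lintegral_mul_Phi_le {f : L2} (hf : f ∈ coneL2) (g : Plane → ℂ) (ω : Plane) :
    ∫⁻ ξ, ‖(𝓕 f : L2) ξ‖ₑ ^ 2 * Phi g ξ ω ≤ ENNReal.ofReal (‖f‖ ^ 2) * Gam g ω := by
  have h1 : ∀ᵐ ξ ∂volume, ξ ∈ cone → Phi g ξ ω ≤ Gam g ω :=
    (ae_restrict_iff' measurableSet_cone).1 (ENNReal.ae_le_essSup _)
  have hm : Measurable fun ξ => ‖(𝓕 f : L2) ξ‖ₑ ^ 2 :=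
    (Lp.stronglyMeasurable _).measurable.enorm.pow_const 2
  rw [← lintegral_enorm_sq_fourier, ← lintegral_mul_const _ hm]
  refine lintegral_mono_ae ?_
  filter_upwards [h1, hf] with ξ h1 h2
  by_cases hξ : ξ ∈ cone
  · gcongr
    exact h1 hξ
  · simp [h2 hξ]

theorem Linf_mul_le_lintegral {f : L2} (hf : f ∈ coneL2) (g : Plane → ℂ) :
    ENNReal.ofReal (‖f‖ ^ 2) * Linf g ≤ ∫⁻ ξ, ‖(𝓕 f : L2) ξ‖ₑ ^ 2 * Phi g ξ 0 := by
  have h1 : ∀ᵐ ξ ∂volume, ξ ∈ cone → Linf g ≤ Phi g ξ 0 :=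
    (ae_restrict_iff' measurableSet_cone).1 (ae_essInf_le)
  have hm : Measurable fun ξ => ‖(𝓕 f : L2) ξ‖ₑ ^ 2 :=
    (Lp.stronglyMeasurable _).measurable.enorm.pow_const 2
  rw [← lintegral_enorm_sq_fourier, ← lintegral_mul_const _ hm]
  refine lintegral_mono_ae ?_
  filter_upwards [h1, hf] with ξ h1 h2
  by_cases hξ : ξ ∈ cone
  · gcongr
    exact h1 hξ
  · simp [h2 hξ]

theorem det_sampMat (c₁ c₂ : ℝ) : (sampMat c₁ c₂).det = c₁ * c₂ := by
  simp [sampMat, Matrix.det_fin_two]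

/-- The two inequalities between the frame sum and `∫ |f̂|² Φ(·, 0)`, with error `R(c) ‖f‖²`. -/
theorem frame_sum_comparison {c₁ c₂ : ℝ} (h₁ : 0 < c₁) (h₂ : 0 < c₂) {ψ : L2} {g : Plane → ℂ}
    (hψ : (𝓕 ψ : L2) =ᵐ[volume] g) (hg : Measurable g) (hgL : Lsup g < ⊤) (hR : R g c₁ c₂ < ⊤)
    {f : L2} (hf : f ∈ coneL2) :
    ENNReal.ofReal |(sampMat c₁ c₂).det| * (∑' i, ‖inner ℂ (system c₁ c₂ ψ i) f‖ₑ ^ 2) ≤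
      (Lsup g + R g c₁ c₂) * ENNReal.ofReal (‖f‖ ^ 2) ∧
    Linf g * ENNReal.ofReal (‖f‖ ^ 2) ≤
      ENNReal.ofReal |(sampMat c₁ c₂).det| * (∑' i, ‖inner ℂ (system c₁ c₂ ψ i) f‖ₑ ^ 2) +
      R g c₁ c₂ * ENNReal.ofReal (‖f‖ ^ 2) := by
  set N := ENNReal.ofReal (‖f‖ ^ 2) with hN
  set F : Plane → ℂ := ⇑(𝓕 f : L2) with hF
  have hFm : Measurable F := (Lp.stronglyMeasurable _).measurable
  set M := sampMat c₁ c₂ with hM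
  have hMdet : M.det ≠ 0 := by rw [hM, det_sampMat]; positivity
  set u : ScaleShear → Plane → ℂ := fun q ξ => conj (g (act (freqMat q) ξ)) * F ξ with hu
  have hum : ∀ q, Measurable (u q) := fun q =>
    (Complex.continuous_conj.measurable.comp (hg.comp (measurable_act _))).mul hFm
  set off : ScaleShear → Plane → ℝ≥0∞ := fun q ξ => ∑' l : {l : Fin 2 → ℤ // l ≠ 0},
    ‖u q ξ‖ₑ * ‖u q (ξ + act (M * freqMat q)⁻¹ (latticePt l))‖ₑ with hoff
  have hcross : ∀ (q : ScaleShear) (l : Fin 2 → ℤ), Measurable fun ξ =>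
      ‖u q ξ‖ₑ * ‖u q (ξ + act (M * freqMat q)⁻¹ (latticePt l))‖ₑ := fun q l =>
    (hum q).enorm.mul ((hum q).comp (measurable_id.add_const _)).enorm
  have hoffm : ∀ q, Measurable (off q) := fun q => Measurable.tsum fun l => hcross q l
  have hdiag : ∑' q, ∫⁻ ξ, ‖u q ξ‖ₑ ^ 2 = ∫⁻ ξ, ‖F ξ‖ₑ ^ 2 * Phi g ξ 0 := by
    rw [← lintegral_tsum fun q => ((hum q).enorm.pow_const 2).aemeasurable]
    refine lintegral_congr fun ξ => ?_
    rw [Phi_eq_tsum, ← ENNReal.tsum_mul_left]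
    refine tsum_congr fun q => ?_
    rw [hu, add_zero, enorm_mul, RCLike.enorm_conj, mul_pow, sq (‖g _‖ₑ), mul_comm]
  have hofftot : ∑' q, ∫⁻ ξ, off q ξ ≤ R g c₁ c₂ * N := by
    have h1 : ∀ q, ∫⁻ ξ, off q ξ = ∑' l : {l : Fin 2 → ℤ // l ≠ 0}, ∫⁻ ξ,
        ‖u q ξ‖ₑ * ‖u q (ξ + act (M * freqMat q)⁻¹ (latticePt l))‖ₑ := fun q =>
      lintegral_tsum fun l => (hcross q l).aemeasurable
    simp only [h1]
    rw [ENNReal.tsum_comm, R, ← ENNReal.tsum_mul_right]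
    refine ENNReal.tsum_le_tsum fun l => ?_
    -- After applying `freqMat q`, the lattice shift is this same ω for every scale and shear, so
    -- the cross terms can be summed over q first.
    set ω := act M⁻¹ (latticePt l) with hω
    have h2 : ∀ q : ScaleShear, act (M * freqMat q)⁻¹ (latticePt l) = act (freqMat q)⁻¹ ω := by
      intro q
      rw [Matrix.mul_inv_rev, act_mul]
    simp only [h2]
    refine (tsum_cross_le hg hFm ω).trans ?_
    calc _ ≤ (N * Gam g ω) ^ (1 / 2 : ℝ) * (N * Gam g (-ω)) ^ (1 / 2 : ℝ) := by
          gcongr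
          · exact lintegral_mul_Phi_le hf g ω
          · exact lintegral_mul_Phi_le hf g (-ω)
      _ = (Gam g ω * Gam g (-ω)) ^ (1 / 2 : ℝ) * N := by
          rw [← ENNReal.mul_rpow_of_nonneg _ _ (by norm_num), mul_mul_mul_comm,
            ENNReal.mul_rpow_of_nonneg _ _ (by norm_num), ← sq, ← ENNReal.rpow_natCast N 2,
            ← ENNReal.rpow_mul]
          norm_num
          rw [mul_comm]
  have hNt : N ≠ ⊤ := ENNReal.ofReal_ne_top
  have hup : ∫⁻ ξ, ‖F ξ‖ₑ ^ 2 * Phi g ξ 0 ≤ Lsup g * N := by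
    rw [mul_comm]
    exact lintegral_mul_Phi_le hf g 0
  -- This puts each periodization in L² of the torus; each single q is dominated by the finite
  -- total.
  have hfin : ∀ q, ∫⁻ ξ, ‖u q ξ‖ₑ ^ 2 + off q ξ ≠ ⊤ := by
    intro q
    rw [lintegral_add_left ((hum q).enorm.pow_const 2)]
    refine ENNReal.add_ne_top.2 ⟨?_, ?_⟩
    · exact ne_top_of_le_ne_top (ENNReal.mul_ne_top hgL.ne hNt)
        ((ENNReal.le_tsum q).trans (hdiag.le.trans hup))
    · exact ne_top_of_le_ne_top (ENNReal.mul_ne_top hR.ne hNt)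
        ((ENNReal.le_tsum (f := fun q => ∫⁻ ξ, off q ξ) q).trans hofftot)
  have hgmem : MemLp g 2 volume := (Lp.memLp (𝓕 ψ : L2)).ae_eq hψ
  have hint : ∀ q, Integrable (u q) := by
    intro q
    have h1 : MemLp (fun ξ => conj (g (act (freqMat q) ξ))) 2 volume := by
      have h2 : MemLp (fun ξ => g (act (freqMat q) ξ)) 2 volume := by
        simpa using memLp_comp_affine hgmem (det_freqMat_pos q).ne' 0
      exact h2.star
    exact h1.integrable_mul (Lp.memLp (𝓕 f : L2))
  have hsum : ENNReal.ofReal |M.det| * (∑' i, ‖inner ℂ (system c₁ c₂ ψ i) f‖ₑ ^ 2) =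
      ∑' q : ScaleShear, ENNReal.ofReal |(M * freqMat q).det| *
        ∑' m : Fin 2 → ℤ, ‖∫ ξ, u q ξ * expo m (act (M * freqMat q) ξ)‖ₑ ^ 2 := by
    rw [ENNReal.tsum_prod', ← ENNReal.tsum_mul_left]
    refine tsum_congr fun q => ?_
    rw [← ENNReal.tsum_mul_left, ← ENNReal.tsum_mul_left]
    exact tsum_congr fun m => enorm_inner_system_sq hψ q m f
  have hcmp := fun q : ScaleShear => lattice_fourier_comparison (D := M * freqMat q)
    (by rw [Matrix.det_mul]; exact mul_ne_zero hMdet (det_freqMat_pos q).ne')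
    (hum q) (hint q) (hfin q)
  rw [hsum]
  constructor
  · calc _ ≤ ∑' q, ∫⁻ ξ, ‖u q ξ‖ₑ ^ 2 + off q ξ := ENNReal.tsum_le_tsum fun q => (hcmp q).1
      _ = (∑' q, ∫⁻ ξ, ‖u q ξ‖ₑ ^ 2) + ∑' q, ∫⁻ ξ, off q ξ := by
          rw [← ENNReal.tsum_add]
          exact tsum_congr fun q => lintegral_add_left ((hum q).enorm.pow_const 2) _
      _ ≤ _ := by
          rw [add_mul]
          exact add_le_add (hdiag.le.trans hup) hofftot
  · calc Linf g * N ≤ ∑' q, ∫⁻ ξ, ‖u q ξ‖ₑ ^ 2 := by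
          rw [hdiag, mul_comm]
          exact Linf_mul_le_lintegral hf g
      _ ≤ _ := ENNReal.tsum_le_tsum fun q => (hcmp q).2
      _ ≤ _ := by
          rw [ENNReal.tsum_add]
          gcongr

/-! ### Optimal frame bounds -/

section FrameBounds

variable {H : Type*} [NormedAddCommGroup H] [InnerProductSpace ℂ H] {ι : Type*}
  {V : Submodule ℂ H} {e : ι → H}

/-- For each f the inequality is a closed condition on the constant, so supremum and infimum are
attained. A nonzero f₀ is needed to compare lower bounds with upper ones; on V = 0 all positive
constants are both. -/
theorem exists_areFrameBounds {f₀ : H} (hf₀ : f₀ ∈ V) (hf₀' : f₀ ≠ 0) (h : IsFrameFor V e) :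
    ∃ A B : ℝ, AreFrameBounds V e A B ∧ A ≤ B := by
  obtain ⟨⟨a₀, ha₀⟩, b₀, hb₀⟩ := h
  have hcmp : ∀ {a b : ℝ}, IsLowerFrameBound V e a → IsUpperFrameBound V e b → a ≤ b := by
    intro a b ha hb
    have h1 := (ha.2 f₀ hf₀).trans (hb.2 f₀ hf₀)
    have h2 : 0 < ‖f₀‖ ^ 2 := by positivity
    rw [ENNReal.ofReal_le_ofReal_iff (mul_nonneg hb.1.le h2.le)] at h1
    exact le_of_mul_le_mul_right h1 h2
  have hfin : ∀ f ∈ V, ∑' i, ‖inner ℂ (e i) f‖ₑ ^ 2 ≠ ⊤ := fun f hf =>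
    ne_top_of_le_ne_top ENNReal.ofReal_ne_top (hb₀.2 f hf)
  have hbdd : BddAbove {a | IsLowerFrameBound V e a} := ⟨b₀, fun a ha => hcmp ha hb₀⟩
  have hbdd' : BddBelow {b | IsUpperFrameBound V e b} := ⟨a₀, fun b hb => hcmp ha₀ hb⟩
  have hA : IsLowerFrameBound V e (sSup {a | IsLowerFrameBound V e a}) := by
    refine ⟨ha₀.1.trans_le (le_csSup hbdd ha₀), fun f hf => ?_⟩
    rcases eq_or_ne f 0 with rfl | hf0
    · simp
    have h2 : 0 < ‖f‖ ^ 2 := by positivity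
    rw [ENNReal.ofReal_le_iff_le_toReal (hfin f hf), ← le_div_iff₀ h2]
    refine csSup_le ⟨a₀, ha₀⟩ fun a ha => ?_
    rw [le_div_iff₀ h2, ← ENNReal.ofReal_le_iff_le_toReal (hfin f hf)]
    exact ha.2 f hf
  have hB : IsUpperFrameBound V e (sInf {b | IsUpperFrameBound V e b}) := by
    refine ⟨ha₀.1.trans_le (le_csInf ⟨b₀, hb₀⟩ fun b hb => hcmp ha₀ hb), fun f hf => ?_⟩
    rcases eq_or_ne f 0 with rfl | hf0
    · simp
    have h2 : 0 < ‖f‖ ^ 2 := by positivity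
    rw [ENNReal.le_ofReal_iff_toReal_le (hfin f hf), ← div_le_iff₀ h2]
    · refine le_csInf ⟨b₀, hb₀⟩ fun b hb => ?_
      rw [div_le_iff₀ h2, ← ENNReal.le_ofReal_iff_toReal_le (hfin f hf)
        (mul_nonneg hb.1.le h2.le)]
      exact hb.2 f hf
    · exact mul_nonneg (Real.sInf_nonneg fun b hb => hb.1.le) h2.le
  exact ⟨_, _, ⟨⟨hA, fun a ha => le_csSup hbdd ha⟩, ⟨hB, fun b hb => csInf_le hbdd' hb⟩⟩,
    hcmp hA hB⟩

theorem isLowerFrameBound_of_le {δ lo : ℝ} (hδ : 0 < δ) {r : ℝ≥0∞}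
    (hr : r < ENNReal.ofReal lo)
    (h : ∀ f ∈ V, ENNReal.ofReal lo * ENNReal.ofReal (‖f‖ ^ 2) ≤
      ENNReal.ofReal δ * (∑' i, ‖inner ℂ (e i) f‖ₑ ^ 2) + r * ENNReal.ofReal (‖f‖ ^ 2)) :
    IsLowerFrameBound V e (1 / δ * (lo - r.toReal)) := by
  have hrt : r ≠ ⊤ := hr.ne_top
  have hlo : r.toReal < lo := by
    rwa [← ENNReal.lt_ofReal_iff_toReal_lt hrt]
  have hr0 : 0 ≤ r.toReal := ENNReal.toReal_nonneg
  refine ⟨by have : 0 < lo - r.toReal := by linarith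
             positivity, fun f hf => ?_⟩
  rcases eq_or_ne (∑' i, ‖inner ℂ (e i) f‖ₑ ^ 2) ⊤ with hS | hS
  · rw [hS]; exact le_top
  have h1 := h f hf
  rw [← ENNReal.ofReal_toReal hS, ← ENNReal.ofReal_toReal hrt,
    ← ENNReal.ofReal_mul (by linarith), ← ENNReal.ofReal_mul hδ.le, ← ENNReal.ofReal_mul hr0,
    ← ENNReal.ofReal_add (by positivity) (by positivity),
    ENNReal.ofReal_le_ofReal_iff (by positivity)] at h1
  rw [ENNReal.ofReal_le_iff_le_toReal hS, mul_assoc, one_div, inv_mul_le_iff₀ hδ]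
  linarith

theorem isUpperFrameBound_of_le {δ hi : ℝ} (hδ : 0 < δ) (hhi : 0 < hi) {r : ℝ≥0∞} (hrt : r ≠ ⊤)
    (h : ∀ f ∈ V, ENNReal.ofReal δ * (∑' i, ‖inner ℂ (e i) f‖ₑ ^ 2) ≤
      (ENNReal.ofReal hi + r) * ENNReal.ofReal (‖f‖ ^ 2)) :
    IsUpperFrameBound V e (1 / δ * (hi + r.toReal)) := by
  have hr0 : 0 ≤ r.toReal := ENNReal.toReal_nonneg
  refine ⟨by positivity, fun f hf => ?_⟩
  have h1 := h f hf
  have hδ' : ENNReal.ofReal δ ≠ 0 := by simpa using hδ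
  rw [← ENNReal.mul_le_mul_iff_right hδ' ENNReal.ofReal_ne_top, ← ENNReal.ofReal_mul hδ.le]
  refine h1.trans (le_of_eq ?_)
  nth_rewrite 1 [← ENNReal.ofReal_toReal hrt]
  rw [← ENNReal.ofReal_add hhi.le hr0, ← ENNReal.ofReal_mul (by positivity)]
  congr 1
  field_simp

end FrameBounds

/-- Shows that the cone has positive measure and that its L² space is nontrivial. -/
theorem ball_subset_cone : Metric.ball (WithLp.toLp 2 ![3, 0] : Plane) 1 ⊆ cone := by
  intro ξ hξ
  rw [Metric.mem_ball, EuclideanSpace.dist_eq, Fin.sum_univ_two, Real.sqrt_lt' one_pos] at hξ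
  simp only [Real.dist_eq, sq_abs] at hξ
  simp at hξ
  have h0 : 2 ≤ ξ 0 := by nlinarith [sq_nonneg (ξ 0 - 3), sq_nonneg (ξ 1)]
  have h1 : |ξ 1| ≤ 1 := abs_le_one_iff_mul_self_le_one.2 (by nlinarith [sq_nonneg (ξ 0 - 3)])
  refine Or.inl ⟨by linarith, ?_⟩
  rw [abs_div, abs_of_pos (by linarith : 0 < ξ 0), div_le_one (by linarith)]
  linarith

/-- Positive measure of the cone is essential: for the zero measure the essential infimum is ⊤ and
the essential supremum 0. -/
theorem Linf_le_Lsup (g : Plane → ℂ) : Linf g ≤ Lsup g := by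
  have hpos : 0 < volume cone :=
    (Metric.measure_ball_pos volume _ one_pos).trans_le (measure_mono ball_subset_cone)
  have : (ae (volume.restrict cone)).NeBot := by
    rw [ae_neBot]
    intro h
    rw [Measure.restrict_eq_zero] at h
    exact hpos.ne' h
  obtain ⟨ξ, h1, h2⟩ := ((ae_essInf_le (μ := volume.restrict cone) (f := fun ξ => Phi g ξ 0)).and
    (ENNReal.ae_le_essSup (μ := volume.restrict cone) (f := fun ξ => Phi g ξ 0))).exists
  exact h1.trans h2

theorem exists_ne_zero_mem_coneL2 : ∃ f ∈ coneL2, f ≠ 0 := by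
  set s := Metric.ball (WithLp.toLp 2 ![3, 0] : Plane) 1 with hs
  have hms : MeasurableSet s := measurableSet_ball
  have hpos : 0 < volume s := Metric.measure_ball_pos volume _ one_pos
  have hfin : volume s ≠ ⊤ := measure_ball_lt_top.ne
  set F : L2 := indicatorConstLp 2 hms hfin (1 : ℂ) with hF
  have hinv : (𝓕 (𝓕⁻ F : L2) : L2) = F := FourierTransform.fourier_fourierInv_eq F
  refine ⟨(𝓕⁻ F : L2), ?_, ?_⟩
  · change ∀ᵐ ξ ∂(volume : Measure Plane), ξ ∉ cone → (𝓕 (𝓕⁻ F : L2) : L2) ξ = 0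
    rw [hinv]
    filter_upwards [indicatorConstLp_coeFn_notMem (p := 2) (hs := hms) (hμs := hfin) (c := (1 : ℂ))]
      with ξ h hξ
    exact h fun hmem => hξ (ball_subset_cone hmem)
  · intro h0
    have h1 : F = 0 := by
      rw [← hinv, h0]
      exact (Lp.fourierTransformₗᵢ Plane ℂ).map_zero
    have h2 := norm_indicatorConstLp (p := 2) (hs := hms) (hμs := hfin) (c := (1 : ℂ)) (by norm_num)
      (by norm_num)
    rw [← hF, h1, norm_zero, norm_one, one_mul] at h2
    have h3 : 0 < volume.real s := ENNReal.toReal_pos hpos.ne' hfin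
    have := Real.rpow_pos_of_pos h3 (1 / (2 : ℝ≥0∞).toReal)
    linarith

/-! ### Compact support -/

/-- The exponential sums on the plane with frequencies of norm at most `r`. -/
noncomputable def expSums (r : ℝ) : Submodule ℂ (Plane → ℂ) :=
  Submodule.span ℂ {G | ∃ l : Plane, ‖l‖ ≤ r ∧
    G = fun ξ => Complex.exp (2 * Real.pi * Complex.I * (inner ℝ l ξ : ℝ))}

theorem expSums_mono {r s : ℝ} (h : r ≤ s) : expSums r ≤ expSums s :=
  Submodule.span_mono fun _ ⟨l, hl, hG⟩ => ⟨l, hl.trans h, hG⟩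

theorem one_mem_expSums {r : ℝ} (h : 0 ≤ r) : (1 : Plane → ℂ) ∈ expSums r :=
  Submodule.subset_span ⟨0, by simpa using h, by funext ξ; simp⟩

theorem mul_mem_expSums {r s : ℝ} {F G : Plane → ℂ} (hF : F ∈ expSums r) (hG : G ∈ expSums s) :
    F * G ∈ expSums (r + s) := by
  have h : expSums r * expSums s ≤ expSums (r + s) := by
    rw [expSums, expSums, Submodule.span_mul_span]
    refine Submodule.span_mono ?_
    rintro _ ⟨_, ⟨l, hl, rfl⟩, _, ⟨l', hl', rfl⟩, rfl⟩
    refine ⟨l + l', (norm_add_le _ _).trans (add_le_add hl hl'), ?_⟩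
    funext ξ
    simp only [Pi.mul_apply]
    rw [← Complex.exp_add, inner_add_left]
    congr 1
    push_cast; ring
  exact h (Submodule.mul_mem_mul hF hG)

theorem IsTrigPoly.exists_mem_expSums {m : ℝ → ℂ} (h : IsTrigPoly m) :
    ∃ N : ℝ, 0 ≤ N ∧ ∀ v : Plane, (fun ξ : Plane => m (inner ℝ v ξ)) ∈ expSums (N * ‖v‖) := by
  obtain ⟨h, hh⟩ := h
  refine ⟨∑ n ∈ h.support, |(n : ℝ)|, Finset.sum_nonneg fun _ _ => abs_nonneg _, fun v => ?_⟩
  have e : (fun ξ : Plane => m (inner ℝ v ξ)) = ∑ n ∈ h.support, h n •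
      fun ξ : Plane => Complex.exp (2 * Real.pi * Complex.I * (inner ℝ ((n : ℝ) • v) ξ : ℝ)) := by
    funext ξ
    rw [hh, Finsupp.sum, Finset.sum_apply]
    refine Finset.sum_congr rfl fun n _ => ?_
    rw [Pi.smul_apply, smul_eq_mul, real_inner_smul_left]
    congr 2
    push_cast; ring
  rw [e]
  refine Submodule.sum_mem _ fun n hn => Submodule.smul_mem _ _ (Submodule.subset_span
    ⟨(n : ℝ) • v, ?_, rfl⟩)
  rw [norm_smul, Real.norm_eq_abs]
  exact mul_le_mul_of_nonneg_right
    (Finset.single_le_sum (f := fun n : ℤ => |(n : ℝ)|) (fun _ _ => abs_nonneg _) hn)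
    (norm_nonneg _)

/-- The j-th factor has frequencies of size at most N‖v‖/2^j. Their geometric sum bounds the radius
independently of n. -/
theorem prod_mem_expSums {m : ℝ → ℂ} {N : ℝ} (hN : 0 ≤ N)
    (hm : ∀ v : Plane, (fun ξ : Plane => m (inner ℝ v ξ)) ∈ expSums (N * ‖v‖)) (v : Plane) (n : ℕ) :
    (fun ξ : Plane => ∏ j ∈ Finset.range n, m (inner ℝ v ξ / 2 ^ j)) ∈ expSums (2 * N * ‖v‖) := by
  have h : ∀ n : ℕ, (fun ξ : Plane => ∏ j ∈ Finset.range n, m (inner ℝ v ξ / 2 ^ j)) ∈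
      expSums (N * ‖v‖ * (2 - 2 / 2 ^ n)) := by
    intro n
    induction n with
    | zero =>
      simp only [Finset.range_zero, Finset.prod_empty]
      exact one_mem_expSums (by simp)
    | succ n ih =>
      have h1 := hm (((2 : ℝ) ^ n)⁻¹ • v)
      have h2 := mul_mem_expSums ih h1
      have e1 : N * ‖v‖ * (2 - 2 / 2 ^ n) + N * ‖((2 : ℝ) ^ n)⁻¹ • v‖ =
          N * ‖v‖ * (2 - 2 / 2 ^ (n + 1)) := by
        rw [norm_smul, Real.norm_of_nonneg (by positivity), pow_succ]
        field_simp
        ring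
      rw [e1] at h2
      convert h2 using 1
      funext ξ
      rw [Finset.prod_range_succ, Pi.mul_apply, real_inner_smul_left, inv_mul_eq_div]
  refine expSums_mono ?_ (h n)
  have : 0 ≤ N * ‖v‖ * (2 / 2 ^ n) := by positivity
  linarith

/-- Exponential sums with frequencies in a ball are orthogonal to the Fourier transforms of
Schwartz functions that vanish on the reflected ball. -/
theorem integral_fourier_mul_expSum {r : ℝ} {h : SchwartzMap Plane ℂ}
    (hh : ∀ x, ‖x‖ ≤ r → h x = 0) {G : Plane → ℂ} (hG : G ∈ expSums r) :
    Integrable (fun ξ => conj (𝓕 (h : Plane → ℂ) ξ) * G ξ) ∧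
      ∫ ξ, conj (𝓕 (h : Plane → ℂ) ξ) * G ξ = 0 := by
  have hi : Integrable (fun ξ => conj (𝓕 (h : Plane → ℂ) ξ)) := by
    rw [← SchwartzMap.fourier_coe]
    exact (Complex.conjCLE.toContinuousLinearMap.integrable_comp (𝓕 h).integrable)
  refine Submodule.span_induction (p := fun G _ =>
    Integrable (fun ξ => conj (𝓕 (h : Plane → ℂ) ξ) * G ξ) ∧
      ∫ ξ, conj (𝓕 (h : Plane → ℂ) ξ) * G ξ = 0) ?_ ?_ ?_ ?_ hG
  · rintro _ ⟨l, hl, rfl⟩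
    constructor
    · refine hi.mul_bdd (c := 1) ?_ (ae_of_all _ fun ξ => ?_)
      · exact (by fun_prop : Continuous fun ξ : Plane =>
          Complex.exp (2 * Real.pi * Complex.I * (inner ℝ l ξ : ℝ))).aestronglyMeasurable
      · rw [show 2 * Real.pi * Complex.I * ((inner ℝ l ξ : ℝ) : ℂ) =
          ((2 * Real.pi * inner ℝ l ξ : ℝ) : ℂ) * Complex.I by push_cast; ring]
        exact (Complex.norm_exp_ofReal_mul_I _).le
    -- By Fourier inversion, pairing with the exponential of frequency l evaluates h at -l, inside
    -- the ball where h vanishes.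
    · have h1 : 𝓕 (𝓕 (h : Plane → ℂ)) l = h (-l) := by
        have h2 := congrFun (congrArg DFunLike.coe
          (FourierTransform.fourierInv_fourier_eq (F := SchwartzMap Plane ℂ) h)) (-l)
        rw [SchwartzMap.fourierInv_coe, SchwartzMap.fourier_coe] at h2
        rw [← h2, Real.fourierInv_eq_fourier_neg, neg_neg]
      have h3 : ∫ ξ, conj (𝓕 (h : Plane → ℂ) ξ) *
          Complex.exp (2 * Real.pi * Complex.I * (inner ℝ l ξ : ℝ)) =
          conj (𝓕 (𝓕 (h : Plane → ℂ)) l) := by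
        rw [Real.fourier_eq (𝓕 (h : Plane → ℂ)), ← integral_conj]
        refine integral_congr_ae (ae_of_all _ fun ξ => ?_)
        simp only [Circle.smul_def, smul_eq_mul, map_mul, conj_fourierChar]
        rw [mul_comm, real_inner_comm]
      rw [h3, h1, hh (-l) (by simpa using hl), map_zero]
  · simp
  · rintro F G - - ⟨hF, hF'⟩ ⟨hG, hG'⟩
    simp only [Pi.add_apply, mul_add]
    exact ⟨hF.add hG, by rw [integral_add hF hG, hF', hG', add_zero]⟩
  · rintro a F - ⟨hF, hF'⟩
    simp only [Pi.smul_apply, smul_eq_mul, mul_left_comm _ a]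
    exact ⟨hF.const_mul a, by rw [integral_const_mul, hF', mul_zero]⟩

/-- A square-integrable function whose Fourier transform is a bounded pointwise limit of exponential
sums with frequencies in a fixed ball is orthogonal to the Schwartz functions that vanish there. -/
theorem inner_eq_zero_of_tendsto_expSums {ψ : L2} {g : Plane → ℂ} (hψ : (𝓕 ψ : L2) =ᵐ[volume] g)
    {r : ℝ} {G : ℕ → Plane → ℂ} (hG : ∀ n, G n ∈ expSums r) (hGb : ∀ n ξ, ‖G n ξ‖ ≤ 1)
    (hlim : ∀ ξ, Filter.Tendsto (fun n => G n ξ) Filter.atTop (nhds (g ξ)))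
    {h : SchwartzMap Plane ℂ} (hvan : ∀ x, ‖x‖ ≤ r → h x = 0) :
    inner ℂ (h.toLp 2 : L2) ψ = 0 := by
  have hzero : ∫ ξ, conj (𝓕 (h : Plane → ℂ) ξ) * g ξ = 0 := by
    have hi : Integrable (fun ξ => ‖𝓕 (h : Plane → ℂ) ξ‖) := by
      rw [← SchwartzMap.fourier_coe]
      exact (𝓕 h).integrable.norm
    have h1 := tendsto_integral_of_dominated_convergence
      (F := fun n ξ => conj (𝓕 (h : Plane → ℂ) ξ) * G n ξ)
      (f := fun ξ => conj (𝓕 (h : Plane → ℂ) ξ) * g ξ) (μ := volume)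
      (fun ξ => ‖𝓕 (h : Plane → ℂ) ξ‖)
      (fun n => (integral_fourier_mul_expSum hvan (hG n)).1.aestronglyMeasurable) hi
      (fun n => ae_of_all _ fun ξ => by
        rw [norm_mul, RCLike.norm_conj]
        exact mul_le_of_le_one_right (norm_nonneg _) (hGb n ξ))
      (ae_of_all _ fun ξ => (hlim ξ).const_mul _)
    simp only [fun n => (integral_fourier_mul_expSum hvan (hG n)).2] at h1
    exact (tendsto_nhds_unique h1 tendsto_const_nhds)
  rw [← Lp.inner_fourier_eq, SchwartzMap.toLp_fourier_eq, L2.inner_def, ← hzero]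
  refine integral_congr_ae ?_
  filter_upwards [hψ, SchwartzMap.coeFn_toLp (𝓕 h) 2 (volume : Measure Plane)] with ξ h1 h2
  rw [h1, h2, RCLike.inner_apply, SchwartzMap.fourier_coe, mul_comm]

/-- A square-integrable function whose Fourier transform is a bounded pointwise limit of exponential
sums with frequencies in a fixed ball vanishes outside that ball. -/
theorem ae_eq_zero_of_tendsto_expSums {ψ : L2} {g : Plane → ℂ} (hψ : (𝓕 ψ : L2) =ᵐ[volume] g)
    {r : ℝ} {G : ℕ → Plane → ℂ} (hG : ∀ n, G n ∈ expSums r) (hGb : ∀ n ξ, ‖G n ξ‖ ≤ 1)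
    (hlim : ∀ ξ, Filter.Tendsto (fun n => G n ξ) Filter.atTop (nhds (g ξ))) :
    ∀ᵐ x ∂(volume : Measure Plane), r < ‖x‖ → ψ x = 0 := by
  have hU : IsOpen {x : Plane | r < ‖x‖} := isOpen_lt continuous_const continuous_norm
  have hloc : LocallyIntegrable (ψ : Plane → ℂ) volume :=
    (Lp.memLp ψ).locallyIntegrable (by norm_num)
  -- It suffices to test against smooth functions compactly supported outside the ball. They are
  -- real-valued, so the conjugation in the inner product is harmless.
  refine hU.ae_eq_zero_of_integral_contDiff_smul_eq_zero (hloc.locallyIntegrableOn _) ?_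
  intro φ hφ hφc hφs
  obtain ⟨h, hhx⟩ : ∃ h : SchwartzMap Plane ℂ, ∀ x, h x = φ x := by
    have hφ' : ContDiff ℝ (⊤ : ℕ∞) fun x => ((φ x : ℝ) : ℂ) := Complex.ofRealCLM.contDiff.comp hφ
    have hφc' : HasCompactSupport fun x => ((φ x : ℝ) : ℂ) :=
      hφc.comp_left (g := fun t : ℝ => (t : ℂ)) (by simp)
    exact ⟨hφc'.toSchwartzMap hφ', fun x => rfl⟩
  have hvan : ∀ x, ‖x‖ ≤ r → h x = 0 := by
    intro x hx
    rw [hhx]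
    have : x ∉ tsupport φ := fun hmem => absurd (hφs hmem) (by simpa using hx)
    rw [image_eq_zero_of_notMem_tsupport this, Complex.ofReal_zero]
  rw [← inner_eq_zero_of_tendsto_expSums hψ hG hGb hlim hvan, L2.inner_def]
  refine integral_congr_ae ?_
  filter_upwards [SchwartzMap.coeFn_toLp h 2 (volume : Measure Plane)] with x hx
  rw [hx, RCLike.inner_apply, hhx, Complex.conj_ofReal, Complex.real_smul, mul_comm]

/-- Truncating both infinite products approximates ψ̂ pointwise by exponential sums bounded by 1
whose frequencies stay in one ball; this takes the place of a Paley–Wiener argument. -/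
theorem IsMaxFlatFilter.compactSupport {K L : ℕ} {m₀ m₁ : ℝ → ℂ} (h : IsMaxFlatFilter K L m₀)
    (hK : 0 < K) (hL : 0 < L) (h₁ : ∀ ξ : ℝ, ‖m₁ ξ‖ ^ 2 = ‖m₀ (ξ + 1 / 2)‖ ^ 2)
    (hm₁ : IsTrigPoly m₁) {ψ : L2} (hψ : (𝓕 ψ : L2) =ᵐ[volume] shearletHat m₀ m₁) :
    ∃ r : ℝ, ∀ᵐ x ∂(volume : Measure Plane), r < ‖x‖ → ψ x = 0 := by
  obtain ⟨N₀, hN₀, hE₀⟩ := h.trigPoly.isTrigPoly.exists_mem_expSums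
  obtain ⟨N₁, hN₁, hE₁⟩ := hm₁.exists_mem_expSums
  set v : Plane := EuclideanSpace.single 0 1 with hv
  set w : Plane := EuclideanSpace.single 1 2 with hw
  have hvi : ∀ ξ : Plane, inner ℝ v ξ = ξ 0 := fun ξ => by simp [hv, EuclideanSpace.inner_single_left]
  have hvi4 : ∀ ξ : Plane, inner ℝ ((4 : ℝ) • v) ξ = 4 * ξ 0 := fun ξ => by
    rw [real_inner_smul_left, hvi]
  have hwi : ∀ ξ : Plane, inner ℝ w ξ = 2 * ξ 1 := fun ξ => by
    simp [hw, EuclideanSpace.inner_single_left]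
  refine ⟨N₁ * ‖(4 : ℝ) • v‖ + 2 * N₀ * ‖v‖ + 2 * N₀ * ‖w‖, ae_eq_zero_of_tendsto_expSums hψ
    (G := fun n ξ => m₁ (4 * ξ 0) * (∏ j ∈ Finset.range n, m₀ (ξ 0 / 2 ^ j)) *
      ∏ j ∈ Finset.range n, m₀ (2 * ξ 1 / 2 ^ j)) (fun n => ?_) (fun n ξ => ?_) fun ξ => ?_⟩
  · have h1 := mul_mem_expSums (mul_mem_expSums (hE₁ ((4 : ℝ) • v)) (prod_mem_expSums hN₀ hE₀ v n))
      (prod_mem_expSums hN₀ hE₀ w n)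
    simp only [hvi, hvi4, hwi] at h1
    exact h1
  · rw [norm_mul, norm_mul]
    exact mul_le_one₀ (mul_le_one₀ (h.highpass_le_one hK hL h₁ _) (norm_nonneg _)
      (h.norm_prod_le_one hK hL _ n)) (norm_nonneg _) (h.norm_prod_le_one hK hL _ n)
  · exact ((h.tendsto_prod (ξ 0)).const_mul _).mul (h.tendsto_prod (2 * ξ 1))

end Shearlet

/-! ### Assembly of the theorem. -/

theorem theorem4p6 (K L : ℕ) (hL : 10 ≤ L) (hK₁ : 3 * L ≤ 2 * K) (hK₂ : K ≤ 3 * L - 2)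
    (m₀ m₁ : ℝ → ℂ) (hm₀ : Shearlet.IsMaxFlatFilter K L m₀)
    (hm₁_meas : Measurable m₁) (hm₁ : ∀ ξ : ℝ, ‖m₁ ξ‖ ^ 2 = ‖m₀ (ξ + 1 / 2)‖ ^ 2) :
    (∀ ξ : ℝ, Multipliable fun j : ℕ => m₀ (ξ / 2 ^ j)) ∧
    ∃ ψ : Shearlet.L2,
      ((FourierTransform.fourier ψ : Shearlet.L2) : Shearlet.Plane → ℂ)
        =ᵐ[MeasureTheory.volume] Shearlet.shearletHat m₀ m₁ ∧
      (Shearlet.IsTrigPoly m₁ →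
        ∃ r : ℝ, ∀ᵐ x ∂(MeasureTheory.volume : MeasureTheory.Measure Shearlet.Plane),
          r < ‖x‖ → ψ x = 0) ∧
      Shearlet.Lsup (Shearlet.shearletHat m₀ m₁) < ⊤ ∧
      ∃ c₁_hat : ℝ, 0 < c₁_hat ∧ ∀ c₁ c₂ : ℝ, 0 < c₂ → c₂ ≤ c₁ → c₁ ≤ c₁_hat →
        Shearlet.IsFrameFor Shearlet.coneL2 (Shearlet.system c₁ c₂ ψ) ∧
        (∀ J₀ : ℕ, (1 - ‖m₀ (1 / 6)‖ ^ 2) / 2 ^ J₀ ≤ 1 / 2 →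
          Shearlet.R (Shearlet.shearletHat m₀ m₁) c₁ c₂
              < ENNReal.ofReal (Shearlet.explicitLinf m₀ J₀) ∧
          ENNReal.ofReal (Shearlet.explicitLinf m₀ J₀)
              ≤ Shearlet.Linf (Shearlet.shearletHat m₀ m₁)) ∧
        ∃ A B : ℝ, Shearlet.AreFrameBounds Shearlet.coneL2 (Shearlet.system c₁ c₂ ψ) A B ∧
          ∀ lo hi : ℝ,
            Shearlet.R (Shearlet.shearletHat m₀ m₁) c₁ c₂ < ENNReal.ofReal lo →
            ENNReal.ofReal lo ≤ Shearlet.Linf (Shearlet.shearletHat m₀ m₁) →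
            Shearlet.Lsup (Shearlet.shearletHat m₀ m₁) ≤ ENNReal.ofReal hi →
            1 / |(Shearlet.sampMat c₁ c₂).det| *
                (lo - (Shearlet.R (Shearlet.shearletHat m₀ m₁) c₁ c₂).toReal) ≤ A ∧
            A ≤ B ∧
            B ≤ 1 / |(Shearlet.sampMat c₁ c₂).det| *
                (hi + (Shearlet.R (Shearlet.shearletHat m₀ m₁) c₁ c₂).toReal) := by
  have hK0 : 0 < K := by omega
  have hL0 : 0 < L := by omega
  have hKL : K + 2 ≤ 3 * L := by omega
  have hg := hm₀.measurable_shearletHat hm₁_meas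
  obtain ⟨C, hdec⟩ := hm₀.exists_hasShearletDecay hL hK₁ hm₁
  -- As c does not depend on J₀, the threshold for c₁ can be fixed before J₀ is given.
  obtain ⟨c, hc, hcJ⟩ := hm₀.exists_le_explicitLinf hK0 (by omega) hKL
  obtain ⟨c_hat, hc_hat, hR⟩ := hdec.exists_R_lt hc
  set g := Shearlet.shearletHat m₀ m₁ with hgdef
  have hmem : MemLp g 2 volume := hdec.memLp hg
  have hfour : (𝓕 (𝓕⁻ (hmem.toLp : Shearlet.L2) : Shearlet.L2) : Shearlet.L2) = hmem.toLp :=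
    FourierTransform.fourier_fourierInv_eq _
  have hψ : ((𝓕 (𝓕⁻ (hmem.toLp : Shearlet.L2) : Shearlet.L2) : Shearlet.L2) :
      Shearlet.Plane → ℂ) =ᵐ[volume] g := by
    rw [hfour]
    exact hmem.coeFn_toLp
  set ψ : Shearlet.L2 := 𝓕⁻ (hmem.toLp : Shearlet.L2)
  have hsup : Shearlet.Lsup g < ⊤ := hdec.Lsup_lt_top
  refine ⟨hm₀.multipliable, ψ, hψ, fun h => hm₀.compactSupport hK0 hL0 hm₁ h hψ, hsup, c_hat,
    hc_hat, fun c₁ c₂ h₂ h₂₁ h₁ => ?_⟩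
  have hc₁ : 0 < c₁ := h₂.trans_le h₂₁
  have hRc := hR c₁ c₂ h₂ h₂₁ h₁
  have hRt : Shearlet.R g c₁ c₂ < ⊤ := hRc.trans ENNReal.ofReal_lt_top
  have hdet : 0 < |(Shearlet.sampMat c₁ c₂).det| := by
    rw [Shearlet.det_sampMat]
    positivity
  have hexp : ∀ J : ℕ, (1 - ‖m₀ (1 / 6)‖ ^ 2) / 2 ^ J ≤ 1 / 2 →
      Shearlet.R g c₁ c₂ < ENNReal.ofReal (Shearlet.explicitLinf m₀ J) ∧
        ENNReal.ofReal (Shearlet.explicitLinf m₀ J) ≤ Shearlet.Linf g := fun J hJ =>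
    ⟨hRc.trans_le (ENNReal.ofReal_le_ofReal (hcJ J hJ)),
      hm₀.explicitLinf_le_Linf hK0 (by omega) hKL hm₁ hJ⟩
  -- J₀ = 1 is always admissible because 1 - |m₀(1/6)|² ≤ 1; it supplies a lower estimate exceeding
  -- R(c), from which the frame property follows.
  have hexp₁ := hexp 1 (by
    have := sq_nonneg ‖m₀ (1 / 6)‖
    linarith)
  have hlower : ∀ lo : ℝ, Shearlet.R g c₁ c₂ < ENNReal.ofReal lo →
      ENNReal.ofReal lo ≤ Shearlet.Linf g →
      Shearlet.IsLowerFrameBound Shearlet.coneL2 (Shearlet.system c₁ c₂ ψ)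
        (1 / |(Shearlet.sampMat c₁ c₂).det| * (lo - (Shearlet.R g c₁ c₂).toReal)) :=
    fun lo hlo hlo' => Shearlet.isLowerFrameBound_of_le hdet hlo fun f hf =>
      (mul_le_mul_left hlo' _).trans
        (Shearlet.frame_sum_comparison hc₁ h₂ hψ hg hsup hRt hf).2
  have hupper : ∀ hi : ℝ, Shearlet.Lsup g ≤ ENNReal.ofReal hi →
      Shearlet.IsUpperFrameBound Shearlet.coneL2 (Shearlet.system c₁ c₂ ψ)
        (1 / |(Shearlet.sampMat c₁ c₂).det| * (hi + (Shearlet.R g c₁ c₂).toReal)) := by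
    intro hi hhi
    -- An upper frame bound must be positive, and 0 ≤ R(c) < L_inf ≤ L_sup ≤ hi.
    have hpos : 0 < ENNReal.ofReal hi := (zero_le.trans_lt hexp₁.1).trans_le
      (hexp₁.2.trans ((Shearlet.Linf_le_Lsup g).trans hhi))
    exact Shearlet.isUpperFrameBound_of_le hdet (ENNReal.ofReal_pos.1 hpos) hRt.ne fun f hf =>
      (Shearlet.frame_sum_comparison hc₁ h₂ hψ hg hsup hRt hf).1.trans
        (mul_le_mul_left (add_le_add_left hhi _) _)
  have hframe : Shearlet.IsFrameFor Shearlet.coneL2 (Shearlet.system c₁ c₂ ψ) :=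
    ⟨⟨_, hlower _ hexp₁.1 hexp₁.2⟩, ⟨_, hupper (Shearlet.Lsup g).toReal
      (ENNReal.ofReal_toReal hsup.ne).ge⟩⟩
  obtain ⟨f₀, hf₀, hf₀'⟩ := Shearlet.exists_ne_zero_mem_coneL2
  obtain ⟨A, B, hAB, hle⟩ := Shearlet.exists_areFrameBounds hf₀ hf₀' hframe
  exact ⟨hframe, hexp, A, B, hAB, fun lo hi hlo hlo' hhi =>
    ⟨hAB.1.2 (hlower lo hlo hlo'), hle, hAB.2.2 (hupper hi hhi)⟩⟩
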